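/- Let $p\ge 2$ be an integer. A $(p,\infty)$-hypermap on $n\ge 1$ darts is a triple $\langle D;\alpha,\sigma\rangle$, where $D$ is a set of $n$ elements and $\alpha,\sigma$ are permutations of $D$ such that $\langle\alpha,\sigma\rangle$ acts transitively on $D$ and all cycles of $\alpha$ have length exactly $p$. Two such hypermaps are isomorphic if some bijection of their sets of darts conjugates $\alpha_1$ to $\alpha_2$ and $\sigma_1$ to $\sigma_2$. Let $h_p(n)$ be the number of isomorphism classes of $(p,\infty)$-hypermaps on $n$ darts ($h_p(0)=0$), and let $\widetilde H(z)=\sum_{n\ge 0}h_p(n)z^n$. Then, as formal power series, $$\widetilde H(z)=\sum_{k=1}^{\infty}\frac{\mu(k)}{k}\sum_{n=1}^{\infty}\log(P_n\odot Q_n)(z_n)\Big|_{z_n=z^{nk}},$$ where $\mu$ is the Möbius function, $\phi$ is the Euler totient function, $$P_n(z_n)=\exp\Big(\frac1{np}\sum_{d\mid\gcd(n,p)}d\,\phi(d)\,z_n^{p/d}\Big),\qquad Q_n(z_n)=\sum_{d=0}^{\infty}z_n^d=\frac1{1-z_n},$$ and $\odot$ denotes the Hadamard product $$\Big(\sum_{j\ge0}a_j\frac{z_n^j}{n^j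 j!}\Big)\odot\Big(\sum_{j\ge0}b_j\frac{z_n^j}{n^j j!}\Big)=\sum_{j\ge0}a_jb_j\frac{z_n^j}{n^j j!}.$$ (Both infinite sums are formal: each coefficient receives only finitely many non-zero contributions.) The non-zero coefficients of $\widetilde H$ are exactly those of $z^{pk}$ with $k\ge 1$, and, as $k\to\infty$, $$[z^{pk}]\widetilde H(z)\sim\frac{(2\pi)^{(p-1)/2}}{\prod_{i=1}^{p}\Gamma(i/p)}\;k^{(p-1)k}\,e^{(p-1)(\log p-1)k}.$$ -/

import Mathlib

open PowerSeries

/-- A connected oriented combinatorial hypermap with set of darts `D`: two permutations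
`α` (whose orbits are the hyper-edges) and `σ` (whose orbits are the vertices) of a non-empty
set `D` such that the group generated by `α` and `σ` acts transitively on `D`. -/
structure Hypermap (D : Type*) where
  /-- the permutation whose orbits are the hyper-edges -/
  α : Equiv.Perm D
  /-- the permutation whose orbits are the vertices -/
  σ : Equiv.Perm D
  nonempty_darts : Nonempty D
  transitive : MulAction.IsPretransitive (Subgroup.closure ({α, σ} : Set (Equiv.Perm D))) D

namespace Hypermap

/-- A `(p, ∞)`-hypermap: all hyper-edges are `p`-gons, that is, every orbit of `α` has exactly
`p` elements. There is no condition on the vertices or on the hyper-faces. -/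
def IsPInfinity {D : Type*} (p : ℕ) (H : Hypermap D) : Prop :=
  ∀ x : D, {y : D | H.α.SameCycle x y}.ncard = p

/-- Isomorphism of (unlabelled, unrooted) hypermaps: a bijection `ψ` of the sets of darts
with `ψ α₁ ψ⁻¹ = α₂` and `ψ σ₁ ψ⁻¹ = σ₂`. -/
def Isomorphic {D₁ D₂ : Type*} (H₁ : Hypermap D₁) (H₂ : Hypermap D₂) : Prop :=
  ∃ ψ : D₁ ≃ D₂, (ψ.symm.trans H₁.α).trans ψ = H₂.α ∧ (ψ.symm.trans H₁.σ).trans ψ = H₂.σ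

/-- The isomorphism relation on the `(p, ∞)`-hypermaps with set of darts `Fin n`. -/
def isoSetoid (p n : ℕ) : Setoid {H : Hypermap (Fin n) // H.IsPInfinity p} where
  r H₁ H₂ := H₁.1.Isomorphic H₂.1
  iseqv :=
    { refl := fun _ => ⟨Equiv.refl _, rfl, rfl⟩
      symm := by
        rintro H₁ H₂ ⟨ψ, hα, hσ⟩
        refine ⟨ψ.symm, ?_, ?_⟩
        · rw [← hα]; ext x; simp
        · rw [← hσ]; ext x; simp
      trans := by
        rintro H₁ H₂ H₃ ⟨ψ, hα, hσ⟩ ⟨χ, hα', hσ'⟩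
        refine ⟨ψ.trans χ, ?_, ?_⟩
        · rw [← hα', ← hα]; ext x; simp
        · rw [← hσ', ← hσ]; ext x; simp }

/-- The number of isomorphism classes of `(p, ∞)`-hypermaps on `n` darts. -/
noncomputable def numIsoClasses (p n : ℕ) : ℕ := Nat.card (Quotient (isoSetoid p n))

/-- The growth series `∑ n, (number of isomorphism classes of (p, ∞)-hypermaps on n darts) z ^ n`. -/
noncomputable def isoSeries (p : ℕ) : ℚ⟦X⟧ := PowerSeries.mk fun n => (numIsoClasses p n : ℚ)

end Hypermap

/-- The formal series `g` is the sum of the family `f` of formal series: for every `N`, only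
finitely many members of the family have a non-zero coefficient at `z ^ N`, and these
coefficients add up to the coefficient of `g`. -/
def HasFormalSum {ι : Type*} (f : ι → ℚ⟦X⟧) (g : ℚ⟦X⟧) : Prop :=
  ∀ N : ℕ, {i | coeff N (f i) ≠ 0}.Finite ∧ ∑ᶠ i, coeff N (f i) = coeff N g

/-- The Hadamard product with respect to `z ^ λ / λ!`, for two series in the single
variable `z = z_n`: the monomial `z_n ^ j` belongs to the partition `λ = n ^ j`, for which
`λ! = n ^ j * j!`. Hence if `A = ∑ a_j z ^ j / (n ^ j j!)` and `B = ∑ b_j z ^ j / (n ^ j j!)` then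
`A ⊙ B = ∑ a_j b_j z ^ j / (n ^ j j!)`. -/
noncomputable def hadamardAt (n : ℕ) (A B : ℚ⟦X⟧) : ℚ⟦X⟧ :=
  PowerSeries.mk fun j =>
    ((n : ℚ) ^ j * (j.factorial : ℚ) * coeff j A) * ((n : ℚ) ^ j * (j.factorial : ℚ) * coeff j B)
      / ((n : ℚ) ^ j * (j.factorial : ℚ))

/-- `P_n(z) = exp ((1 / (n p)) ∑_{d ∣ gcd(n, p)} d φ(d) z ^ (p / d))`. -/
noncomputable def seriesP (p n : ℕ) : ℚ⟦X⟧ :=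
  (PowerSeries.exp ℚ).subst
    (C (1 / ((n : ℚ) * p)) *
      ∑ d ∈ (Nat.gcd n p).divisors, C ((d : ℚ) * (Nat.totient d : ℚ)) * (X : ℚ⟦X⟧) ^ (p / d))

/-- `Q_n(z) = 1 / (1 - z)`, the same series for all `n`. -/
noncomputable def seriesQ : ℚ⟦X⟧ := (1 - X)⁻¹

/-- The logarithm of a formal series `F` with constant coefficient `1`. -/
noncomputable def formalLog (F : ℚ⟦X⟧) : ℚ⟦X⟧ := (PowerSeries.log ℚ).subst (F - 1)

/-- `log (P_n ⊙ Q_n)(z_n)` at `z_n = z ^ (n k)`. -/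
noncomputable def logTerm (p : ℕ) (n k : ℕ) : ℚ⟦X⟧ :=
  (formalLog (hadamardAt n (seriesP p n) seriesQ)).subst ((X : ℚ⟦X⟧) ^ (n * k))

/-!
The permutations `α`, `σ` of a hypermap are counted together with a third permutation `g` that
commutes with both. By the lemma of Burnside the triples `(α, σ, g)` on `n` labelled darts in which
`α` and `σ` alone are transitive number `n!` times the isomorphism classes (`blockCount_triple`). A
triple that is transitive as a whole consists of `n / m` copies of a hypermap on `m` darts, permuted
cyclically by `g`; the exponential formula (`theta_goodSeries`) therefore gives, for the exponential
generating function `U` of all the triples, `n [z ^ n] log U = ∑ m c_m` over the divisors `m` of `n`,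
where `c_m` is the number of hypermaps on `m` darts (`mul_coeff_formalLog_allSeries`). Möbius
inversion recovers the `c_m` (`hasFormalSum_isoSeries`).

On the other hand, for fixed `g` the permutations `α` and `σ` range independently over the
centralizer of `g`. The weight of `σ` is the order of the centralizer, which turns a sum over `g` into
a sum over partitions (`sum_mul_card_centralizer`). The choices of `α` factor over the cycle lengths
`i` of `g`, and on `j` cycles of length `i` they number `i ^ j j! [z ^ j] P_i`, the coefficient of
`P_i ⊙ Q_i` (`commCount_uniform`); this again is the exponential formula, for pairs of commuting
permutations (`seriesP_subst_eq`). Hence `U` is the product of the `(P_i ⊙ Q_i)(z ^ i)`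
(`goodSeries_triple_eq_genFun`), and its logarithm is the inner sum of the theorem.

The hypermap with `σ` a cycle on `p k` darts and `α = σ ^ k` shows that the coefficient at `p k` is
not zero. For the asymptotic behaviour, let `a_k = (p k)! / (p ^ k k!)` be the number of permutations
`α`. The pairs `(α, σ)` that are not transitive make up a share of order `1 / k`
(`uniformCount_sub_le_numIsoClasses`). An automorphism of a hypermap has cycles of one and the same
length `d`, and the orders of the centralizers of such permutations bound the share of the hypermaps
with a non-trivial automorphism (`numIsoClasses_le_uniformCount_mul`). So the number of isomorphism
classes is equivalent to `a_k`, the formula of Stirling applies, and the constant is `√p` by the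
reflection formula of the Gamma function (`two_pi_rpow_div_prod_Gamma`).
-/

open Equiv Function

/-! ### Families of permutations and the exponential formula -/

/-- Transitivity of a family of permutations: every non-empty set closed under the family is the
whole set. It holds vacuously when `D` is empty. -/
def TransFam {κ D : Type} (c : κ → Perm D) : Prop :=
  ∀ S : Set D, S.Nonempty → (∀ k, ∀ z ∈ S, c k z ∈ S) → S = Set.univ

/-- The smallest set containing `x` that is closed under the family `c`. -/
def orb {κ D : Type} (c : κ → Perm D) (x : D) : Set D :=
  {y | ∀ S : Set D, x ∈ S → (∀ k, ∀ z ∈ S, c k z ∈ S) → y ∈ S}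

/-- A family of permutations, subject to conditions that can be checked on each invariant subset:
all cycle lengths of the `k`-th one lie in `Ψ k`, and those related by `R` commute. -/
def Good {κ D : Type} (Ψ : κ → Set ℕ) (R : κ → κ → Prop) (c : κ → Perm D) : Prop :=
  (∀ k y, minimalPeriod (c k) y ∈ Ψ k) ∧ ∀ k k', R k k' → ∀ y, c k (c k' y) = c k' (c k y)

section
variable {κ D D' : Type} (Ψ : κ → Set ℕ) (R : κ → κ → Prop)

lemma mem_orb_self (c : κ → Perm D) (x : D) : x ∈ orb c x := fun _ h _ => h

lemma apply_mem_orb {c : κ → Perm D} {x z : D} (hz : z ∈ orb c x) (k : κ) : c k z ∈ orb c x :=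
  fun S hx hS => hS k z (hz S hx hS)

lemma orb_subset {c : κ → Perm D} {x : D} {S : Set D} (hx : x ∈ S)
    (hS : ∀ k, ∀ z ∈ S, c k z ∈ S) : orb c x ⊆ S := fun _ hy => hy S hx hS

/-- A finite set mapped into itself by a permutation contains the preimages of its elements. -/
lemma mem_of_apply_mem [Finite D] {f : Perm D} {S : Set D} (hS : ∀ z ∈ S, f z ∈ S) {z : D}
    (hz : f z ∈ S) : z ∈ S := by
  have hb : Set.SurjOn f S S :=
    ((Set.toFinite S).surjOn_iff_bijOn_of_mapsTo (fun z hz => hS z hz)).2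
      ((Set.toFinite S).injOn_iff_bijOn_of_mapsTo (fun z hz => hS z hz) |>.1 f.injective.injOn)
  obtain ⟨w, hw, hwz⟩ := hb hz
  rwa [← f.injective hwz]

lemma orb_eq_of_mem [Finite D] {c : κ → Perm D} {x y : D} (hy : y ∈ orb c x) :
    orb c y = orb c x := by
  refine (orb_subset hy fun k z hz => apply_mem_orb hz k).antisymm ?_
  by_contra hsub
  have hx : x ∉ orb c y := fun hx => hsub (orb_subset hx fun k z hz => apply_mem_orb hz k)
  -- the complement of `orb c y` is closed under `c`, so it contains `orb c x`
  exact orb_subset (S := (orb c y)ᶜ) hx (fun k z hz hz' =>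
    hz (mem_of_apply_mem (fun w hw => apply_mem_orb hw k) hz')) hy (mem_orb_self c y)

lemma minimalPeriod_of_semiconj {f : D → D} {g : D' → D'} {e : D → D'} (he : Injective e)
    (h : ∀ y, e (f y) = g (e y)) (y : D) : minimalPeriod g (e y) = minimalPeriod f y := by
  rw [minimalPeriod_eq_minimalPeriod_iff]
  intro n
  have : ∀ n y, g^[n] (e y) = e (f^[n] y) := by
    intro n
    induction n with
    | zero => simp
    | succ n ih => intro y; rw [iterate_succ_apply, iterate_succ_apply, ← h, ih]
  simp only [IsPeriodicPt, IsFixedPt, this]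
  exact he.eq_iff

lemma good_of_semiconj {c : κ → Perm D} {c' : κ → Perm D'} {e : D → D'} (he : Injective e)
    (h : ∀ k y, e (c k y) = c' k (e y)) (hc : Good Ψ R c') : Good Ψ R c := by
  refine ⟨fun k y => ?_, fun k k' hk y => he ?_⟩
  · rw [← minimalPeriod_of_semiconj he (h k)]; exact hc.1 k _
  · rw [h, h, h, h, hc.2 k k' hk]

lemma isTrans_of_semiconj {c : κ → Perm D} {c' : κ → Perm D'} {e : D → D'} (he : Surjective e)
    (h : ∀ k y, e (c k y) = c' k (e y)) (hc : TransFam c) : TransFam c' := by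
  intro S hS hcl
  have := hc (e ⁻¹' S) (hS.preimage he) (fun k z hz => by
    simp only [Set.mem_preimage, h]; exact hcl k _ hz)
  rw [Set.eq_univ_iff_forall] at this ⊢
  intro y
  obtain ⟨z, rfl⟩ := he y
  exact this z

/-- Families of permutations are transported along a bijection of the underlying sets. -/
def permFamilyCongr (κ : Type) (e : D ≃ D') : (κ → Perm D) ≃ (κ → Perm D') :=
  Equiv.piCongrRight fun _ => e.permCongr

lemma permFamilyCongr_apply (e : D ≃ D') (c : κ → Perm D) (k : κ) (y : D) :
    permFamilyCongr κ e c k (e y) = e (c k y) := by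
  simp [permFamilyCongr]

lemma permFamilyCongr_apply' (e : D ≃ D') (c : κ → Perm D) (k : κ) (y : D') :
    e.symm (permFamilyCongr κ e c k y) = c k (e.symm y) := by
  simp [permFamilyCongr]

lemma good_permFamilyCongr (e : D ≃ D') (c : κ → Perm D) :
    Good Ψ R (permFamilyCongr κ e c) ↔ Good Ψ R c := by
  refine ⟨good_of_semiconj Ψ R e.injective (fun k y => (permFamilyCongr_apply e c k y).symm),
    good_of_semiconj Ψ R e.symm.injective (permFamilyCongr_apply' e c)⟩

lemma isTrans_permFamilyCongr (e : D ≃ D') (c : κ → Perm D) :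
    TransFam (permFamilyCongr κ e c) ↔ TransFam c := by
  exact ⟨isTrans_of_semiconj e.symm.surjective (permFamilyCongr_apply' e c),
    isTrans_of_semiconj e.surjective (fun k y => (permFamilyCongr_apply e c k y).symm)⟩

/-- The number of good families on `n` labelled points. -/
noncomputable def goodCount (n : ℕ) : ℕ := Nat.card {c : κ → Perm (Fin n) // Good Ψ R c}

/-- The number of transitive good families on `n` labelled points. -/
noncomputable def transCount (n : ℕ) : ℕ :=
  Nat.card {c : κ → Perm (Fin n) // Good Ψ R c ∧ TransFam c}

lemma card_good_eq [Finite D] :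
    Nat.card {c : κ → Perm D // Good Ψ R c} = goodCount Ψ R (Nat.card D) :=
  Nat.card_congr ((permFamilyCongr κ (Finite.equivFin D)).subtypeEquiv fun c =>
    (good_permFamilyCongr Ψ R _ c).symm)

lemma card_good_trans_eq [Finite D] :
    Nat.card {c : κ → Perm D // Good Ψ R c ∧ TransFam c} = transCount Ψ R (Nat.card D) :=
  Nat.card_congr ((permFamilyCongr κ (Finite.equivFin D)).subtypeEquiv fun c => by
    rw [good_permFamilyCongr, isTrans_permFamilyCongr])

lemma transCount_le_goodCount [Finite κ] (n : ℕ) : transCount Ψ R n ≤ goodCount Ψ R n :=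
  Nat.card_le_card_of_injective (fun c => ⟨c.1, c.2.1⟩) fun a b h => by
    simpa [Subtype.ext_iff] using h

/-- Families for which the orbit of `x` is `S` are glued from a transitive family on `S` and an
arbitrary family on the complement. -/
lemma card_good_orb_eq [Finite D] [Finite κ] (x : D) (S : Finset D) [DecidableEq D] (hx : x ∈ S) :
    Nat.card {c : κ → Perm D // Good Ψ R c ∧ orb c x = S} =
      transCount Ψ R S.card * goodCount Ψ R (Nat.card D - S.card) := by
  have h1 := card_good_trans_eq (D := {y // y ∈ S}) Ψ R
  have h2 := card_good_eq (D := {y // ¬ y ∈ S}) Ψ R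
  have hS : Nat.card {y // y ∈ S} = S.card := by simp
  have hS' : Nat.card {y // ¬ y ∈ S} = Nat.card D - S.card := by
    have := Fintype.ofFinite D
    rw [Nat.card_eq_fintype_card, Nat.card_eq_fintype_card, Fintype.card_subtype_compl]
    simp
  rw [hS] at h1
  rw [hS'] at h2
  rw [← h1, ← h2, ← Nat.card_prod]
  symm
  let glue (a : κ → Perm {y // y ∈ S}) (b : κ → Perm {y // ¬ y ∈ S}) : κ → Perm D :=
    fun k => Perm.subtypeCongr (a k) (b k)
  have gl (a : κ → Perm {y // y ∈ S}) (b : κ → Perm {y // ¬ y ∈ S}) (k) (y : {y // y ∈ S}) :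
      (a k y : D) = glue a b k y := by simp [glue]
  have gr (a : κ → Perm {y // y ∈ S}) (b : κ → Perm {y // ¬ y ∈ S}) (k) (y : {y // ¬ y ∈ S}) :
      (b k y : D) = glue a b k y := by simp [glue, y.2]
  have gS (a : κ → Perm {y // y ∈ S}) (b : κ → Perm {y // ¬ y ∈ S}) (k) (z : D) (hz : z ∈ S) :
      glue a b k z ∈ S := by rw [← gl a b k ⟨z, hz⟩]; exact (a k ⟨z, hz⟩).2
  refine Nat.card_congr (Equiv.ofBijective (fun q => ⟨glue q.1.1 q.2.1, ⟨⟨?_, ?_⟩, ?_⟩⟩) ⟨?_, ?_⟩)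
  · intro k y
    by_cases hy : y ∈ S
    · have := minimalPeriod_of_semiconj Subtype.val_injective (gl q.1.1 q.2.1 k) ⟨y, hy⟩
      rw [this]; exact q.1.2.1.1 k _
    · have := minimalPeriod_of_semiconj Subtype.val_injective (gr q.1.1 q.2.1 k) ⟨y, hy⟩
      rw [this]; exact q.2.2.1 k _
  · intro k k' hk y
    by_cases hy : y ∈ S
    · have := q.1.2.1.2 k k' hk ⟨y, hy⟩
      have := congrArg Subtype.val this
      simpa only [gl q.1.1 q.2.1] using this
    · have := q.2.2.2 k k' hk ⟨y, hy⟩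
      have := congrArg Subtype.val this
      simpa only [gr q.1.1 q.2.1] using this
  · refine (orb_subset (by exact_mod_cast hx) fun k z hz => gS _ _ k z hz).antisymm ?_
    have := q.1.2.2 (Subtype.val ⁻¹' orb (glue q.1.1 q.2.1) x) ⟨⟨x, hx⟩, mem_orb_self _ _⟩
      (fun k z hz => by
        simp only [Set.mem_preimage, gl q.1.1 q.2.1] at hz ⊢
        exact apply_mem_orb hz k)
    intro y hy
    exact Set.eq_univ_iff_forall.1 this ⟨y, hy⟩
  · rintro ⟨⟨a, ha⟩, ⟨b, hb⟩⟩ ⟨⟨a', ha'⟩, ⟨b', hb'⟩⟩ h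
    have h' : ∀ k y, glue a b k y = glue a' b' k y := by
      intro k y
      have := congrArg Subtype.val h
      exact congrFun (congrArg DFunLike.coe (congrFun this k)) y
    have e1 : a = a' := by
      ext k y
      rw [gl a b, gl a' b', h']
    have e2 : b = b' := by
      ext k y
      rw [gr a b, gr a' b', h']
    subst e1 e2
    rfl
  · rintro ⟨c, hc, hcx⟩
    have hin : ∀ k z, z ∈ S ↔ c k z ∈ S := by
      intro k z
      have hcl : ∀ z ∈ (S : Set D), c k z ∈ (S : Set D) := fun z hz => by
        rw [← hcx] at hz ⊢; exact apply_mem_orb hz k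
      exact ⟨fun hz => hcl z hz, fun hz => mem_of_apply_mem hcl hz⟩
    let a : κ → Perm {y // y ∈ S} := fun k => (c k).subtypePerm fun z => (hin k z).symm
    let b : κ → Perm {y // ¬ y ∈ S} := fun k => (c k).subtypePerm fun z => not_congr (hin k z).symm
    have ha : ∀ k (y : {y // y ∈ S}), (a k y : D) = c k y := fun k y => rfl
    have hb : ∀ k (y : {y // ¬ y ∈ S}), (b k y : D) = c k y := fun k y => rfl
    refine ⟨⟨⟨a, good_of_semiconj Ψ R Subtype.val_injective ha hc, ?_⟩,
      ⟨b, good_of_semiconj Ψ R Subtype.val_injective hb hc⟩⟩, ?_⟩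
    · intro T hT hcl
      obtain ⟨t, ht⟩ := hT
      have hsub : orb c t ⊆ Subtype.val '' T := orb_subset ⟨t, ht, rfl⟩ (by
        rintro k _ ⟨z, hz, rfl⟩
        exact ⟨a k z, hcl k z hz, ha k z⟩)
      have : (t : D) ∈ orb c x := by rw [hcx]; exact t.2
      rw [orb_eq_of_mem this, hcx] at hsub
      rw [Set.eq_univ_iff_forall]
      intro y
      obtain ⟨z, hz, hzy⟩ := hsub y.2
      rwa [← Subtype.ext hzy]
    · ext k y
      change glue a b k y = c k y
      by_cases hy : y ∈ S
      · rw [← gl a b k ⟨y, hy⟩, ha]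
      · rw [← gr a b k ⟨y, hy⟩, hb]

/-- Sums over the subsets that contain a given point, of a function of the cardinality. -/
lemma sum_finset_mem_eq [Fintype D] [DecidableEq D] (x : D) {N : ℕ} (hN : Fintype.card D = N + 1)
    {M : Type} [AddCommMonoid M] (G : ℕ → M) :
    ∑ S : Finset D, (if x ∈ S then G S.card else 0) =
      ∑ k ∈ Finset.range (N + 1), N.choose k • G (k + 1) := by
  rw [← Finset.sum_filter]
  have hc : (Finset.univ.erase x : Finset D).card = N := by
    rw [Finset.card_erase_of_mem (Finset.mem_univ x), Finset.card_univ, hN]; rfl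
  have := Finset.sum_powerset_apply_card (fun k => G (k + 1)) (x := (Finset.univ.erase x : Finset D))
  rw [hc] at this
  rw [← this]
  refine Finset.sum_bij' (fun S _ => S.erase x) (fun S _ => insert x S) ?_ ?_ ?_ ?_ ?_
  · intro S _
    simpa using Finset.erase_subset_erase x (Finset.subset_univ S)
  · intro S _; simp
  · intro S hS
    exact Finset.insert_erase (by simpa using hS)
  · intro S hS
    have : S ⊆ Finset.univ.erase x := by simpa using hS
    exact Finset.erase_insert fun h => by simpa using this h
  · intro S hS
    have hS : x ∈ S := by simpa using hS
    rw [Finset.card_erase_add_one hS]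

lemma card_eq_sum_fiber {A B : Type} [Finite A] [Fintype B] (f : A → B) :
    Nat.card A = ∑ b, Nat.card {a // f a = b} := by
  rw [← Nat.card_sigma]
  exact Nat.card_congr (Equiv.sigmaFiberEquiv f).symm

lemma card_subtype_eq_sum {A B : Type} [Finite A] [Fintype B] (P : A → Prop) (f : A → B) :
    Nat.card {a // P a} = ∑ b, Nat.card {a // P a ∧ f a = b} := by
  rw [card_eq_sum_fiber (fun a : {a // P a} => f a.1)]
  refine Finset.sum_congr rfl fun b _ => Nat.card_congr ?_
  exact Equiv.subtypeSubtypeEquivSubtypeInter P (fun a => f a = b)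

/-- The exponential formula: splitting off the orbit of one point. -/
theorem goodCount_succ [Finite κ] (N : ℕ) :
    goodCount Ψ R (N + 1) = ∑ k ∈ Finset.range (N + 1),
      N.choose k * (transCount Ψ R (k + 1) * goodCount Ψ R (N - k)) := by
  classical
  have h := sum_finset_mem_eq (D := Fin (N + 1)) 0 (Fintype.card_fin _)
    (fun k => transCount Ψ R k * goodCount Ψ R (N + 1 - k))
  simp only [Nat.add_sub_add_right, smul_eq_mul] at h
  rw [← h, goodCount, card_subtype_eq_sum _
    (fun c : κ → Perm (Fin (N + 1)) => (Set.toFinite (orb c 0)).toFinset)]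
  refine Finset.sum_congr rfl fun S _ => ?_
  have e : ∀ c : κ → Perm (Fin (N + 1)),
      (Set.toFinite (orb c 0)).toFinset = S ↔ orb c 0 = S := by
    intro c
    rw [← Finset.coe_inj, Set.Finite.coe_toFinset]
  simp only [e]
  split_ifs with hS
  · rw [card_good_orb_eq Ψ R 0 S hS, Nat.card_fin]
  · rw [Nat.card_eq_zero]
    left
    refine ⟨fun c => hS ?_⟩
    have := mem_orb_self c.1 0
    rw [c.2.2] at this
    exact_mod_cast this

/-- The exponential formula as a recurrence for the coefficients of the exponential generating
function. -/
theorem goodCount_div_factorial_succ [Finite κ] (N : ℕ) :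
    ((N + 1 : ℕ) : ℚ) * (goodCount Ψ R (N + 1) / (N + 1).factorial) =
      ∑ k ∈ Finset.range (N + 1), (transCount Ψ R (k + 1) / (k.factorial : ℚ)) *
        (goodCount Ψ R (N - k) / ((N - k).factorial : ℚ)) := by
  rw [goodCount_succ, Nat.factorial_succ]
  push_cast
  have hN : (N.factorial : ℚ) ≠ 0 := by positivity
  rw [← mul_div_assoc, mul_div_mul_left _ _ (by positivity), Finset.sum_div]
  refine Finset.sum_congr rfl fun k hk => ?_
  have hk : k ≤ N := by simpa [Nat.lt_succ_iff] using hk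
  rw [Nat.cast_choose ℚ hk]
  field_simp

lemma goodCount_zero : goodCount Ψ R 0 = 1 := by
  rw [goodCount, Nat.card_eq_one_iff_unique]
  refine ⟨⟨fun a b => Subtype.ext (Subsingleton.elim _ _)⟩, ⟨fun _ => 1, ?_, ?_⟩⟩
  · intro k y; exact y.elim0
  · intro k k' _ y; exact y.elim0

/-- There are `(n - 1)!` permutations of `n` points that are single cycles. -/
lemma card_isTrans_perm (n : ℕ) :
    Nat.card {c : Unit → Perm (Fin (n + 1)) // TransFam c} = n.factorial := by
  let Ψ : Unit → Set ℕ := fun _ => Set.univ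
  let R : Unit → Unit → Prop := fun _ _ => False
  have hgood : ∀ m (c : Unit → Perm (Fin m)), Good Ψ R c :=
    fun m c => ⟨fun _ _ => trivial, fun _ _ h => h.elim⟩
  have hF : ∀ m, goodCount Ψ R m = m.factorial := by
    intro m
    rw [goodCount, Nat.card_congr (Equiv.subtypeUnivEquiv (hgood m)), Nat.card_fun]
    simp [Nat.card_eq_fintype_card, Fintype.card_perm]
  have hT : Nat.card {c : Unit → Perm (Fin (n + 1)) // TransFam c} = transCount Ψ R (n + 1) := by
    rw [transCount]
    exact Nat.card_congr (Equiv.subtypeEquivRight fun c => by simp [hgood])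
  have hrec : ∀ N : ℕ, ((N + 1 : ℕ) : ℚ) =
      ∑ k ∈ Finset.range (N + 1), (transCount Ψ R (k + 1) / (k.factorial : ℚ)) := by
    intro N
    have h := goodCount_div_factorial_succ Ψ R N
    simp only [hF] at h
    rw [div_self (by positivity), mul_one] at h
    rw [h]
    refine Finset.sum_congr rfl fun k _ => ?_
    rw [div_self (by positivity), mul_one]
  have : (transCount Ψ R (n + 1) / (n.factorial : ℚ)) = 1 := by
    have h1 := hrec n
    rw [Finset.sum_range_succ] at h1
    cases n with
    | zero => simpa using h1.symm
    | succ m => rw [← hrec m] at h1; push_cast at h1; linarith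
  rw [hT]
  rw [div_eq_one_iff_eq (by positivity)] at this
  exact_mod_cast this

end

/-! ### Transitive families with a commuting member -/

/-- The permutation of `j + 1` copies of `S` that moves each copy to the next one, and the last one
to the first through `h`. -/
def twist {S : Type} (j : ℕ) (h : Perm S) : Perm (Fin (j + 1) × S) :=
  Equiv.prodShear (finRotate (j + 1)) fun t => if t = Fin.last j then h else 1

/-- On `j + 1` copies of `S`, the members `some i` of the family act on each copy, and the member
`none` permutes the copies cyclically. -/
def blockFam {ι S : Type} (j : ℕ) (c : Option ι → Perm S) : Option ι → Perm (Fin (j + 1) × S)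
  | none => twist j (c none)
  | some i => Equiv.prodCongr (Equiv.refl _) (c (some i))

/-- The relation expressing that the member `none` commutes with all the others. -/
def noneRel (ι : Type) (k _k' : Option ι) : Prop := k = none

/-- The conditions on cycle lengths that a family on one of `j` blocks has to satisfy in order that
the family on the union of the blocks satisfies `Ψ`. -/
def blockLengths {ι : Type} (j : ℕ) (Ψ : Option ι → Set ℕ) : Option ι → Set ℕ
  | none => {q | j * q ∈ Ψ none}
  | some i => Ψ (some i)

/-- The number of families on `m` labelled points whose members `some i` already act transitively,
and which are good for the cycle lengths of one of `j` blocks. -/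
noncomputable def blockCount {ι : Type} (Ψ : Option ι → Set ℕ) (j m : ℕ) : ℕ :=
  Nat.card {c : Option ι → Perm (Fin m) //
    Good (blockLengths j Ψ) (noneRel ι) c ∧ TransFam fun i => c (some i)}

section
variable {ι S D : Type} (Ψ : Option ι → Set ℕ)

lemma twist_iterate (j : ℕ) (h : Perm S) (o : S) (t : ℕ) (ht : t < j + 1) :
    (twist j h)^[t] (0, o) = (⟨t, ht⟩, o) := by
  induction t with
  | zero => rfl
  | succ t ih =>
    rw [iterate_succ_apply', ih (by omega)]
    have h1 : (⟨t, by omega⟩ : Fin (j + 1)) ≠ Fin.last j := by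
      simp [Fin.ext_iff]; omega
    simp only [twist, Equiv.prodShear_apply, h1, if_false, Perm.coe_one, id]
    rw [Prod.mk.injEq]
    refine ⟨?_, rfl⟩
    rw [finRotate_of_lt (by omega)]

lemma twist_last (j : ℕ) (h : Perm S) (o : S) : twist j h (Fin.last j, o) = (0, h o) := by
  simp [twist]

lemma twist_iterate_succ (j : ℕ) (h : Perm S) (o : S) :
    (twist j h)^[j + 1] (0, o) = (0, h o) := by
  rw [iterate_succ_apply', twist_iterate j h o j (by omega)]
  exact twist_last j h o

lemma twist_iterate_mul (j : ℕ) (h : Perm S) (o : S) (q : ℕ) :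
    (twist j h)^[(j + 1) * q] (0, o) = (0, h^[q] o) := by
  induction q with
  | zero => rfl
  | succ q ih =>
    rw [Nat.mul_succ, Nat.add_comm ((j + 1) * q), iterate_add_apply, ih, twist_iterate_succ,
      iterate_succ_apply']

lemma perm_mem_periodicPts [Finite D] (f : Perm D) (y : D) : y ∈ periodicPts f :=
  mk_mem_periodicPts (orderOf_pos f) (by
    rw [IsPeriodicPt, IsFixedPt, Perm.iterate_eq_pow, pow_orderOf_eq_one]; rfl)

lemma minimalPeriod_perm_pos [Finite D] (f : Perm D) (y : D) : 0 < minimalPeriod f y :=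
  minimalPeriod_pos_of_mem_periodicPts (perm_mem_periodicPts f y)

lemma minimalPeriod_twist [Finite S] (j : ℕ) (h : Perm S) (q : Fin (j + 1) × S) :
    minimalPeriod (twist j h) q = (j + 1) * minimalPeriod h q.2 := by
  obtain ⟨t, o⟩ := q
  have h0 := twist_iterate j h o t t.2
  rw [show (⟨t, t.2⟩ : Fin (j + 1)) = t from rfl] at h0
  rw [← h0, minimalPeriod_apply_iterate (perm_mem_periodicPts _ _), h0]
  refine Nat.dvd_antisymm ?_ ?_
  · rw [← isPeriodicPt_iff_minimalPeriod_dvd, IsPeriodicPt, IsFixedPt, twist_iterate_mul,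
      iterate_minimalPeriod]
  · have hp := iterate_minimalPeriod (f := twist j h) (x := ((0 : Fin (j + 1)), o))
    set n := minimalPeriod (twist j h) ((0 : Fin (j + 1)), o)
    have hn : n = n % (j + 1) + (j + 1) * (n / (j + 1)) := (Nat.mod_add_div _ _).symm
    rw [hn, iterate_add_apply, twist_iterate_mul,
      twist_iterate j h _ _ (Nat.mod_lt _ (Nat.succ_pos j)), Prod.mk.injEq, Fin.ext_iff] at hp
    obtain ⟨h1, h2⟩ := hp
    simp only [Fin.val_zero] at h1
    rw [hn, h1, zero_add]
    exact Nat.mul_dvd_mul_left _ (isPeriodicPt_iff_minimalPeriod_dvd.1 h2)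

lemma minimalPeriod_refl_prodCongr (j : ℕ) (f : Perm S) (q : Fin (j + 1) × S) :
    minimalPeriod (Equiv.prodCongr (Equiv.refl (Fin (j + 1))) f) q = minimalPeriod f q.2 :=
  minimalPeriod_of_semiconj (e := fun o => (q.1, o)) (fun _ _ h => by simpa using h)
    (fun _ => rfl) q.2

lemma twist_comm_prodCongr_iff (j : ℕ) (h f : Perm S) :
    (∀ q, twist j h (Equiv.prodCongr (Equiv.refl (Fin (j + 1))) f q) =
      Equiv.prodCongr (Equiv.refl (Fin (j + 1))) f (twist j h q)) ↔
    ∀ o, h (f o) = f (h o) := by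
  constructor
  · intro H o
    have := H (Fin.last j, o)
    simp [twist] at this
    exact this
  · rintro H ⟨t, o⟩
    by_cases ht : t = Fin.last j
    · simp [twist, ht, H]
    · simp [twist, ht]

lemma good_blockFam_iff [Finite S] (j : ℕ) (c : Option ι → Perm S) :
    Good Ψ (noneRel ι) (blockFam j c) ↔ Good (blockLengths (j + 1) Ψ) (noneRel ι) c := by
  refine and_congr (forall_congr' fun k => ?_) ?_
  · cases k with
    | none =>
      simp only [blockFam, minimalPeriod_twist, blockLengths, Set.mem_ofPred_eq]
      exact ⟨fun H o => H (0, o), fun H q => H q.2⟩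
    | some i =>
      simp only [blockFam, minimalPeriod_refl_prodCongr, blockLengths]
      exact ⟨fun H o => H (0, o), fun H q => H q.2⟩
  · constructor
    · rintro H k k' rfl
      cases k' with
      | none => intro _; rfl
      | some i => exact (twist_comm_prodCongr_iff j _ _).1 (H none (some i) rfl)
    · rintro H k k' rfl
      cases k' with
      | none => intro _; rfl
      | some i => exact (twist_comm_prodCongr_iff j _ _).2 (H none (some i) rfl)

lemma orb_blockFam (j : ℕ) {c : Option ι → Perm S} (hc : TransFam fun i => c (some i)) (o : S) :
    orb (fun i => blockFam j c (some i)) (0, o) = {q | q.1 = 0} := by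
  refine (orb_subset (by exact rfl) fun k z hz => ?_).antisymm ?_
  · exact hz
  · rintro ⟨t, y⟩ (rfl : t = 0)
    have := hc {y | (0, y) ∈ orb (fun i => blockFam j c (some i)) (0, o)} ⟨o, mem_orb_self _ _⟩
      (fun k z hz => apply_mem_orb (c := fun i => blockFam j c (some i)) hz k)
    exact Set.eq_univ_iff_forall.1 this y

lemma transFam_blockFam [Finite S] (j : ℕ) {c : Option ι → Perm S}
    (hc : TransFam fun i => c (some i)) : TransFam (blockFam j c) := by
  intro U hU hcl
  have hit : ∀ n, ∀ q ∈ U, (twist j (c none))^[n] q ∈ U := by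
    intro n
    induction n with
    | zero => exact fun q hq => hq
    | succ n ih => intro q hq; rw [iterate_succ_apply']; exact hcl none _ (ih q hq)
  obtain ⟨⟨t, o⟩, hto⟩ := hU
  have h0 : ∃ o', (0, o') ∈ U := by
    refine ⟨c none o, ?_⟩
    have := hit (j + 1 - t) _ hto
    rw [← show (⟨t, t.2⟩ : Fin (j + 1)) = t from rfl, ← twist_iterate j (c none) o t t.2,
      ← iterate_add_apply, Nat.sub_add_cancel t.2.le, twist_iterate_succ] at this
    exact this
  obtain ⟨o', ho'⟩ := h0
  have hall : ∀ y, (0, y) ∈ U := Set.eq_univ_iff_forall.1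
    (hc {y | (0, y) ∈ U} ⟨o', ho'⟩ fun i z hz => hcl (some i) _ hz)
  rw [Set.eq_univ_iff_forall]
  rintro ⟨s, y⟩
  have := hit s _ (hall y)
  rwa [twist_iterate j _ _ _ s.2] at this

/-- If `g` commutes with the family `b` and the two together are transitive, then the orbits of `b`
are permuted cyclically by `g`. -/
lemma exists_block_bijective [Finite D] (b : ι → Perm D) (g : Perm D)
    (hg : ∀ i y, g (b i y) = b i (g y)) (x : D)
    (htr : ∀ U : Set D, U.Nonempty → (∀ i, ∀ z ∈ U, b i z ∈ U) → (∀ z ∈ U, g z ∈ U) →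
      U = Set.univ) :
    ∃ j, (∀ z ∈ orb b x, g^[j + 1] z ∈ orb b x) ∧
      Bijective fun q : Fin (j + 1) × orb b x => g^[q.1] q.2.1 := by
  classical
  have hcomm : ∀ t i y, g^[t] (b i y) = b i (g^[t] y) := by
    intro t
    induction t with
    | zero => intro i y; rfl
    | succ t ih => intro i y; rw [iterate_succ_apply, hg, ih, iterate_succ_apply]
  have hkey : ∀ t, ∀ o ∈ orb b x, g^[t] o ∈ orb b x → ∀ z ∈ orb b x, g^[t] z ∈ orb b x := by
    intro t o ho hto z hz
    rw [← orb_eq_of_mem ho] at hz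
    exact orb_subset (S := {z | g^[t] z ∈ orb b x}) hto
      (fun i z hz => by
        simp only [Set.mem_ofPred_eq, hcomm] at hz ⊢
        exact apply_mem_orb hz i) hz
  have hex : ∃ t, 0 < t ∧ g^[t] x ∈ orb b x :=
    ⟨minimalPeriod g x, minimalPeriod_perm_pos g x, by
      rw [iterate_minimalPeriod]; exact mem_orb_self b x⟩
  obtain ⟨hpos, hmem⟩ := Nat.find_spec hex
  have hmin : ∀ t, 0 < t → g^[t] x ∈ orb b x → Nat.find hex ≤ t :=
    fun t h1 h2 => Nat.find_min' hex ⟨h1, h2⟩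
  obtain ⟨j, hj⟩ : ∃ j, Nat.find hex = j + 1 := ⟨_, (Nat.succ_pred_eq_of_pos hpos).symm⟩
  rw [hj] at hmem hmin
  have hret := hkey (j + 1) x (mem_orb_self b x) hmem
  have hinj : ∀ t s, t ≤ s → s < j + 1 → ∀ o ∈ orb b x, ∀ o' ∈ orb b x,
      g^[t] o = g^[s] o' → t = s ∧ o = o' := by
    intro t s hts hs o ho o' ho' h
    rw [show s = t + (s - t) by omega, iterate_add_apply] at h
    have h' := g.injective.iterate t h
    have hst : s - t = 0 := by
      by_contra hne
      have := hmin (s - t) (Nat.pos_of_ne_zero hne)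
        (hkey _ o' ho' (h' ▸ ho) x (mem_orb_self b x))
      omega
    rw [hst] at h'
    exact ⟨by omega, h'⟩
  refine ⟨j, hret, ?_, ?_⟩
  · rintro ⟨t, o⟩ ⟨s, o'⟩ h
    have h : g^[t] o.1 = g^[s] o'.1 := h
    rw [Prod.mk.injEq, Fin.ext_iff, Subtype.ext_iff]
    rcases le_total (t : ℕ) s with hts | hts
    · exact hinj t s hts s.2 o.1 o.2 o'.1 o'.2 h
    · obtain ⟨h1, h2⟩ := hinj s t hts t.2 o'.1 o'.2 o.1 o.2 h.symm
      exact ⟨h1.symm, h2.symm⟩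
  · rw [← Set.range_eq_univ]
    refine htr _ ⟨_, ⟨(0, ⟨x, mem_orb_self b x⟩), rfl⟩⟩ ?_ ?_
    · rintro i _ ⟨⟨t, o⟩, rfl⟩
      exact ⟨(t, ⟨b i o, apply_mem_orb o.2 i⟩), hcomm t i o⟩
    · rintro _ ⟨⟨t, o⟩, rfl⟩
      by_cases ht : (t : ℕ) = j
      · refine ⟨(0, ⟨_, hret o o.2⟩), ?_⟩
        simp only [Fin.val_zero, iterate_zero, id, ht]
        rw [iterate_succ_apply']
      · refine ⟨(⟨t + 1, by omega⟩, o), ?_⟩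
        simp only
        rw [iterate_succ_apply']

/-- An injective map on part of a finite set extends to bijections in as many ways as there are
bijections between the complements. -/
lemma card_equiv_extending [Finite D] {A : Type} [Finite A] (s : Set A) (f : A → D)
    (hf : Set.InjOn f s) (hA : Nat.card A = Nat.card D) :
    Nat.card {e : A ≃ D // ∀ a ∈ s, e a = f a} = (Nat.card D - s.ncard).factorial := by
  classical
  have := Fintype.ofFinite D
  have := Fintype.ofFinite A
  have h := Nat.card_congr (Equiv.Set.compl (Equiv.Set.imageOfInjOn f s hf))
  have h2 : Nat.card {e : A ≃ D // ∀ a ∈ s, e a = f a} =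
      Nat.card {e : A ≃ D // ∀ x : s, e x = (Equiv.Set.imageOfInjOn f s hf) x} :=
    Nat.card_congr (Equiv.subtypeEquivRight fun e => by simp [Equiv.Set.imageOfInjOn])
  have c1 : Nat.card (sᶜ : Set A) = Nat.card D - s.ncard := by
    rw [Nat.card_coe_set_eq, Set.ncard_compl, hA]
  have c2 : Nat.card ((f '' s)ᶜ : Set D) = Nat.card D - s.ncard := by
    rw [Nat.card_coe_set_eq, Set.ncard_compl, Set.InjOn.ncard_image hf]
  rw [h2, h]
  obtain ⟨e⟩ : Nonempty ((sᶜ : Set A) ≃ ((f '' s)ᶜ : Set D)) :=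
    Finite.card_eq.1 (c1.trans c2.symm)
  rw [Nat.card_eq_fintype_card, Fintype.card_equiv e, ← Nat.card_eq_fintype_card, c1]

lemma good_trans_some_congr {S' : Type} (j : ℕ) (e : S ≃ S') (c : Option ι → Perm S) :
    (Good (blockLengths j Ψ) (noneRel ι) c ∧ TransFam fun i => c (some i)) ↔
    (Good (blockLengths j Ψ) (noneRel ι) (permFamilyCongr _ e c) ∧
      TransFam fun i => permFamilyCongr _ e c (some i)) := by
  rw [good_permFamilyCongr]
  have : (fun i => permFamilyCongr _ e c (some i)) = permFamilyCongr ι e fun i => c (some i) := rfl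
  rw [this, isTrans_permFamilyCongr]

/-- The count of families on a block depends only on the size of the block. -/
lemma card_block_eq [Finite S] (j : ℕ) :
    Nat.card {c : Option ι → Perm S //
      Good (blockLengths j Ψ) (noneRel ι) c ∧ TransFam fun i => c (some i)} =
    blockCount Ψ j (Nat.card S) :=
  Nat.card_congr ((permFamilyCongr _ (Finite.equivFin S)).subtypeEquiv
    (good_trans_some_congr Ψ j _))

/-- The transitive families for which the members `some i` have the orbit `S` at `x`: they amount to
a family on `S` and an identification of the whole set with copies of `S`. -/
lemma card_trans_orb_eq [Finite ι] [Finite D] (x : D) (S : Finset D) (hx : x ∈ S) (j : ℕ)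
    (hj : (j + 1) * S.card = Nat.card D) :
    Nat.card {c : Option ι → Perm D // (Good Ψ (noneRel ι) c ∧ TransFam c) ∧
      orb (fun i => c (some i)) x = S} =
    blockCount Ψ (j + 1) S.card * (Nat.card D - S.card).factorial := by
  classical
  have h1 := card_block_eq (S := {y // y ∈ S}) Ψ (j + 1)
  rw [show Nat.card {y // y ∈ S} = S.card by simp] at h1
  have h2 := card_equiv_extending (D := D) (A := Fin (j + 1) × {y // y ∈ S}) {q | q.1 = 0}
    (fun q => q.2.1) (by
      rintro ⟨t, o⟩ (rfl : t = 0) ⟨s, o'⟩ (rfl : s = 0) h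
      rw [Prod.mk.injEq, Subtype.ext_iff]; exact ⟨rfl, h⟩) (by simp [hj])
  have h3 : ({q | q.1 = 0} : Set (Fin (j + 1) × {y // y ∈ S})).ncard = S.card := by
    rw [show ({q | q.1 = 0} : Set (Fin (j + 1) × {y // y ∈ S})) = Set.range fun o => (0, o) by
      ext ⟨t, o⟩; simp [eq_comm],
      Set.ncard_range_of_injective fun a b h => (Prod.mk.inj h).2]
    simp
  rw [h3] at h2
  rw [← h1, ← h2, ← Nat.card_prod]
  symm
  refine Nat.card_congr (Equiv.ofBijective
    (fun q => ⟨permFamilyCongr _ q.2.1 (blockFam j q.1.1), ⟨⟨?_, ?_⟩, ?_⟩⟩) ⟨?_, ?_⟩)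
  · rw [good_permFamilyCongr, good_blockFam_iff]; exact q.1.2.1
  · rw [isTrans_permFamilyCongr]; exact transFam_blockFam j q.1.2.2
  · have hq : q.2.1 (0, ⟨x, hx⟩) = x := q.2.2 _ rfl
    ext y
    have horb := orb_blockFam j q.1.2.2 ⟨x, hx⟩
    constructor
    · intro hy
      have := orb_subset (c := fun i => permFamilyCongr _ q.2.1 (blockFam j q.1.1) (some i))
        (x := x) (S := S) (by exact_mod_cast hx) (fun i z hz => by
          have hz' : q.2.1 (0, ⟨z, hz⟩) = z := q.2.2 _ rfl
          rw [← hz', permFamilyCongr_apply]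
          rw [show blockFam j q.1.1 (some i) (0, ⟨z, hz⟩) = (0, q.1.1 (some i) ⟨z, hz⟩) from rfl,
            q.2.2 _ rfl]
          exact (q.1.1 (some i) ⟨z, hz⟩).2)
      exact this hy
    · intro hy
      have hy' : ((0, ⟨y, hy⟩) : Fin (j + 1) × {y // y ∈ S}) ∈
          orb (fun i => blockFam j q.1.1 (some i)) (0, ⟨x, hx⟩) := by rw [horb]; rfl
      have hy2 : q.2.1 (0, ⟨y, hy⟩) = y := q.2.2 _ rfl
      intro U hxU hU
      have := hy' (q.2.1 ⁻¹' U) (by simpa [hq] using hxU) (fun i z hz => by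
        simp only [Set.mem_preimage] at hz ⊢
        rw [← permFamilyCongr_apply]; exact hU i _ hz)
      simpa [hy2] using this
  · rintro ⟨⟨a, ha⟩, ⟨e, he⟩⟩ ⟨⟨a', ha'⟩, ⟨e', he'⟩⟩ h
    have h' : ∀ k y, permFamilyCongr _ e (blockFam j a) k y =
        permFamilyCongr _ e' (blockFam j a') k y := by
      intro k y
      exact congrFun (congrArg DFunLike.coe (congrFun (congrArg Subtype.val h) k)) y
    have he0 : ∀ o, e (0, o) = o := fun o => he (0, o) rfl
    have he0' : ∀ o, e' (0, o) = o := fun o => he' (0, o) rfl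
    have hit : ∀ (e : Fin (j + 1) × {y // y ∈ S} ≃ D) (a : Option ι → Perm {y // y ∈ S}) n q,
        e ((twist j (a none))^[n] q) = (permFamilyCongr _ e (blockFam j a) none)^[n] (e q) := by
      intro e a n
      induction n with
      | zero => intro q; rfl
      | succ n ih =>
        intro q
        rw [iterate_succ_apply, iterate_succ_apply, ih, permFamilyCongr_apply]; rfl
    have hnone : ⇑(permFamilyCongr _ e (blockFam j a) none) =
        permFamilyCongr _ e' (blockFam j a') none := funext (h' none)
    have e1 : e = e' := by
      ext ⟨t, o⟩
      have := hit e a t (0, o)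
      have h2 := hit e' a' t (0, o)
      rw [twist_iterate _ _ _ _ t.2] at this h2
      rw [this, h2, he0, he0', hnone]
    subst e1
    have e2 : a = a' := by
      funext k
      ext o
      cases k with
      | none =>
        have := hit e a (j + 1) (0, o)
        have h2 := hit e a' (j + 1) (0, o)
        rw [twist_iterate_succ, he0] at this h2
        rw [this, h2, hnone]
      | some i =>
        have h2 := h' (some i) (e (0, o))
        rw [permFamilyCongr_apply, permFamilyCongr_apply] at h2
        have h3 : e (0, a (some i) o) = e (0, a' (some i) o) := h2
        rwa [he0, he0] at h3
    subst e2
    rfl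
  · rintro ⟨c, ⟨hc, htr⟩, horb⟩
    obtain ⟨i, hret, hbij⟩ := exists_block_bijective (fun i => c (some i)) (c none)
      (fun i => hc.2 none (some i) rfl) x (fun U hU hb hg => htr U hU fun k => by
        cases k with
        | none => exact hg
        | some i => exact hb i)
    have hmem : ∀ z, z ∈ orb (fun i => c (some i)) x ↔ z ∈ S := fun z => by rw [horb]; rfl
    have hij : i = j := by
      have := Nat.card_congr (Equiv.ofBijective _ hbij)
      rw [Nat.card_prod, Nat.card_eq_fintype_card, Fintype.card_fin, ← hj, horb] at this
      have hS : 0 < S.card := Finset.card_pos.2 ⟨x, hx⟩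
      have : (i + 1) * S.card = (j + 1) * S.card := by simpa using this
      have := Nat.eq_of_mul_eq_mul_right hS this
      omega
    subst hij
    have hbij' : Bijective fun q : Fin (i + 1) × {y // y ∈ S} => (c none)^[q.1] q.2.1 := by
      refine hbij.comp (f := fun q : Fin (i + 1) × {y // y ∈ S} =>
        (q.1, (⟨q.2.1, (hmem _).2 q.2.2⟩ : orb (fun i => c (some i)) x))) ⟨?_, ?_⟩
      · rintro ⟨t, o⟩ ⟨s, o'⟩ h
        rw [Prod.mk.injEq, Subtype.ext_iff] at h ⊢
        exact h
      · rintro ⟨t, o⟩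
        exact ⟨(t, ⟨o.1, (hmem _).1 o.2⟩), rfl⟩
    let e := Equiv.ofBijective _ hbij'
    have he : ∀ t o, e (t, o) = (c none)^[t] o.1 := fun t o => rfl
    have hS : ∀ k, ∀ z ∈ S, c (some k) z ∈ S := fun k z hz => by
      rw [← hmem] at hz ⊢; exact apply_mem_orb (c := fun i => c (some i)) hz k
    have hS' : ∀ z ∈ S, ((c none) ^ (i + 1)) z ∈ S := fun z hz => by
      rw [← hmem] at hz ⊢; rw [← Perm.iterate_eq_pow]; exact hret z hz
    let a : Option ι → Perm {y // y ∈ S} := fun k => match k with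
      | none => ((c none) ^ (i + 1)).subtypePerm fun z =>
          ⟨fun h => mem_of_apply_mem (S := (S : Set D)) hS' h, hS' z⟩
      | some k => (c (some k)).subtypePerm fun z =>
          ⟨fun h => mem_of_apply_mem (S := (S : Set D)) (hS k) h, hS k z⟩
    have han : ∀ o, (a none o : D) = (c none)^[i + 1] o.1 := fun o => by
      rw [Perm.iterate_eq_pow]; rfl
    have has : ∀ k o, (a (some k) o : D) = c (some k) o.1 := fun k o => rfl
    have hcomm : ∀ t k y, (c none)^[t] (c (some k) y) = c (some k) ((c none)^[t] y) := by
      intro t k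
      induction t with
      | zero => intro y; rfl
      | succ t ih =>
        intro y
        rw [iterate_succ_apply, hc.2 none (some k) rfl, ih, iterate_succ_apply]
    have hca : permFamilyCongr _ e (blockFam i a) = c := by
      funext k
      ext y
      obtain ⟨⟨t, o⟩, rfl⟩ := e.surjective y
      rw [permFamilyCongr_apply]
      cases k with
      | some k =>
        rw [show blockFam i a (some k) (t, o) = (t, a (some k) o) from rfl, he, he, has, hcomm]
      | none =>
        change e (twist i (a none) (t, o)) = _
        by_cases ht : (t : ℕ) = i
        · have : t = Fin.last i := Fin.ext ht
          subst this
          rw [twist_last, he, he, han]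
          simp only [Fin.val_zero, iterate_zero, id, Fin.val_last]
          rw [iterate_succ_apply']
        · have h3 := twist_iterate i (a none) o (t + 1) (by omega)
          rw [iterate_succ_apply', twist_iterate i (a none) o t t.2] at h3
          rw [show t = ⟨t, t.2⟩ from rfl, h3, he, he]
          exact iterate_succ_apply' _ _ _
    refine ⟨⟨⟨a, ?_, ?_⟩, ⟨e, ?_⟩⟩, ?_⟩
    · rw [← good_blockFam_iff, ← good_permFamilyCongr Ψ _ e, hca]; exact hc
    · intro U hU hcl
      obtain ⟨u, hu⟩ := hU
      have hsub : orb (fun i => c (some i)) u ⊆ Subtype.val '' U := orb_subset ⟨u, hu, rfl⟩ (by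
        rintro k _ ⟨z, hz, rfl⟩
        exact ⟨a (some k) z, hcl k z hz, has k z⟩)
      rw [orb_eq_of_mem ((hmem _).2 u.2), horb] at hsub
      rw [Set.eq_univ_iff_forall]
      intro y
      obtain ⟨z, hz, hzy⟩ := hsub y.2
      rwa [← Subtype.ext hzy]
    · rintro ⟨t, o⟩ (rfl : t = 0)
      rfl
    · exact Subtype.ext hca

lemma card_orb_dvd [Finite D] {c : Option ι → Perm D} (hc : Good Ψ (noneRel ι) c)
    (htr : TransFam c) (x : D) : (orb (fun i => c (some i)) x).ncard ∣ Nat.card D := by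
  obtain ⟨i, -, hbij⟩ := exists_block_bijective (fun i => c (some i)) (c none)
    (fun i => hc.2 none (some i) rfl) x (fun U hU hb hg => htr U hU fun k => by
      cases k with
      | none => exact hg
      | some i => exact hb i)
  have := Nat.card_congr (Equiv.ofBijective _ hbij)
  rw [Nat.card_prod, Nat.card_coe_set_eq] at this
  exact ⟨_, by rw [← this, mul_comm]⟩

/-- Transitive families with a member `none` commuting with all the others, counted by the size
`k + 1` of the orbits of those others. -/
theorem transCount_div_factorial [Finite ι] (N : ℕ) :
    (transCount Ψ (noneRel ι) (N + 1) / (N.factorial : ℚ)) = ∑ k ∈ Finset.range (N + 1),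
      if k + 1 ∣ N + 1 then (blockCount Ψ ((N + 1) / (k + 1)) (k + 1) : ℚ) / k.factorial
        else 0 := by
  classical
  have h := sum_finset_mem_eq (D := Fin (N + 1)) 0 (Fintype.card_fin _)
    (fun k => if k ∣ N + 1 then blockCount Ψ ((N + 1) / k) k * (N + 1 - k).factorial else 0)
  have hT : transCount Ψ (noneRel ι) (N + 1) = ∑ k ∈ Finset.range (N + 1), N.choose k *
      (if k + 1 ∣ N + 1 then blockCount Ψ ((N + 1) / (k + 1)) (k + 1) * (N - k).factorial
        else 0) := by
    simp only [Nat.add_sub_add_right, smul_eq_mul] at h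
    rw [← h, transCount, card_subtype_eq_sum _
      (fun c : Option ι → Perm (Fin (N + 1)) =>
        (Set.toFinite (orb (fun i => c (some i)) 0)).toFinset)]
    refine Finset.sum_congr rfl fun S _ => ?_
    have e : ∀ c : Option ι → Perm (Fin (N + 1)),
        (Set.toFinite (orb (fun i => c (some i)) 0)).toFinset = S ↔
          orb (fun i => c (some i)) 0 = S := by
      intro c
      rw [← Finset.coe_inj, Set.Finite.coe_toFinset]
    simp only [e]
    split_ifs with hS hd
    · obtain ⟨j, hj⟩ := hd
      have hS0 : 0 < S.card := Finset.card_pos.2 ⟨0, hS⟩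
      cases j with
      | zero => simp at hj
      | succ j =>
        rw [card_trans_orb_eq Ψ 0 S hS j (by rw [Nat.card_fin, Nat.mul_comm]; exact hj.symm),
          Nat.card_fin, Nat.div_eq_of_eq_mul_right hS0 hj]
    · rw [Nat.card_eq_zero]
      left
      refine ⟨fun c => hd ?_⟩
      have := card_orb_dvd Ψ c.2.1.1 c.2.1.2 0
      rwa [c.2.2, Set.ncard_coe_finset, Nat.card_fin] at this
    · rw [Nat.card_eq_zero]
      left
      refine ⟨fun c => hS ?_⟩
      have := mem_orb_self (fun i => c.1 (some i)) 0
      rw [c.2.2] at this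
      exact_mod_cast this
  rw [hT]
  push_cast
  rw [Finset.sum_div]
  refine Finset.sum_congr rfl fun k hk => ?_
  have hk : k ≤ N := by simpa [Nat.lt_succ_iff] using hk
  split_ifs
  · rw [Nat.cast_choose ℚ hk]
    have : (N.factorial : ℚ) ≠ 0 := by positivity
    field_simp
  · simp

end

/-! ### Formal power series: Euler operator, exponential -/

/-- The Euler operator `z d/dz`. -/
noncomputable def theta (F : ℚ⟦X⟧) : ℚ⟦X⟧ := X * d⁄dX ℚ F

lemma coeff_theta (F : ℚ⟦X⟧) (n : ℕ) : coeff n (theta F) = n * coeff n F := by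
  cases n with
  | zero => simp [theta]
  | succ n => rw [theta, coeff_succ_X_mul, coeff_derivative]; push_cast; ring

lemma theta_mul (F G : ℚ⟦X⟧) : theta (F * G) = theta F * G + F * theta G := by
  simp only [theta, Derivation.leibniz, smul_eq_mul]; ring

lemma theta_subst_X_pow {k : ℕ} (hk : k ≠ 0) (F : ℚ⟦X⟧) :
    theta (F.subst ((X : ℚ⟦X⟧) ^ k)) = C (k : ℚ) * (theta F).subst ((X : ℚ⟦X⟧) ^ k) := by
  ext n
  rw [coeff_theta, coeff_C_mul, coeff_subst_X_pow hk, coeff_subst_X_pow hk]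
  split_ifs with h
  · obtain ⟨m, rfl⟩ := h
    rw [Nat.mul_div_cancel_left _ (Nat.pos_of_ne_zero hk), coeff_theta]
    push_cast; simp; ring
  · simp

/-- A series with non-zero constant coefficient is determined by its logarithmic derivative. -/
lemma eq_of_theta_eq {F G τ : ℚ⟦X⟧} (h0 : constantCoeff F = constantCoeff G)
    (hτ : constantCoeff τ = 0) (hF : theta F = τ * F) (hG : theta G = τ * G) : F = G := by
  ext n
  induction n using Nat.strong_induction_on with
  | _ n ih =>
    rcases Nat.eq_zero_or_pos n with rfl | hn
    · simpa using h0
    · have h1 := congrArg (coeff n) hF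
      have h2 := congrArg (coeff n) hG
      rw [coeff_theta, coeff_mul] at h1 h2
      have : ∑ q ∈ Finset.HasAntidiagonal.antidiagonal n, coeff q.1 τ * coeff q.2 F =
          ∑ q ∈ Finset.HasAntidiagonal.antidiagonal n, coeff q.1 τ * coeff q.2 G := by
        refine Finset.sum_congr rfl fun q hq => ?_
        have hq := Finset.HasAntidiagonal.mem_antidiagonal.1 hq
        rcases Nat.eq_zero_or_pos q.1 with h | h
        · rw [h, coeff_zero_eq_constantCoeff_apply, hτ]; simp
        · rw [ih q.2 (by omega)]
      rw [this, ← h2] at h1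
      have hn' : (n : ℚ) ≠ 0 := by positivity
      exact mul_left_cancel₀ hn' h1

lemma theta_exp_subst {f : ℚ⟦X⟧} (hf : constantCoeff f = 0) :
    theta ((PowerSeries.exp ℚ).subst f) = theta f * (PowerSeries.exp ℚ).subst f := by
  rw [theta, derivative_subst (HasSubst.of_constantCoeff_zero' hf), derivative_exp, theta]
  ring

lemma constantCoeff_exp_subst {f : ℚ⟦X⟧} (hf : constantCoeff f = 0) :
    constantCoeff ((PowerSeries.exp ℚ).subst f) = 1 := by
  have h := constantCoeff_subst_eq_zero (a := f) hf (PowerSeries.exp ℚ - 1) (by simp)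
  have hs := HasSubst.of_constantCoeff_zero' hf
  rw [subst_sub hs] at h
  have h1 : (1 : ℚ⟦X⟧).subst f = (1 : ℚ⟦X⟧) := by
    rw [← coe_substAlgHom hs, map_one]
  rw [h1] at h
  have h2 : constantCoeff ((PowerSeries.exp ℚ).subst f) - constantCoeff (1 : ℚ⟦X⟧) = 0 := by
    rw [← map_sub]; exact h
  simpa [sub_eq_zero] using h2

/-! ### Generating functions of labelled families -/

section
variable {κ : Type} (Ψ : κ → Set ℕ) (R : κ → κ → Prop)

/-- The exponential generating function of the good families. -/
noncomputable def goodSeries : ℚ⟦X⟧ := PowerSeries.mk fun n => (goodCount Ψ R n : ℚ) / n.factorial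

/-- The exponential generating function of the transitive good families with a marked point. -/
noncomputable def rootedTransSeries : ℚ⟦X⟧ :=
  PowerSeries.mk fun n => n * ((transCount Ψ R n : ℚ) / n.factorial)

lemma coeff_succ_rootedTransSeries (n : ℕ) :
    coeff (n + 1) (rootedTransSeries Ψ R) = (transCount Ψ R (n + 1) : ℚ) / n.factorial := by
  rw [rootedTransSeries, coeff_mk, Nat.factorial_succ]
  push_cast
  have : (n.factorial : ℚ) ≠ 0 := by positivity
  field_simp

lemma constantCoeff_rootedTransSeries : constantCoeff (rootedTransSeries Ψ R) = 0 := by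
  rw [← coeff_zero_eq_constantCoeff_apply, rootedTransSeries, coeff_mk]; simp

lemma constantCoeff_goodSeries : constantCoeff (goodSeries Ψ R) = 1 := by
  rw [← coeff_zero_eq_constantCoeff_apply, goodSeries, coeff_mk, goodCount_zero]; simp

/-- The exponential formula in the form `z F' = (z T') F`. -/
lemma theta_goodSeries [Finite κ] :
    theta (goodSeries Ψ R) = rootedTransSeries Ψ R * goodSeries Ψ R := by
  ext n
  rw [coeff_theta, coeff_mul]
  cases n with
  | zero => simp [constantCoeff_rootedTransSeries]
  | succ N =>
    rw [goodSeries, coeff_mk, goodCount_div_factorial_succ, Finset.Nat.antidiagonal_succ,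
      Finset.sum_cons, coeff_zero_eq_constantCoeff_apply, constantCoeff_rootedTransSeries,
      zero_mul, zero_add, Finset.sum_map, Finset.Nat.sum_antidiagonal_eq_sum_range_succ_mk]
    refine Finset.sum_congr rfl fun k hk => ?_
    simp only [Embedding.prodMap, Embedding.coeFn_mk, Prod.map, Embedding.refl_apply]
    rw [coeff_mk]
    erw [coeff_succ_rootedTransSeries]

end

/-! ### Pairs of commuting permutations with given cycle lengths -/

/-- Cycle lengths of a pair: the permutation `none` has all cycles of length `p`, the other one has
all cycles of length `i`. -/
def pairLengths (p i : ℕ) : Option Unit → Set ℕ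
  | none => {p}
  | some _ => {i}

lemma exists_iterate_eq_of_transFam {D : Type} {b : Unit → Perm D} (hb : TransFam b) (x y : D) :
    ∃ n, (b ())^[n] x = y := by
  have := hb (Set.range fun n => (b ())^[n] x) ⟨_, ⟨0, rfl⟩⟩ (by
    rintro k _ ⟨n, rfl⟩
    exact ⟨n + 1, iterate_succ_apply' _ _ _⟩)
  exact Set.eq_univ_iff_forall.1 this y

lemma minimalPeriod_of_transFam {D : Type} [Finite D] {b : Unit → Perm D} (hb : TransFam b) (x : D) :
    minimalPeriod (b ()) x = Nat.card D := by
  have hpos := minimalPeriod_perm_pos (b ()) x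
  have hbij : Bijective fun n : Fin (minimalPeriod (b ()) x) => (b ())^[n] x := by
    constructor
    · intro n m h
      exact Fin.ext (iterate_injOn_Iio_minimalPeriod n.2 m.2 h)
    · intro y
      obtain ⟨n, rfl⟩ := exists_iterate_eq_of_transFam hb x y
      exact ⟨⟨n % _, Nat.mod_lt _ hpos⟩, iterate_mod_minimalPeriod_eq⟩
  have := Nat.card_congr (Equiv.ofBijective _ hbij)
  simpa using this

/-- All cycles of a permutation that commutes with a single cycle on all points have the same length. -/
lemma minimalPeriod_eq_orderOf {D : Type} {b : Unit → Perm D} (hb : TransFam b) {h : Perm D}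
    (hh : ∀ y, h (b () y) = b () (h y)) (y : D) : minimalPeriod h y = orderOf h := by
  have hcomm : ∀ n y, h ((b ())^[n] y) = (b ())^[n] (h y) := fun n =>
    (Function.Commute.iterate_right (f := h) (g := b ()) (fun y => hh y) n)
  have key : ∀ n, h^[n] y = y → h ^ n = 1 := by
    intro n hn
    ext z
    obtain ⟨m, rfl⟩ := exists_iterate_eq_of_transFam hb y z
    rw [← Perm.iterate_eq_pow]
    have : h^[n] ((b ())^[m] y) = (b ())^[m] (h^[n] y) :=
      (Function.Commute.iterate_iterate (f := h) (g := b ()) (fun y => hh y) n m) y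
    rw [this, hn]; rfl
  refine Nat.dvd_antisymm ?_ ?_
  · rw [← isPeriodicPt_iff_minimalPeriod_dvd, IsPeriodicPt, IsFixedPt, Perm.iterate_eq_pow,
      pow_orderOf_eq_one]; rfl
  · exact orderOf_dvd_of_pow_eq_one (key _ iterate_minimalPeriod)

/-- A permutation commuting with a single cycle on all points is one of its powers. -/
lemma commute_iff_mem_zpowers {D : Type} [Nonempty D] {b : Unit → Perm D} (hb : TransFam b)
    (h : Perm D) :
    (∀ y, h (b () y) = b () (h y)) ↔ h ∈ Subgroup.zpowers (b ()) := by
  constructor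
  · intro hh
    obtain ⟨x⟩ := ‹Nonempty D›
    obtain ⟨n, hn⟩ := exists_iterate_eq_of_transFam hb x (h x)
    refine ⟨n, ?_⟩
    ext z
    obtain ⟨m, rfl⟩ := exists_iterate_eq_of_transFam hb x z
    have : h ((b ())^[m] x) = (b ())^[m] (h x) :=
      (Function.Commute.iterate_right (f := h) (g := b ()) (fun y => hh y) m) x
    rw [this, ← hn, ← iterate_add_apply, add_comm, iterate_add_apply]
    rw [Perm.iterate_eq_pow (b ()) n]; simp
  · rintro ⟨n, rfl⟩ y
    have : Commute ((b ()) ^ n) (b ()) := (Commute.refl (b ())).zpow_left n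
    exact congrFun (congrArg DFunLike.coe this.eq) y

section
variable {D : Type} [Finite D]

lemma orderOf_of_transFam [Nonempty D] {b : Unit → Perm D} (hb : TransFam b) :
    orderOf (b ()) = Nat.card D := by
  obtain ⟨x⟩ := ‹Nonempty D›
  rw [← minimalPeriod_eq_orderOf hb (fun _ => rfl) x, minimalPeriod_of_transFam hb]

lemma card_commuting_orderOf [Nonempty D] {b : Unit → Perm D} (hb : TransFam b) (d : ℕ) :
    Nat.card {h : Perm D // (∀ y, h (b () y) = b () (h y)) ∧ orderOf h = d} =
      if d ∣ Nat.card D then d.totient else 0 := by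
  classical
  have := Fintype.ofFinite D
  have e : Nat.card {h : Perm D // (∀ y, h (b () y) = b () (h y)) ∧ orderOf h = d} =
      Nat.card {h : Subgroup.zpowers (b ()) // orderOf h = d} := by
    refine Nat.card_congr ?_
    refine (Equiv.subtypeEquivRight fun h => ?_).trans
      (Equiv.subtypeSubtypeEquivSubtypeInter (fun h => h ∈ Subgroup.zpowers (b ()))
        (fun h => orderOf h = d)).symm |>.trans (Equiv.subtypeEquivRight fun h => ?_)
    · rw [commute_iff_mem_zpowers hb]
    · rw [← Subgroup.orderOf_coe]
  have hc : Nat.card (Subgroup.zpowers (b ())) = Nat.card D := by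
    rw [Nat.card_zpowers, orderOf_of_transFam hb]
  rw [e]
  split_ifs with hd
  · rw [← hc, Nat.card_eq_fintype_card] at hd
    have := IsCyclic.card_orderOf_eq_totient hd
    rw [← this, Nat.card_eq_fintype_card, Fintype.card_subtype]
  · rw [Nat.card_eq_zero]
    left
    refine ⟨fun h => hd ?_⟩
    rw [← hc, ← h.2]
    exact orderOf_dvd_natCard h.1

end

lemma blockCount_pair_of_ne {p i j m : ℕ} (hm : m + 1 ≠ i) :
    blockCount (pairLengths p i) j (m + 1) = 0 := by
  rw [blockCount, Nat.card_eq_zero]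
  left
  refine ⟨fun c => hm ?_⟩
  have h1 := c.2.1.1 (some ()) 0
  have h2 := minimalPeriod_of_transFam c.2.2 0
  rw [Nat.card_fin] at h2
  rw [← h2]
  exact h1

/-- Splitting a family indexed by `Option Unit` into its two members. -/
def optionUnitEquiv (α : Type) : (Option Unit → α) ≃ (Unit → α) × α where
  toFun c := (fun i => c (some i), c none)
  invFun q k := k.elim q.2 q.1
  left_inv c := by funext k; cases k <;> rfl
  right_inv q := rfl

lemma blockCount_pair (p m j : ℕ) (hj : 0 < j) (hjp : j ∣ p) :
    blockCount (pairLengths p (m + 1)) j (m + 1) =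
      m.factorial * if p / j ∣ m + 1 then (p / j).totient else 0 := by
  classical
  rw [← card_isTrans_perm m, blockCount]
  rw [Nat.card_congr ((optionUnitEquiv (Perm (Fin (m + 1)))).subtypeEquiv
    (q := fun q => TransFam q.1 ∧ ((∀ y, q.2 (q.1 () y) = q.1 () (q.2 y)) ∧
      orderOf q.2 = p / j)) ?_)]
  · have e : {q : (Unit → Perm (Fin (m + 1))) × Perm (Fin (m + 1)) //
        TransFam q.1 ∧ ((∀ y, q.2 (q.1 () y) = q.1 () (q.2 y)) ∧ orderOf q.2 = p / j)} ≃
        Σ b : {b : Unit → Perm (Fin (m + 1)) // TransFam b},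
          {h : Perm (Fin (m + 1)) // (∀ y, h (b.1 () y) = b.1 () (h y)) ∧ orderOf h = p / j} :=
      { toFun := fun q => ⟨⟨q.1.1, q.2.1⟩, ⟨q.1.2, q.2.2⟩⟩
        invFun := fun q => ⟨(q.1.1, q.2.1), q.1.2, q.2.2⟩
        left_inv := fun q => rfl
        right_inv := fun q => rfl }
    rw [Nat.card_congr e, Nat.card_sigma,
      Finset.sum_congr rfl fun b _ => card_commuting_orderOf b.2 (p / j)]
    simp
  · intro c
    have hper : ∀ h : Perm (Fin (m + 1)), TransFam (fun i => c (some i)) →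
        (∀ y, h (c (some ()) y) = c (some ()) (h y)) →
        ((∀ y, j * minimalPeriod h y = p) ↔ orderOf h = p / j) := by
      intro h hb hh
      simp only [minimalPeriod_eq_orderOf (b := fun i => c (some i)) hb hh, forall_const]
      rw [Nat.eq_div_iff_mul_eq_left hj.ne' hjp, mul_comm, eq_comm]
    constructor
    · rintro ⟨hg, hb⟩
      have hh := hg.2 none (some ()) rfl
      exact ⟨hb, hh, (hper _ hb hh).1 fun y => hg.1 none y⟩
    · rintro ⟨hb, hh, ho⟩
      refine ⟨⟨?_, ?_⟩, hb⟩
      · intro k y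
        cases k with
        | none => exact (hper _ hb hh).2 ho y
        | some i =>
          have := minimalPeriod_of_transFam hb y
          rw [Nat.card_fin] at this
          exact this
      · rintro k k' rfl
        cases k' with
        | none => intro _; rfl
        | some i => exact hh

lemma blockCount_pair_of_not_dvd (p m j : ℕ) (hjp : ¬ j ∣ p) :
    blockCount (pairLengths p (m + 1)) j (m + 1) = 0 := by
  rw [blockCount, Nat.card_eq_zero]
  left
  exact ⟨fun c => hjp ⟨_, (c.2.1.1 none 0 : _ = p).symm⟩⟩

/-- In a transitive pair the cycles of length `i` of one member are permuted cyclically by the other.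
If there are `p / d` of them, the power of the other member that maps a cycle to itself acts on it as
one of the `φ(d)` powers of the cycle that have order `d`. -/
lemma coeff_rootedTransSeries_pair (p i n : ℕ) (hi : 0 < i) (hp : 0 < p) :
    coeff n (rootedTransSeries (pairLengths p i) (noneRel Unit)) =
      ∑ d ∈ (Nat.gcd i p).divisors, if n = i * (p / d) then (d.totient : ℚ) else 0 := by
  have hdd : ∀ d ∈ (Nat.gcd i p).divisors, d ∣ i ∧ d ∣ p := fun d hd =>
    ⟨(Nat.dvd_of_mem_divisors hd).trans (Nat.gcd_dvd_left _ _),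
      (Nat.dvd_of_mem_divisors hd).trans (Nat.gcd_dvd_right _ _)⟩
  have hpos : ∀ d ∈ (Nat.gcd i p).divisors, 0 < i * (p / d) := fun d hd =>
    Nat.mul_pos hi (Nat.div_pos (Nat.le_of_dvd hp (hdd d hd).2) (Nat.pos_of_mem_divisors hd))
  cases n with
  | zero =>
    rw [coeff_zero_eq_constantCoeff_apply, constantCoeff_rootedTransSeries]
    refine (Finset.sum_eq_zero fun d hd => if_neg (hpos d hd).ne).symm
  | succ N =>
    obtain ⟨i, rfl⟩ : ∃ i', i = i' + 1 := ⟨i - 1, by omega⟩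
    rw [coeff_succ_rootedTransSeries, transCount_div_factorial]
    have hL : ∀ k, (if k + 1 ∣ N + 1 then
        (blockCount (pairLengths p (i + 1)) ((N + 1) / (k + 1)) (k + 1) : ℚ) / k.factorial
        else 0) = if k = i then (if i + 1 ∣ N + 1 then
        (blockCount (pairLengths p (i + 1)) ((N + 1) / (i + 1)) (i + 1) : ℚ) / i.factorial
        else 0) else 0 := by
      intro k
      split_ifs with h1 h2 h3 h4 h5
      · subst h2; rfl
      · subst h2; exact absurd h1 h3
      · rw [blockCount_pair_of_ne (by omega)]; simp
      · subst h4; exact absurd h5 h1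
      · rfl
      · rfl
    rw [Finset.sum_congr rfl fun k _ => hL k, Finset.sum_ite_eq']
    by_cases hd : i + 1 ∣ N + 1
    · have hmem : i ∈ Finset.range (N + 1) :=
        Finset.mem_range.2 (by have := Nat.le_of_dvd (by omega) hd; omega)
      rw [if_pos hmem, if_pos hd]
      obtain ⟨j, hj⟩ := hd
      have hj0 : 0 < j := by
        rcases Nat.eq_zero_or_pos j with rfl | h
        · simp at hj
        · exact h
      rw [hj, Nat.mul_div_cancel_left _ (Nat.succ_pos i)]
      have hcond : ∀ d, (i + 1) * j = (i + 1) * (p / d) ↔ j = p / d := fun d =>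
        Nat.mul_right_inj (Nat.succ_ne_zero i)
      simp only [hcond]
      by_cases hjp : j ∣ p
      · have hfac : (i.factorial : ℚ) ≠ 0 := by positivity
        rw [blockCount_pair p i j hj0 hjp]
        push_cast
        rw [mul_div_cancel_left₀ _ hfac]
        by_cases hpi : p / j ∣ i + 1
        · rw [if_pos hpi, Finset.sum_eq_single (p / j)]
          · rw [Nat.div_div_self hjp hp.ne', if_pos rfl]
          · intro d hd hne
            rw [if_neg]
            rintro rfl
            exact hne (Nat.div_div_self (hdd d hd).2 hp.ne').symm
          · intro h
            exact absurd (Nat.mem_divisors.2 ⟨Nat.dvd_gcd hpi (Nat.div_dvd_of_dvd hjp),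
              (Nat.gcd_pos_of_pos_right _ hp).ne'⟩) h
        · rw [if_neg hpi, Finset.sum_eq_zero]
          intro d hd
          rw [if_neg]
          rintro rfl
          rw [Nat.div_div_self (hdd d hd).2 hp.ne'] at hpi
          exact hpi (hdd d hd).1
      · rw [blockCount_pair_of_not_dvd p i j hjp, Finset.sum_eq_zero]
        · simp
        · intro d hd
          rw [if_neg]
          rintro rfl
          exact hjp (Nat.div_dvd_of_dvd (hdd d hd).2)
    · rw [if_neg hd, ite_self, Finset.sum_eq_zero]
      intro d _
      rw [if_neg]
      intro h
      exact hd ⟨_, h⟩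

/-! ### The series `P_n` -/

/-- The exponent of the series `P_i`. -/
noncomputable def exponentP (p i : ℕ) : ℚ⟦X⟧ :=
  C (1 / ((i : ℚ) * p)) *
    ∑ d ∈ (Nat.gcd i p).divisors, C ((d : ℚ) * (Nat.totient d : ℚ)) * (X : ℚ⟦X⟧) ^ (p / d)

section
variable {p i : ℕ}

lemma coeff_theta_exponentP (hi : 0 < i) (hp : 0 < p) (j : ℕ) :
    coeff j (theta (exponentP p i)) =
      (1 / (i : ℚ)) * ∑ d ∈ (Nat.gcd i p).divisors, if j = p / d then (d.totient : ℚ) else 0 := by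
  rw [coeff_theta, exponentP, coeff_C_mul, map_sum, ← mul_assoc, Finset.mul_sum, Finset.mul_sum]
  refine Finset.sum_congr rfl fun d hd => ?_
  rw [coeff_C_mul, coeff_X_pow]
  split_ifs with h
  · have hdp : d ∣ p := (Nat.dvd_of_mem_divisors hd).trans (Nat.gcd_dvd_right _ _)
    have hd0 : (d : ℚ) ≠ 0 := by exact_mod_cast (Nat.pos_of_mem_divisors hd).ne'
    have hi' : (i : ℚ) ≠ 0 := by positivity
    have hp' : (p : ℚ) ≠ 0 := by positivity
    rw [h, Nat.cast_div hdp hd0]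
    field_simp
  · simp

lemma constantCoeff_exponentP (hp : 0 < p) : constantCoeff (exponentP p i) = 0 := by
  rw [exponentP, map_mul, map_sum]
  rw [Finset.sum_eq_zero, mul_zero]
  intro d hd
  have hdp : d ∣ p := (Nat.dvd_of_mem_divisors hd).trans (Nat.gcd_dvd_right _ _)
  have := Nat.div_pos (Nat.le_of_dvd hp hdp) (Nat.pos_of_mem_divisors hd)
  simp [this.ne']

lemma theta_seriesP (hp : 0 < p) : theta (seriesP p i) = theta (exponentP p i) * seriesP p i :=
  theta_exp_subst (constantCoeff_exponentP hp)

lemma constantCoeff_seriesP (hp : 0 < p) : constantCoeff (seriesP p i) = 1 :=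
  constantCoeff_exp_subst (constantCoeff_exponentP hp)

/-- `P_i(z ^ i)` is the exponential generating function of the pairs of commuting permutations, the
first with all cycles of length `p`, the second with all cycles of length `i`. -/
theorem seriesP_subst_eq (hi : 0 < i) (hp : 0 < p) :
    (seriesP p i).subst ((X : ℚ⟦X⟧) ^ i) = goodSeries (pairLengths p i) (noneRel Unit) := by
  have hs := HasSubst.X_pow (R := ℚ) hi.ne'
  refine eq_of_theta_eq ?_ (constantCoeff_rootedTransSeries _ _) ?_ (theta_goodSeries _ _)
  · rw [constantCoeff_subst_X_pow hi.ne', constantCoeff_seriesP hp, constantCoeff_goodSeries,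
      map_one]
  · rw [theta_subst_X_pow hi.ne', theta_seriesP hp, subst_mul hs, ← mul_assoc]
    congr 1
    ext n
    rw [coeff_C_mul, coeff_subst_X_pow hi.ne', coeff_rootedTransSeries_pair p i n hi hp]
    have hi' : (i : ℚ) ≠ 0 := by positivity
    split_ifs with h
    · obtain ⟨j, rfl⟩ := h
      rw [Nat.mul_div_cancel_left _ hi, coeff_theta_exponentP hi hp]
      simp only [Nat.mul_right_inj hi.ne']
      simp [hi']
    · rw [Finset.sum_eq_zero]
      · simp
      · intro d _
        rw [if_neg]
        intro h'
        exact h ⟨_, h'⟩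

lemma coeff_seriesP (hi : 0 < i) (hp : 0 < p) (j : ℕ) :
    coeff j (seriesP p i) =
      (goodCount (pairLengths p i) (noneRel Unit) (i * j) : ℚ) / (i * j).factorial := by
  have := congrArg (coeff (i * j)) (seriesP_subst_eq hi hp)
  rw [coeff_subst_X_pow hi.ne', if_pos (dvd_mul_right _ _), Nat.mul_div_cancel_left _ hi] at this
  simpa [goodSeries] using this

lemma coeff_seriesP_nonneg (hi : 0 < i) (hp : 0 < p) (j : ℕ) : 0 ≤ coeff j (seriesP p i) := by
  rw [coeff_seriesP hi hp]; positivity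

/-- The coefficients of `P_i` are at most `1 / j`: in the recurrence for them the weights
`φ(d) / i`, for `d` dividing `gcd(i, p)`, add up to at most `1`. -/
lemma mul_coeff_seriesP_le (hi : 0 < i) (hp : 0 < p) (j : ℕ) :
    j * coeff j (seriesP p i) ≤ 1 ∧ coeff j (seriesP p i) ≤ 1 := by
  induction j using Nat.strong_induction_on with
  | _ j ih =>
    rcases Nat.eq_zero_or_pos j with rfl | hj
    · have := constantCoeff_seriesP (i := i) hp
      simp [this]
    · have hi' : (0 : ℚ) < i := by positivity
      have key : j * coeff j (seriesP p i) ≤ 1 := by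
        rw [← coeff_theta, theta_seriesP hp, coeff_mul,
          Finset.Nat.sum_antidiagonal_eq_sum_range_succ_mk]
        have h1 : ∀ k ∈ Finset.range j.succ,
            coeff k (theta (exponentP p i)) * coeff (j - k) (seriesP p i) ≤
            coeff k (theta (exponentP p i)) := by
          intro k hk
          rcases Nat.eq_zero_or_pos k with rfl | hk0
          · rw [coeff_theta]; simp
          · refine mul_le_of_le_one_right ?_ (ih _ (by omega)).2
            rw [coeff_theta_exponentP hi hp]
            refine mul_nonneg (by positivity) (Finset.sum_nonneg fun d _ => ?_)
            split_ifs <;> positivity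
        refine (Finset.sum_le_sum h1).trans ?_
        simp only [coeff_theta_exponentP hi hp]
        rw [← Finset.mul_sum, Finset.sum_comm]
        have h2 : ∀ d ∈ (Nat.gcd i p).divisors,
            (∑ k ∈ Finset.range j.succ, if k = p / d then (d.totient : ℚ) else 0) ≤ d.totient := by
          intro d _
          rw [Finset.sum_ite_eq']
          split_ifs
          · exact le_rfl
          · positivity
        have h3 : (∑ d ∈ (Nat.gcd i p).divisors, (d.totient : ℚ)) = (Nat.gcd i p : ℚ) := by
          exact_mod_cast Nat.sum_totient (Nat.gcd i p)
        have h4 : (Nat.gcd i p : ℚ) ≤ i := by exact_mod_cast Nat.gcd_le_left _ hi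
        calc _ ≤ 1 / (i : ℚ) * i := by
              refine mul_le_mul_of_nonneg_left ?_ (by positivity)
              exact (Finset.sum_le_sum h2).trans (h3.le.trans h4)
          _ = 1 := by field_simp
      refine ⟨key, ?_⟩
      have hj1 : (1 : ℚ) ≤ j := by exact_mod_cast hj
      have := coeff_seriesP_nonneg hi hp j
      nlinarith

end

/-! ### Hypermaps as families of permutations -/

/-- Cycle lengths of a triple consisting of the permutations `α` (index `some true`) and `σ` (index
`some false`) of a `(p, ∞)`-hypermap and of a further permutation (index `none`). -/
def tripleLengths (p : ℕ) (Θ : Set ℕ) : Option Bool → Set ℕ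
  | none => Θ
  | some true => {p}
  | some false => Set.univ

lemma ncard_sameCycle_eq {D : Type} [Finite D] (f : Perm D) (x : D) :
    {y : D | f.SameCycle x y}.ncard = minimalPeriod f x := by
  have hpos := minimalPeriod_perm_pos f x
  have hr : {y : D | f.SameCycle x y} = Set.range fun n : Fin (minimalPeriod f x) => f^[n] x := by
    ext y
    constructor
    · intro h
      obtain ⟨n, hn⟩ := Perm.SameCycle.exists_nat_pow_eq h
      refine ⟨⟨n % minimalPeriod f x, Nat.mod_lt _ hpos⟩, ?_⟩
      simp only
      rw [iterate_mod_minimalPeriod_eq, Perm.iterate_eq_pow, hn]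
    · rintro ⟨n, rfl⟩
      refine ⟨n, ?_⟩
      simp only [Perm.iterate_eq_pow, zpow_natCast]
  rw [hr, Set.ncard_range_of_injective]
  · simp
  · intro n m h
    exact Fin.ext (iterate_injOn_Iio_minimalPeriod n.2 m.2 h)

lemma isPretransitive_iff_transFam {D : Type} [Finite D] (c : Bool → Perm D) :
    MulAction.IsPretransitive (Subgroup.closure ({c true, c false} : Set (Perm D))) D ↔
      TransFam c := by
  constructor
  · intro h S hS hcl
    obtain ⟨x, hx⟩ := hS
    have key : ∀ g ∈ Subgroup.closure ({c true, c false} : Set (Perm D)), ∀ z ∈ S, g z ∈ S := by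
      intro g hg
      induction hg using Subgroup.closure_induction with
      | mem g hg =>
        rcases hg with rfl | rfl
        · exact hcl true
        · exact hcl false
      | one => exact fun z hz => hz
      | mul a b _ _ ha hb => exact fun z hz => ha _ (hb z hz)
      | inv a _ ha =>
        intro z hz
        refine mem_of_apply_mem ha ?_
        simpa using hz
    rw [Set.eq_univ_iff_forall]
    intro y
    obtain ⟨g, rfl⟩ := h.exists_smul_eq x y
    exact key g.1 g.2 x hx
  · intro h
    refine ⟨fun x y => ?_⟩
    have := h {y | ∃ g : Subgroup.closure ({c true, c false} : Set (Perm D)), g • x = y}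
      ⟨x, 1, one_smul _ _⟩ (by
        rintro k _ ⟨g, rfl⟩
        refine ⟨⟨c k, Subgroup.subset_closure (by cases k <;> simp)⟩ * g, ?_⟩
        rw [mul_smul]; rfl)
    exact Set.eq_univ_iff_forall.1 this y

/-- A family indexed by `Bool` from its two members. -/
def pairFam {D : Type} (α σ : Perm D) : Bool → Perm D
  | true => α
  | false => σ

/-- The family consisting of the two permutations of a hypermap. -/
def Hypermap.fam {D : Type} (H : Hypermap D) : Bool → Perm D := pairFam H.α H.σ

lemma Hypermap.transFam_fam {D : Type} [Finite D] (H : Hypermap D) : TransFam H.fam :=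
  (isPretransitive_iff_transFam H.fam).1 H.transitive

lemma Hypermap.ext_perm {D : Type} {H₁ H₂ : Hypermap D} (hα : H₁.α = H₂.α) (hσ : H₁.σ = H₂.σ) :
    H₁ = H₂ := by
  cases H₁; cases H₂; cases hα; cases hσ; rfl

instance {D : Type} [Finite D] : Finite (Hypermap D) :=
  Finite.of_injective (fun H => (H.α, H.σ)) fun _ _ h =>
    Hypermap.ext_perm (congrArg Prod.fst h) (congrArg Prod.snd h)

/-- Conjugation of a hypermap by a permutation of its darts. -/
def Hypermap.conj {D : Type} [Finite D] (ψ : Perm D) (H : Hypermap D) : Hypermap D where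
  α := ψ.permCongr H.α
  σ := ψ.permCongr H.σ
  nonempty_darts := H.nonempty_darts
  transitive := (isPretransitive_iff_transFam (permFamilyCongr Bool ψ H.fam)).2
    ((isTrans_permFamilyCongr ψ H.fam).2 H.transFam_fam)

lemma Hypermap.isPInfinity_iff {D : Type} [Finite D] (p : ℕ) (H : Hypermap D) :
    H.IsPInfinity p ↔ ∀ y, minimalPeriod H.α y = p := by
  simp only [Hypermap.IsPInfinity, ncard_sameCycle_eq]

lemma minimalPeriod_permCongr {D : Type} (ψ f : Perm D) (y : D) :
    minimalPeriod (ψ.permCongr f) (ψ y) = minimalPeriod f y :=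
  minimalPeriod_of_semiconj ψ.injective (fun y => by simp) y

/-- Permutations of the darts act on the `(p, ∞)`-hypermaps by conjugation. -/
instance conjAction (p n : ℕ) :
    MulAction (Perm (Fin n)) {H : Hypermap (Fin n) // H.IsPInfinity p} where
  smul ψ H := ⟨H.1.conj ψ, by
    rw [Hypermap.isPInfinity_iff]
    intro y
    obtain ⟨z, rfl⟩ := ψ.surjective y
    exact (minimalPeriod_permCongr ψ H.1.α z).trans ((H.1.isPInfinity_iff p).1 H.2 z)⟩
  one_smul H := Subtype.ext (Hypermap.ext_perm rfl rfl)
  mul_smul ψ χ H := Subtype.ext (Hypermap.ext_perm rfl rfl)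

lemma permCongr_eq_iff {D : Type} (ψ f : Perm D) :
    ψ.permCongr f = f ↔ ∀ y, ψ (f y) = f (ψ y) := by
  constructor
  · intro h y
    have := congrFun (congrArg DFunLike.coe h) (ψ y)
    simpa using this
  · intro h
    ext y
    obtain ⟨z, rfl⟩ := ψ.surjective y
    simp [h]

lemma blockLengths_triple (p j : ℕ) :
    blockLengths j (tripleLengths p Set.univ) = tripleLengths p Set.univ := by
  funext k
  rcases k with _ | _
  · exact Set.eq_univ_of_forall fun _ => trivial
  · rfl

/-- A family indexed by `Option Bool` from its three members. -/
def tripleFam {D : Type} (g α σ : Perm D) : Option Bool → Perm D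
  | none => g
  | some true => α
  | some false => σ

/-- Burnside's lemma for the isomorphism classes of `(p, ∞)`-hypermaps. -/
theorem blockCount_triple (p j m : ℕ) :
    blockCount (tripleLengths p Set.univ) j (m + 1) =
      Hypermap.numIsoClasses p (m + 1) * (m + 1).factorial := by
  classical
  let X := {H : Hypermap (Fin (m + 1)) // H.IsPInfinity p}
  have : Fintype X := Fintype.ofFinite X
  have : Fintype (Quotient (MulAction.orbitRel (Perm (Fin (m + 1))) X)) := Fintype.ofFinite _
  have hB := MulAction.sum_card_fixedBy_eq_card_orbits_mul_card_group (Perm (Fin (m + 1))) X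
  have hq : Hypermap.numIsoClasses p (m + 1) =
      Fintype.card (Quotient (MulAction.orbitRel (Perm (Fin (m + 1))) X)) := by
    rw [← Nat.card_eq_fintype_card, Hypermap.numIsoClasses]
    refine Nat.card_congr (Quotient.congr (Equiv.refl _) fun H₁ H₂ => ?_)
    change H₁.1.Isomorphic H₂.1 ↔ H₁ ∈ MulAction.orbit (Perm (Fin (m + 1))) H₂
    rw [MulAction.mem_orbit_symm]
    constructor
    · rintro ⟨ψ, h1, h2⟩
      exact ⟨ψ, Subtype.ext (Hypermap.ext_perm h1 h2)⟩
    · rintro ⟨ψ, h⟩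
      have h := congrArg Subtype.val h
      exact ⟨ψ, congrArg Hypermap.α h, congrArg Hypermap.σ h⟩
  rw [Fintype.card_perm, Fintype.card_fin, ← hq] at hB
  rw [← hB, blockCount, blockLengths_triple, ← Fintype.card_sigma, ← Nat.card_eq_fintype_card]
  have hfix : ∀ (ψ : Perm (Fin (m + 1))) (H : X), H ∈ MulAction.fixedBy X ψ ↔
      (∀ y, ψ (H.1.α y) = H.1.α (ψ y)) ∧ (∀ y, ψ (H.1.σ y) = H.1.σ (ψ y)) := by
    intro ψ H
    rw [MulAction.mem_fixedBy, ← permCongr_eq_iff, ← permCongr_eq_iff]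
    constructor
    · intro h
      have h := congrArg Subtype.val h
      exact ⟨congrArg Hypermap.α h, congrArg Hypermap.σ h⟩
    · rintro ⟨h1, h2⟩
      exact Subtype.ext (Hypermap.ext_perm h1 h2)
  symm
  refine Nat.card_congr (Equiv.ofBijective (fun q =>
    ⟨tripleFam q.1 q.2.1.1.α q.2.1.1.σ, ⟨?_, ?_⟩, ?_⟩) ⟨?_, ?_⟩)
  · intro k y
    rcases k with _ | _ | _
    · trivial
    · trivial
    · exact (q.2.1.1.isPInfinity_iff p).1 q.2.1.2 y
  · rintro k k' rfl
    have := (hfix _ _).1 q.2.2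
    rcases k' with _ | _ | _
    · intro _; rfl
    · exact this.2
    · exact this.1
  · have := q.2.1.1.transFam_fam
    convert this using 1
    funext k
    cases k <;> rfl
  · rintro ⟨ψ, ⟨⟨H, hH⟩, h⟩⟩ ⟨ψ', ⟨⟨H', hH'⟩, h'⟩⟩ he
    have he := congrArg Subtype.val he
    have e1 : ψ = ψ' := congrFun he none
    have e2 : H = H' := Hypermap.ext_perm (congrFun he (some true)) (congrFun he (some false))
    subst e1 e2
    rfl
  · rintro ⟨c, hc, htr⟩
    have hH : MulAction.IsPretransitive
        (Subgroup.closure ({c (some true), c (some false)} : Set (Perm (Fin (m + 1)))))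
        (Fin (m + 1)) := (isPretransitive_iff_transFam fun i => c (some i)).2 htr
    let H : Hypermap (Fin (m + 1)) := ⟨c (some true), c (some false), ⟨0⟩, hH⟩
    have hHp : H.IsPInfinity p := (H.isPInfinity_iff p).2 fun y => hc.1 (some true) y
    refine ⟨⟨c none, ⟨⟨H, hHp⟩, (hfix _ _).2 ⟨hc.2 none (some true) rfl,
      hc.2 none (some false) rfl⟩⟩⟩, Subtype.ext ?_⟩
    funext k
    rcases k with _ | _ | _ <;> rfl

/-- In the series counting transitive triples with a marked point, the coefficient at `n` is the sum
of `m c_m` over the divisors `m` of `n`, where `c_m` counts the hypermaps on `m` darts. -/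
theorem coeff_rootedTransSeries_triple (p n : ℕ) :
    coeff n (rootedTransSeries (tripleLengths p Set.univ) (noneRel Bool)) =
      ∑ m ∈ n.divisors, (m : ℚ) * Hypermap.numIsoClasses p m := by
  cases n with
  | zero => simp [constantCoeff_rootedTransSeries]
  | succ N =>
    rw [coeff_succ_rootedTransSeries, transCount_div_factorial]
    simp only [blockCount_triple]
    rw [Nat.divisors, Finset.sum_filter,
      Finset.sum_Ico_eq_sum_range]
    refine Finset.sum_congr rfl fun k _ => ?_
    rw [add_comm 1 k]
    refine if_congr Iff.rfl ?_ rfl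
    rw [Nat.factorial_succ]
    have : (k.factorial : ℚ) ≠ 0 := by positivity
    push_cast
    field_simp

/-! ### Counting the permutations that commute with a given one -/

/-- The number of permutations with all cycles of length `p` that commute with `g`. -/
noncomputable def commCount {D : Type} (p : ℕ) (g : Perm D) : ℕ :=
  Nat.card {a : Perm D // (∀ y, a (g y) = g (a y)) ∧ ∀ y, minimalPeriod a y = p}

section
variable {D D' : Type}

lemma commCount_permCongr (p : ℕ) (e : D ≃ D') (g : Perm D) :
    commCount p (e.permCongr g) = commCount p g := by
  refine (Nat.card_congr (e.permCongr.subtypeEquiv fun a => and_congr ?_ ?_)).symm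
  · constructor
    · intro h y
      obtain ⟨z, rfl⟩ := e.surjective y
      simp [h]
    · intro h y
      have := h (e y)
      simpa using this
  · have : ∀ y, minimalPeriod (e.permCongr a) (e y) = minimalPeriod a y := fun y =>
      minimalPeriod_of_semiconj e.injective (fun y => by simp) y
    constructor
    · intro h y
      obtain ⟨z, rfl⟩ := e.surjective y
      rw [this, h]
    · intro h y
      rw [← this, h]

lemma commCount_of_isConj (p : ℕ) {g g' : Perm D} (h : IsConj g g') :
    commCount p g = commCount p g' := by
  obtain ⟨c, hc⟩ := isConj_iff.1 h
  rw [← commCount_permCongr p c g]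
  congr 1

lemma commCount_of_isEmpty [IsEmpty D] (p : ℕ) (g : Perm D) : commCount p g = 1 := by
  rw [commCount, Nat.card_eq_one_iff_unique]
  exact ⟨⟨fun a b => Subtype.ext (Subsingleton.elim _ _)⟩,
    ⟨⟨1, fun y => isEmptyElim y, fun y => isEmptyElim y⟩⟩⟩

/-- If a function `f` is invariant under all the permutations commuting with `g`, these
permutations are given by their restrictions to the fibres of `f`. -/
lemma commCount_eq_prod_fiber [Finite D] {I : Type} [Fintype I] (p : ℕ) (g : Perm D) (f : D → I)
    (hg : ∀ y, f (g y) = f y)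
    (hf : ∀ a : Perm D, (∀ y, a (g y) = g (a y)) → ∀ y, f (a y) = f y) :
    commCount p g = ∏ i, commCount p
      (g.subtypePerm (p := fun y => f y = i) fun y => by rw [hg]) := by
  classical
  unfold commCount
  rw [← Nat.card_pi]
  symm
  let glue (a : ∀ i, Perm {y // f y = i}) : Perm D :=
    (Equiv.sigmaFiberEquiv f).permCongr (Equiv.sigmaCongrRight a)
  have hglue : ∀ a y i (h : f y = i), glue a y = (a i ⟨y, h⟩ : D) := by
    rintro a y i rfl
    rfl
  refine Nat.card_congr (Equiv.ofBijective (fun a => ⟨glue fun i => (a i).1, ?_, ?_⟩) ⟨?_, ?_⟩)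
  · intro y
    rw [hglue _ y _ rfl, hglue _ (g y) _ (hg y)]
    exact congrArg Subtype.val ((a (f y)).2.1 ⟨y, rfl⟩)
  · intro y
    refine Eq.trans ?_ ((a (f y)).2.2 ⟨y, rfl⟩)
    exact minimalPeriod_of_semiconj (e := fun y : {z // f z = f y} => (y : D))
      Subtype.val_injective
      (fun z => (hglue _ z.1 _ z.2).symm) ⟨y, rfl⟩
  · intro a b h
    have h := congrArg Subtype.val h
    funext i
    refine Subtype.ext (Equiv.ext fun y => Subtype.ext ?_)
    rw [← hglue (fun i => (a i).1) y.1 i y.2, ← hglue (fun i => (b i).1) y.1 i y.2]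
    exact congrFun (congrArg DFunLike.coe h) _
  · rintro ⟨a, ha, hp⟩
    have hfa := hf a ha
    refine ⟨fun i => ⟨a.subtypePerm fun y => by rw [hfa], ?_, ?_⟩, ?_⟩
    · intro y
      exact Subtype.ext (ha y)
    · intro y
      rw [← hp y]
      exact (minimalPeriod_of_semiconj Subtype.val_injective (fun z => rfl) y).symm
    · refine Subtype.ext (Equiv.ext fun y => ?_)
      rw [hglue _ y _ rfl]
      rfl

section
variable [Fintype D] [DecidableEq D]

lemma minimalPeriod_eq_card_support_cycleOf {g : Perm D} {y : D} (hy : y ∈ g.support) :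
    minimalPeriod g y = (g.cycleOf y).support.card := by
  rw [← ncard_sameCycle_eq, ← Set.ncard_coe_finset]
  congr 1
  ext z
  simp only [Set.mem_ofPred_eq, Finset.mem_coe, Perm.mem_support_cycleOf_iff]
  exact ⟨fun h => ⟨h, hy⟩, fun h => h.1⟩

lemma card_minimalPeriod_eq (g : Perm D) (i : ℕ) :
    Nat.card {y // minimalPeriod g y = i} = i * g.partition.parts.count i := by
  rw [Perm.parts_partition, Multiset.count_add]
  have hfix : ∀ y, minimalPeriod g y = 1 ↔ y ∉ g.support := by
    intro y
    rw [minimalPeriod_eq_one_iff_isFixedPt, Perm.mem_support, not_not]; rfl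
  by_cases h1 : i = 1
  · subst h1
    have : g.cycleType.count 1 = 0 := Multiset.count_eq_zero.2 fun h =>
      absurd (Perm.two_le_of_mem_cycleType h) (by norm_num)
    rw [this, Multiset.count_replicate_self, one_mul, zero_add]
    simp only [hfix]
    rw [Nat.card_eq_fintype_card, Fintype.card_subtype_compl, Fintype.card_coe]
  · rw [Multiset.count_replicate, if_neg (Ne.symm h1), add_zero, Perm.cycleType_def,
      Multiset.count_map]
    have hset : {y | minimalPeriod g y = i} =
        ((g.cycleFactorsFinset.filter fun c => i = c.support.card).biUnion Perm.support : Set D) := by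
      ext y
      simp only [Set.mem_ofPred_eq, Finset.coe_biUnion, Finset.mem_coe, Finset.mem_filter,
        Set.mem_iUnion, exists_prop]
      constructor
      · intro h
        have hy : y ∈ g.support := by
          by_contra hy
          exact h1 (h.symm.trans ((hfix y).2 hy))
        refine ⟨g.cycleOf y, ⟨Perm.cycleOf_mem_cycleFactorsFinset_iff.2 hy, ?_⟩,
          Perm.mem_support_cycleOf_iff.2 ⟨Perm.SameCycle.refl _ _, hy⟩⟩
        rw [← h, minimalPeriod_eq_card_support_cycleOf hy]
      · rintro ⟨c, ⟨hc, hi⟩, hy⟩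
        have := Perm.cycle_is_cycleOf hy hc
        rw [hi, this]
        exact minimalPeriod_eq_card_support_cycleOf
          (Perm.mem_cycleFactorsFinset_support_le hc hy)
    have hcard : Nat.card {y // minimalPeriod g y = i} = {y | minimalPeriod g y = i}.ncard := rfl
    rw [hcard, hset, Set.ncard_coe_finset, Finset.card_biUnion]
    · rw [Finset.sum_congr rfl fun c hc => ((Finset.mem_filter.1 hc).2).symm, Finset.sum_const,
        smul_eq_mul, mul_comm]
      rfl
    · intro c hc d hd hcd
      exact (g.cycleFactorsFinset_pairwise_disjoint (Finset.mem_filter.1 hc).1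
        (Finset.mem_filter.1 hd).1 hcd).disjoint_support

/-- The cycle type of a permutation all of whose cycles have the same length. -/
lemma parts_of_uniform {g : Perm D} {i j : ℕ} (hi : 0 < i) (hg : ∀ y, minimalPeriod g y = i)
    (hD : Nat.card D = i * j) : g.partition.parts = Multiset.replicate j i := by
  ext k
  have h := card_minimalPeriod_eq g k
  rw [Multiset.count_replicate]
  split_ifs with hk
  · subst hk
    rw [Nat.card_congr (Equiv.subtypeUnivEquiv hg), hD] at h
    exact (Nat.eq_of_mul_eq_mul_left hi h).symm
  · rw [Nat.card_eq_zero.2 (Or.inl ⟨fun y => hk ((hg y.1).symm.trans y.2)⟩)] at h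
    rcases mul_eq_zero.1 h.symm with rfl | h
    · exact Multiset.count_eq_zero.2 fun h => absurd (g.partition.parts_pos h) (lt_irrefl 0)
    · exact h

lemma card_centralizer_uniform {g : Perm D} {i j : ℕ} (hi : 0 < i)
    (hg : ∀ y, minimalPeriod g y = i) (hD : Nat.card D = i * j) :
    Nat.card (Subgroup.centralizer {g}) = i ^ j * j.factorial := by
  have hparts := parts_of_uniform hi hg hD
  rw [Perm.nat_card_centralizer, ← Nat.card_eq_fintype_card, hD,
    ← Perm.filter_parts_partition_eq_cycleType, hparts]
  by_cases h2 : 2 ≤ i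
  · rw [Multiset.filter_eq_self.2 fun a ha => by rw [Multiset.eq_of_mem_replicate ha]; exact h2]
    rw [Multiset.sum_replicate, Multiset.prod_replicate, smul_eq_mul, mul_comm j i, Nat.sub_self,
      Nat.factorial_zero, one_mul]
    congr 1
    rcases Nat.eq_zero_or_pos j with rfl | hj
    · simp
    · rw [Multiset.toFinset_replicate, if_neg hj.ne', Finset.prod_singleton,
        Multiset.count_replicate_self]
  · rw [Multiset.filter_eq_nil.2 fun a ha => by rw [Multiset.eq_of_mem_replicate ha]; exact h2]
    obtain rfl : i = 1 := by omega
    simp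

/-- The orbit of `g` under conjugation consists of all the permutations with cycles of the same length. -/
lemma card_uniform {g : Perm D} {i j : ℕ} (hi : 0 < i) (hg : ∀ y, minimalPeriod g y = i)
    (hD : Nat.card D = i * j) :
    Nat.card {h : Perm D // ∀ y, minimalPeriod h y = i} * (i ^ j * j.factorial) =
      (i * j).factorial := by
  have hparts := parts_of_uniform hi hg hD
  have h := Perm.card_isConj_mul_eq g
  rw [← Perm.nat_card_centralizer, card_centralizer_uniform hi hg hD, ← Nat.card_eq_fintype_card,
    hD] at h
  have hset : Nat.card {h : Perm D | IsConj g h} =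
      Nat.card {h : Perm D // ∀ y, minimalPeriod h y = i} := by
    refine Nat.card_congr (Equiv.subtypeEquivRight fun h => ?_)
    change IsConj g h ↔ _
    rw [Perm.partition_eq_of_isConj]
    constructor
    · intro hgh y
      have hc := card_minimalPeriod_eq h i
      rw [← hgh, ← card_minimalPeriod_eq g i, Nat.card_congr (Equiv.subtypeUnivEquiv hg)] at hc
      by_contra hne
      have := Fintype.card_subtype_lt (p := fun y => minimalPeriod h y = i) hne
      rw [← Nat.card_eq_fintype_card, ← Nat.card_eq_fintype_card] at this
      omega
    · intro hh
      exact Nat.Partition.ext (hparts.trans (parts_of_uniform hi hh hD).symm)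
  rwa [hset] at h

end

lemma goodCount_pair_eq_sum (p i n : ℕ) :
    goodCount (pairLengths p i) (noneRel Unit) n =
      ∑ g : {g : Perm (Fin n) // ∀ y, minimalPeriod g y = i}, commCount p g.1 := by
  classical
  unfold commCount
  rw [← Nat.card_sigma, goodCount]
  refine Nat.card_congr (Equiv.ofBijective
    (fun c => ⟨⟨c.1 (some ()), c.2.1 (some ())⟩, ⟨c.1 none, c.2.2 none (some ()) rfl,
      c.2.1 none⟩⟩) ⟨?_, ?_⟩)
  · rintro ⟨c, hc⟩ ⟨d, hd⟩ h
    have h1 : c (some ()) = d (some ()) := congrArg (fun q => q.1.1) h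
    have h2 : c none = d none := congrArg (fun q => q.2.1) h
    refine Subtype.ext (funext fun k => ?_)
    rcases k with _ | _
    · exact h2
    · exact h1
  · rintro ⟨⟨g, hg⟩, ⟨a, ha, hp⟩⟩
    refine ⟨⟨fun k => k.elim a fun _ => g, ?_, ?_⟩, rfl⟩
    · intro k y
      rcases k with _ | _
      · exact hp y
      · exact hg y
    · rintro k k' rfl
      rcases k' with _ | _
      · intro _; rfl
      · exact ha

/-- The number of permutations with all cycles of length `p` in the centralizer of a product of `j`
cycles of length `i`. -/
lemma commCount_uniform [Finite D] {p i j : ℕ} (hi : 0 < i) (hp : 0 < p) {g : Perm D}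
    (hg : ∀ y, minimalPeriod g y = i) (hD : Nat.card D = i * j) :
    (commCount p g : ℚ) = i ^ j * j.factorial * coeff j (seriesP p i) := by
  classical
  have e : D ≃ Fin (i * j) := Finite.equivFinOfCardEq hD
  have hg' : ∀ y, minimalPeriod (e.permCongr g) y = i := by
    intro y
    obtain ⟨z, rfl⟩ := e.surjective y
    refine Eq.trans ?_ (hg z)
    exact minimalPeriod_of_semiconj e.injective (fun y => by simp) z
  have hF : Nat.card (Fin (i * j)) = i * j := Nat.card_fin _
  have hu := card_uniform hi hg' hF
  have hsum := goodCount_pair_eq_sum p i (i * j)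
  have hc : ∀ h : {h : Perm (Fin (i * j)) // ∀ y, minimalPeriod h y = i},
      commCount p h.1 = commCount p g := by
    intro h
    rw [← commCount_permCongr p e g]
    refine commCount_of_isConj p (Perm.partition_eq_of_isConj.2 (Nat.Partition.ext ?_))
    rw [parts_of_uniform hi h.2 hF, parts_of_uniform hi hg' hF]
  rw [Finset.sum_congr rfl fun h _ => hc h, Finset.sum_const, Finset.card_univ,
    ← Nat.card_eq_fintype_card, smul_eq_mul] at hsum
  rw [coeff_seriesP hi hp, hsum, ← hu]
  have hne : Nat.card {h : Perm (Fin (i * j)) // ∀ y, minimalPeriod h y = i} ≠ 0 := by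
    intro h0
    rw [h0, zero_mul] at hu
    exact (Nat.factorial_pos _).ne hu
  push_cast
  field_simp

end

/-! ### The Hadamard products and the partition generating function -/

lemma coeff_seriesQ (j : ℕ) : coeff j seriesQ = 1 := by
  have h : seriesQ = PowerSeries.mk 1 := by
    rw [seriesQ, PowerSeries.inv_eq_iff_mul_eq_one (by simp)]
    rw [PowerSeries.mk_one_mul_one_sub_eq_one]
  rw [h, coeff_mk]; rfl

lemma coeff_hadamardAt {p i : ℕ} (hi : 0 < i) (j : ℕ) :
    coeff j (hadamardAt i (seriesP p i) seriesQ) = i ^ j * j.factorial * coeff j (seriesP p i) := by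
  rw [hadamardAt, coeff_mk, coeff_seriesQ, mul_one, mul_div_assoc, div_self, mul_one]
  positivity

lemma constantCoeff_hadamardAt {p : ℕ} (hp : 0 < p) (i : ℕ) :
    constantCoeff (hadamardAt i (seriesP p i) seriesQ) = 1 := by
  rw [← coeff_zero_eq_constantCoeff_apply, hadamardAt, coeff_mk, coeff_seriesQ,
    coeff_zero_eq_constantCoeff_apply, constantCoeff_seriesP hp]
  simp

/-- The permutations commuting with `g` are counted by splitting the domain of `g` according to the
lengths of its cycles. -/
lemma commCount_eq_partition_prod {n p : ℕ} (hp : 0 < p) (g : Perm (Fin n)) :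
    (commCount p g : ℚ) = g.partition.parts.toFinsupp.prod fun i j =>
      coeff j (hadamardAt i (seriesP p i) seriesQ) := by
  classical
  have hle : ∀ y, minimalPeriod g y < n + 1 := fun y => by
    rw [← ncard_sameCycle_eq]
    have := Set.ncard_le_card {z | g.SameCycle y z}
    rw [Nat.card_fin] at this
    omega
  let f : Fin n → Fin (n + 1) := fun y => ⟨minimalPeriod g y, hle y⟩
  have hf : ∀ a : Perm (Fin n), (∀ y, a (g y) = g (a y)) → ∀ y, f (a y) = f y := by
    intro a ha y
    exact Fin.ext (minimalPeriod_of_semiconj a.injective ha y)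
  rw [commCount_eq_prod_fiber p g f (hf g fun _ => rfl) hf]
  push_cast
  have hterm : ∀ i : Fin (n + 1), (commCount p
      (g.subtypePerm (p := fun y => f y = i) fun y => by rw [hf g fun _ => rfl]) : ℚ) =
      coeff (g.partition.parts.count (i : ℕ))
        (hadamardAt (i : ℕ) (seriesP p i) seriesQ) := by
    intro i
    have hcard : Nat.card {y // f y = i} = i * g.partition.parts.count (i : ℕ) := by
      rw [← card_minimalPeriod_eq]
      exact Nat.card_congr (Equiv.subtypeEquivRight fun y => by simp [f, Fin.ext_iff])
    have hper : ∀ y, minimalPeriod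
        (g.subtypePerm (p := fun y => f y = i) fun y => by rw [hf g fun _ => rfl]) y = i := by
      intro y
      have h1 : minimalPeriod g y.1 = i := congrArg Fin.val y.2
      rw [← h1]
      exact (minimalPeriod_of_semiconj Subtype.val_injective (fun z => rfl) y).symm
    rcases Nat.eq_zero_or_pos (i : ℕ) with h0 | h0
    · have : IsEmpty {y // f y = i} := by
        rw [h0, zero_mul, Nat.card_eq_zero] at hcard
        rcases hcard with h | h
        · exact h
        · exact (h.not_finite inferInstance).elim
      rw [commCount_of_isEmpty, Multiset.count_eq_zero.2 fun h =>
        absurd (g.partition.parts_pos h) (by omega), coeff_zero_eq_constantCoeff_apply,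
        constantCoeff_hadamardAt hp]
      simp
    · rw [coeff_hadamardAt h0, commCount_uniform h0 hp hper hcard]
  rw [Finset.prod_congr rfl fun i _ => hterm i]
  rw [Finsupp.prod_of_support_subset _ (s := Finset.range (n + 1)), ← Fin.prod_univ_eq_prod_range
    (fun i => coeff (g.partition.parts.toFinsupp i) (hadamardAt i (seriesP p i) seriesQ))]
  · rfl
  · intro i hi
    rw [Multiset.toFinsupp_support, Multiset.mem_toFinset] at hi
    have := Multiset.single_le_sum (fun _ _ => Nat.zero_le _) i hi
    rw [g.partition.parts_sum, Fintype.card_fin] at this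
    simp; omega
  · intro i _
    rw [coeff_zero_eq_constantCoeff_apply, constantCoeff_hadamardAt hp]

/-- Once the commuting permutation `g` is chosen, `α` and `σ` are chosen in its centralizer
independently of each other. -/
lemma goodCount_triple_eq_sum (p n : ℕ) (Θ : Set ℕ) [DecidablePred fun g : Perm (Fin n) =>
    ∀ y, minimalPeriod g y ∈ Θ] :
    goodCount (tripleLengths p Θ) (noneRel Bool) n =
      ∑ g ∈ Finset.univ.filter fun g : Perm (Fin n) => ∀ y, minimalPeriod g y ∈ Θ,
        commCount p g * Nat.card (Subgroup.centralizer {g}) := by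
  classical
  unfold commCount
  have : ∀ g : Perm (Fin n), Nat.card {a : Perm (Fin n) // (∀ y, a (g y) = g (a y)) ∧
      ∀ y, minimalPeriod a y = p} * Nat.card (Subgroup.centralizer {g}) =
      Nat.card ({a : Perm (Fin n) // (∀ y, a (g y) = g (a y)) ∧
        ∀ y, minimalPeriod a y = p} × {s : Perm (Fin n) // ∀ y, g (s y) = s (g y)}) := by
    intro g
    rw [Nat.card_prod]
    congr 1
    refine Nat.card_congr (Equiv.subtypeEquivRight fun s => ?_)
    rw [Subgroup.mem_centralizer_singleton_iff]
    constructor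
    · intro h y
      exact congrFun (congrArg DFunLike.coe h.symm) y
    · intro h
      exact (Equiv.ext h).symm
  simp only [this]
  rw [Finset.sum_subtype (F := inferInstance) (p := fun g : Perm (Fin n) => ∀ y, minimalPeriod g y ∈ Θ) _
    (fun g => by simp), ← Nat.card_sigma, goodCount]
  refine Nat.card_congr (Equiv.ofBijective
    (fun c => ⟨⟨c.1 none, c.2.1 none⟩, ⟨c.1 (some true), fun y =>
      (c.2.2 none (some true) rfl y).symm, c.2.1 (some true)⟩,
      ⟨c.1 (some false), c.2.2 none (some false) rfl⟩⟩) ⟨?_, ?_⟩)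
  · rintro ⟨c, hc⟩ ⟨d, hd⟩ h
    have h1 : c none = d none := congrArg (fun q => q.1.1) h
    have h2 : c (some true) = d (some true) := congrArg (fun q => q.2.1.1) h
    have h3 : c (some false) = d (some false) := congrArg (fun q => q.2.2.1) h
    refine Subtype.ext (funext fun k => ?_)
    rcases k with _ | _ | _
    · exact h1
    · exact h3
    · exact h2
  · rintro ⟨⟨g, hg⟩, ⟨a, ha, hp⟩, ⟨s, hs⟩⟩
    refine ⟨⟨tripleFam g a s, ?_, ?_⟩, rfl⟩
    · intro k y
      rcases k with _ | _ | _
      · exact hg y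
      · trivial
      · exact hp y
    · rintro k k' rfl
      rcases k' with _ | _ | _
      · intro _; rfl
      · exact hs
      · exact fun y => (ha y).symm

/-- Class functions, weighted by the orders of the centralizers, are summed over cycle types. -/
lemma sum_mul_card_centralizer {n : ℕ} (F : (Fintype.card (Fin n)).Partition → ℚ) :
    ∑ g : Perm (Fin n), F g.partition * Nat.card (Subgroup.centralizer {g}) =
      n.factorial * ∑ q, F q := by
  classical
  rw [← Finset.sum_fiberwise (s := Finset.univ) (g := fun g : Perm (Fin n) => g.partition),
    Finset.mul_sum]
  refine Finset.sum_congr rfl fun q _ => ?_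
  obtain ⟨g, rfl⟩ : ∃ g : Perm (Fin n), g.partition = q := by
    obtain ⟨g, hg⟩ := (Perm.exists_with_cycleType_iff (α := Fin n)
      (m := q.parts.filter fun k => 2 ≤ k)).2 ⟨by
        have h := q.parts_sum
        rw [← Multiset.filter_add_not (fun k => 2 ≤ k) q.parts, Multiset.sum_add] at h
        omega, fun a ha => (Multiset.mem_filter.1 ha).2⟩
    refine ⟨g, Nat.Partition.ext ?_⟩
    have hones : q.parts.filter (fun k => ¬ 2 ≤ k) =
        Multiset.replicate (Multiset.card (q.parts.filter (fun k => ¬ 2 ≤ k))) 1 := by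
      refine Multiset.eq_replicate_card.2 fun b hb => ?_
      have h1 := Multiset.mem_filter.1 hb
      have := q.parts_pos h1.1
      omega
    have hsum : Fintype.card (Fin n) - g.support.card =
        Multiset.card (q.parts.filter (fun k => ¬ 2 ≤ k)) := by
      have h := q.parts_sum
      rw [← Multiset.filter_add_not (fun k => 2 ≤ k) q.parts, Multiset.sum_add, ← hg,
        Perm.sum_cycleType, hones, Multiset.sum_replicate] at h
      simp only [smul_eq_mul, mul_one] at h
      omega
    rw [Perm.parts_partition, hg, hsum, ← hones, Multiset.filter_add_not]
  have hcent : ∀ h : Perm (Fin n), h.partition = g.partition →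
      Nat.card (Subgroup.centralizer {h}) = Nat.card (Subgroup.centralizer {g}) := by
    intro h hh
    rw [Perm.nat_card_centralizer, Perm.nat_card_centralizer,
      ← Perm.filter_parts_partition_eq_cycleType, ← Perm.filter_parts_partition_eq_cycleType, hh]
  rw [Finset.sum_congr rfl fun h hh => by
    rw [(Finset.mem_filter.1 hh).2, hcent h (Finset.mem_filter.1 hh).2], Finset.sum_const,
    nsmul_eq_mul]
  have hc := Perm.card_isConj_mul_eq g
  rw [← Perm.nat_card_centralizer g, Fintype.card_fin] at hc
  have hset : Nat.card {h : Perm (Fin n) | IsConj g h} =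
      (Finset.univ.filter fun h : Perm (Fin n) => h.partition = g.partition).card := by
    rw [← Fintype.card_subtype, ← Nat.card_eq_fintype_card]
    refine Nat.card_congr (Equiv.subtypeEquivRight fun h => ?_)
    change IsConj g h ↔ _
    rw [Perm.partition_eq_of_isConj, eq_comm]
  rw [hset] at hc
  rw [← hc]
  push_cast
  ring

/-- The exponential generating function of the commuting triples is the generating function of
partitions in which `j` parts equal to `i` have the weight `[z ^ j] (P_i ⊙ Q_i)`. -/
theorem goodSeries_triple_eq_genFun {p : ℕ} (hp : 0 < p) :
    goodSeries (tripleLengths p Set.univ) (noneRel Bool) =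
      Nat.Partition.genFun fun i j => coeff j (hadamardAt i (seriesP p i) seriesQ) := by
  classical
  ext n
  rw [goodSeries, coeff_mk, Nat.Partition.coeff_genFun, goodCount_triple_eq_sum,
    Finset.filter_true_of_mem fun _ _ _ => Set.mem_univ _]
  push_cast
  simp only [commCount_eq_partition_prod hp]
  have := sum_mul_card_centralizer (n := n) (fun q => q.parts.toFinsupp.prod fun i j =>
    coeff j (hadamardAt i (seriesP p i) seriesQ))
  rw [this, mul_div_cancel_left₀ _ (by positivity)]
  rw [Fintype.card_fin]

open scoped PowerSeries.WithPiTopology in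
/-- Up to any given degree, the generating function of partitions is a finite product. -/
lemma exists_coeff_genFun_eq_prod (f : ℕ → ℚ⟦X⟧) (hf : ∀ i, constantCoeff (f i) = 1) (N : ℕ) :
    ∃ M₀, ∀ M ≥ M₀, ∀ n ≤ N, coeff n (Nat.Partition.genFun fun i j => coeff j (f i)) =
      coeff n (∏ i ∈ Finset.range M, (f (i + 1)).subst ((X : ℚ⟦X⟧) ^ (i + 1))) := by
  let _ : TopologicalSpace ℚ := ⊥
  have : DiscreteTopology ℚ := ⟨rfl⟩
  have h := Nat.Partition.hasProd_genFun (R := ℚ) fun i j => coeff j (f i)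
  have hterm : ∀ i, (1 + ∑' j, coeff (j + 1) (f (i + 1)) • (X : ℚ⟦X⟧) ^ ((i + 1) * (j + 1))) =
      (f (i + 1)).subst ((X : ℚ⟦X⟧) ^ (i + 1)) := by
    intro i
    ext n
    rw [map_add, coeff_subst_X_pow (Nat.succ_ne_zero i),
      (Nat.Partition.summable_genFun_term (fun i j => coeff j (f i)) i).map_tsum _
        (WithPiTopology.continuous_coeff _ _)]
    simp only [map_smul, coeff_X_pow, smul_eq_mul, mul_ite, mul_one, mul_zero]
    split_ifs with hd
    · obtain ⟨k, rfl⟩ := hd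
      rw [Nat.mul_div_cancel_left _ (Nat.succ_pos i)]
      cases k with
      | zero =>
        have h0 := hf (i + 1)
        simp [h0]
      | succ k =>
        rw [tsum_eq_single k]
        · simp [coeff_one]
        · intro b hb
          rw [if_neg]
          intro hbk
          exact hb (by have := Nat.eq_of_mul_eq_mul_left (Nat.succ_pos i) hbk; omega)
    · have h1 : ∀ j, n ≠ (i + 1) * (j + 1) := fun j hj => hd ⟨_, hj⟩
      have h2 : n ≠ 0 := by rintro rfl; exact hd (dvd_zero _)
      simp [h1, h2, coeff_one]
  simp only [hterm] at h
  have ht := h.tendsto_prod_nat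
  rw [WithPiTopology.tendsto_iff_coeff_tendsto] at ht
  have hev : ∀ n, ∀ᶠ M in Filter.atTop,
      coeff n (∏ i ∈ Finset.range M, (f (i + 1)).subst ((X : ℚ⟦X⟧) ^ (i + 1))) =
      coeff n (Nat.Partition.genFun fun i j => coeff j (f i)) := by
    intro n
    have := ht n
    rw [nhds_discrete, Filter.tendsto_pure] at this
    exact this
  obtain ⟨M₀, hM₀⟩ := Filter.eventually_atTop.1
    ((Filter.eventually_all_finset (Finset.range (N + 1))).2 fun n _ => hev n)
  exact ⟨M₀, fun M hM n hn => (hM₀ M hM n (Finset.mem_range.2 (by omega))).symm⟩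

/-! ### Logarithms of formal power series -/

lemma eq_of_theta_eq_theta {F G : ℚ⟦X⟧} (h0 : constantCoeff F = constantCoeff G)
    (h : theta F = theta G) : F = G := by
  ext n
  rcases Nat.eq_zero_or_pos n with rfl | hn
  · simpa using h0
  · have := congrArg (coeff n) h
    rw [coeff_theta, coeff_theta] at this
    exact mul_left_cancel₀ (by positivity) this

section
variable {F G : ℚ⟦X⟧}

lemma hasSubst_sub_one (hF : constantCoeff F = 1) : HasSubst (F - 1) :=
  HasSubst.of_constantCoeff_zero' (by simp [hF])

lemma constantCoeff_formalLog (hF : constantCoeff F = 1) : constantCoeff (formalLog F) = 0 :=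
  constantCoeff_logOf hF

/-- The logarithmic derivative of `F` is the derivative of its formal logarithm. -/
lemma theta_formalLog_mul (hF : constantCoeff F = 1) : theta (formalLog F) * F = theta F := by
  have hs := hasSubst_sub_one hF
  have h1 : d⁄dX ℚ (PowerSeries.log ℚ) * (1 + X) = 1 := by
    rw [deriv_log, mul_add, mul_one]
    ext n
    cases n with
    | zero => simp
    | succ n => simp [coeff_succ_mul_X, coeff_one, pow_succ]
  have h2 : (d⁄dX ℚ (PowerSeries.log ℚ)).subst (F - 1) * F = 1 := by
    have := congrArg (substAlgHom hs) h1
    rw [map_mul, map_add, map_one, coe_substAlgHom, subst_X hs] at this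
    simpa using this
  have h3 : d⁄dX ℚ (F - 1) = d⁄dX ℚ F := by simp
  rw [theta, formalLog, derivative_subst hs, h3, theta]
  calc _ = X * d⁄dX ℚ F * ((d⁄dX ℚ (PowerSeries.log ℚ)).subst (F - 1) * F) := by ring
    _ = _ := by rw [h2, mul_one]

lemma ne_zero_of_constantCoeff (hF : constantCoeff F = 1) : F ≠ 0 := by
  rintro rfl
  simp at hF

lemma formalLog_mul (hF : constantCoeff F = 1) (hG : constantCoeff G = 1) :
    formalLog (F * G) = formalLog F + formalLog G := by
  have hFG : constantCoeff (F * G) = 1 := by rw [map_mul, hF, hG, mul_one]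
  refine eq_of_theta_eq_theta ?_ (mul_right_cancel₀ (ne_zero_of_constantCoeff hFG) ?_)
  · rw [map_add, constantCoeff_formalLog hF, constantCoeff_formalLog hG,
      constantCoeff_formalLog hFG, add_zero]
  · have hadd : theta (formalLog F + formalLog G) = theta (formalLog F) + theta (formalLog G) := by
      simp [theta, mul_add]
    rw [theta_formalLog_mul hFG, theta_mul, hadd]
    linear_combination (-G) * theta_formalLog_mul hF + (-F) * theta_formalLog_mul hG

lemma formalLog_one : formalLog (1 : ℚ⟦X⟧) = 0 := by
  have := formalLog_mul (F := 1) (G := 1) (by simp) (by simp)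
  simpa using this

lemma formalLog_prod {ι : Type} (s : Finset ι) (f : ι → ℚ⟦X⟧)
    (hf : ∀ i, constantCoeff (f i) = 1) :
    formalLog (∏ i ∈ s, f i) = ∑ i ∈ s, formalLog (f i) := by
  classical
  induction s using Finset.induction_on with
  | empty => simpa using formalLog_one
  | insert a s ha ih =>
    rw [Finset.prod_insert ha, Finset.sum_insert ha, formalLog_mul (hf a), ih]
    rw [map_prod]
    exact Finset.prod_eq_one fun i _ => hf i

lemma formalLog_subst_X_pow (hF : constantCoeff F = 1) {k : ℕ} (hk : k ≠ 0) :
    formalLog (F.subst ((X : ℚ⟦X⟧) ^ k)) = (formalLog F).subst ((X : ℚ⟦X⟧) ^ k) := by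
  have hs := HasSubst.X_pow (R := ℚ) hk
  rw [formalLog, formalLog, subst_comp_subst_apply (hasSubst_sub_one hF) hs]
  congr 1
  rw [subst_sub hs]
  congr 1
  rw [← coe_substAlgHom hs, map_one]

/-- The coefficients of the logarithm up to degree `N` depend only on those of the series. -/
lemma coeff_formalLog_congr (hF : constantCoeff F = 1) (hG : constantCoeff G = 1) {N : ℕ}
    (h : ∀ n ≤ N, coeff n F = coeff n G) : ∀ n ≤ N,
    coeff n (formalLog F) = coeff n (formalLog G) := by
  intro n
  induction n using Nat.strong_induction_on with
  | _ n ih =>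
    intro hn
    rcases Nat.eq_zero_or_pos n with rfl | hn0
    · simp [constantCoeff_formalLog hF, constantCoeff_formalLog hG]
    · have h1 := congrArg (coeff n) (theta_formalLog_mul hF)
      have h2 := congrArg (coeff n) (theta_formalLog_mul hG)
      rw [coeff_theta, coeff_mul, Finset.Nat.sum_antidiagonal_eq_sum_range_succ_mk,
        Finset.sum_range_succ] at h1 h2
      have : ∑ k ∈ Finset.range n, coeff k (theta (formalLog F)) * coeff (n - k) F =
          ∑ k ∈ Finset.range n, coeff k (theta (formalLog G)) * coeff (n - k) G := by
        refine Finset.sum_congr rfl fun k hk => ?_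
        have hk := Finset.mem_range.1 hk
        rw [coeff_theta, coeff_theta, ih k hk (by omega), h (n - k) (by omega)]
      rw [this, h n hn, ← h2] at h1
      have h3 := add_left_cancel h1
      simp only [Nat.sub_self, coeff_zero_eq_constantCoeff_apply, hF, hG, mul_one,
        coeff_theta] at h3
      exact mul_left_cancel₀ (by positivity) h3

end

/-! ### The generating function of hypermaps -/

/-- The Hadamard product `P_i ⊙ Q_i`. -/
noncomputable def hadamardPQ (p i : ℕ) : ℚ⟦X⟧ := hadamardAt i (seriesP p i) seriesQ

/-- The generating function of commuting triples, equal to the generating function of the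
isomorphism classes of not necessarily connected `(p, ∞)`-hypermaps. -/
noncomputable def allSeries (p : ℕ) : ℚ⟦X⟧ := goodSeries (tripleLengths p Set.univ) (noneRel Bool)

/-- By the exponential formula the logarithm of the series of all triples is the series of the
transitive ones. -/
lemma mul_coeff_formalLog_allSeries (p n : ℕ) :
    n * coeff n (formalLog (allSeries p)) =
      ∑ m ∈ n.divisors, (m : ℚ) * Hypermap.numIsoClasses p m := by
  have h0 : constantCoeff (allSeries p) = 1 := constantCoeff_goodSeries _ _
  rw [← coeff_theta, ← coeff_rootedTransSeries_triple]
  congr 1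
  refine mul_right_cancel₀ (ne_zero_of_constantCoeff h0) ?_
  rw [theta_formalLog_mul h0]
  exact theta_goodSeries _ _

lemma exists_coeff_formalLog_allSeries {p : ℕ} (hp : 0 < p) (n : ℕ) :
    ∃ M₀, ∀ M ≥ M₀, coeff n (formalLog (allSeries p)) = ∑ i ∈ Finset.range M,
      if i + 1 ∣ n then coeff (n / (i + 1)) (formalLog (hadamardPQ p (i + 1))) else 0 := by
  have hc : ∀ i, constantCoeff (hadamardPQ p i) = 1 := constantCoeff_hadamardAt hp
  have hc' : ∀ i, constantCoeff ((hadamardPQ p (i + 1)).subst ((X : ℚ⟦X⟧) ^ (i + 1))) = 1 := by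
    intro i
    rw [constantCoeff_subst_X_pow (Nat.succ_ne_zero i), hc]
    simp
  obtain ⟨M₀, hM₀⟩ := exists_coeff_genFun_eq_prod (hadamardPQ p) hc n
  refine ⟨M₀, fun M hM => ?_⟩
  have h := coeff_formalLog_congr (F := allSeries p)
    (G := ∏ i ∈ Finset.range M, (hadamardPQ p (i + 1)).subst ((X : ℚ⟦X⟧) ^ (i + 1)))
    (constantCoeff_goodSeries _ _) (by rw [map_prod]; exact Finset.prod_eq_one fun i _ => hc' i)
    (N := n) (fun k hk => by
      rw [← hM₀ M hM k hk, allSeries, goodSeries_triple_eq_genFun hp]; rfl) n le_rfl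
  rw [h, formalLog_prod _ _ hc', map_sum]
  refine Finset.sum_congr rfl fun i _ => ?_
  rw [formalLog_subst_X_pow (hc _) (Nat.succ_ne_zero i), coeff_subst_X_pow (Nat.succ_ne_zero i)]
  rfl

lemma numIsoClasses_zero (p : ℕ) : Hypermap.numIsoClasses p 0 = 0 := by
  rw [Hypermap.numIsoClasses, Nat.card_eq_zero]
  left
  refine ⟨fun q => ?_⟩
  obtain ⟨H, rfl⟩ := Quotient.exists_rep q
  obtain ⟨x⟩ := H.1.nonempty_darts
  exact x.elim0

/-- For fixed `k`, the terms `log (P_n ⊙ Q_n)(z ^ (n k))` add up to the logarithm of the generating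
function of all hypermaps, taken at `z ^ k`. -/
theorem hasFormalSum_logTerm {p : ℕ} (hp : 0 < p) (k : ℕ+) :
    HasFormalSum (fun n : ℕ+ => logTerm p n k)
      ((formalLog (allSeries p)).subst ((X : ℚ⟦X⟧) ^ (k : ℕ))) := by
  intro N
  have hc : ∀ i, constantCoeff (hadamardPQ p i) = 1 := constantCoeff_hadamardAt hp
  have hterm : ∀ n : ℕ+, coeff N (logTerm p n k) = if (n : ℕ) * k ∣ N then
      coeff (N / (n * k)) (formalLog (hadamardPQ p n)) else 0 := by
    intro n
    rw [logTerm, coeff_subst_X_pow (Nat.mul_pos n.pos k.pos).ne']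
    rfl
  simp only [hterm]
  rw [coeff_subst_X_pow k.pos.ne']
  rcases Nat.eq_zero_or_pos N with rfl | hN
  · have h0 : constantCoeff (allSeries p) = 1 := constantCoeff_goodSeries _ _
    simp [constantCoeff_formalLog (hc _), constantCoeff_formalLog h0]
  constructor
  · refine (Set.finite_Iic (⟨N, hN⟩ : ℕ+)).subset fun n hn => ?_
    have hd : (n : ℕ) * k ∣ N := by
      by_contra h
      exact hn (if_neg h)
    have h1 : (n : ℕ) ≤ N := Nat.le_of_dvd hN ((dvd_mul_right _ _).trans hd)
    exact h1
  · split_ifs with hk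
    · obtain ⟨m, rfl⟩ := hk
      rw [Nat.mul_div_cancel_left _ k.pos]
      have hm : 0 < m := Nat.pos_of_mul_pos_left hN
      obtain ⟨M₀, hM₀⟩ := exists_coeff_formalLog_allSeries hp m
      have hterm' : ∀ n : ℕ+, (if (n : ℕ) * k ∣ k * m then
          coeff (k * m / (n * k)) (formalLog (hadamardPQ p n)) else 0) =
          if (n : ℕ) ∣ m then coeff (m / n) (formalLog (hadamardPQ p n)) else 0 := by
        intro n
        rw [mul_comm (n : ℕ) k, Nat.mul_div_mul_left _ _ k.pos]
        simp only [Nat.mul_dvd_mul_iff_left k.pos]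
      simp only [hterm']
      rw [hM₀ (max M₀ m) (le_max_left _ _)]
      rw [finsum_eq_sum_of_support_subset (s := (Finset.range (max M₀ m)).map
        ⟨Nat.succPNat, Nat.succPNat_injective⟩), Finset.sum_map]
      · rfl
      · intro n hn
        have hd : (n : ℕ) ∣ m := by
          by_contra h
          exact hn (if_neg h)
        have h1 := Nat.le_of_dvd hm hd
        have h2 := n.pos
        rw [Finset.mem_coe, Finset.mem_map]
        refine ⟨(n : ℕ) - 1, Finset.mem_range.2 ?_, ?_⟩
        · have := le_max_right M₀ m
          omega
        · apply PNat.eq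
          simp; omega
    · rw [finsum_eq_zero_of_forall_eq_zero]
      intro n
      rw [if_neg]
      exact fun h => hk ((dvd_mul_left _ _).trans h)

/-- Möbius inversion of the relation between all hypermaps and the connected ones. -/
theorem hasFormalSum_isoSeries (p : ℕ) :
    HasFormalSum (fun k : ℕ+ => C ((ArithmeticFunction.moebius (k : ℕ) : ℚ) / ((k : ℕ) : ℚ)) *
      (formalLog (allSeries p)).subst ((X : ℚ⟦X⟧) ^ (k : ℕ))) (Hypermap.isoSeries p) := by
  intro N
  have h0 : constantCoeff (allSeries p) = 1 := constantCoeff_goodSeries _ _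
  have hterm : ∀ k : ℕ+, coeff N (C ((ArithmeticFunction.moebius (k : ℕ) : ℚ) / ((k : ℕ) : ℚ)) *
      (formalLog (allSeries p)).subst ((X : ℚ⟦X⟧) ^ (k : ℕ))) = if (k : ℕ) ∣ N then
      (ArithmeticFunction.moebius (k : ℕ) : ℚ) / ((k : ℕ) : ℚ) *
        coeff (N / k) (formalLog (allSeries p)) else 0 := by
    intro k
    rw [coeff_C_mul, coeff_subst_X_pow k.pos.ne', mul_ite, mul_zero]
    rfl
  simp only [hterm]
  rw [Hypermap.isoSeries, coeff_mk]
  rcases Nat.eq_zero_or_pos N with rfl | hN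
  · simp [constantCoeff_formalLog h0, numIsoClasses_zero]
  constructor
  · refine (Set.finite_Iic (⟨N, hN⟩ : ℕ+)).subset fun n hn => ?_
    have hd : (n : ℕ) ∣ N := by
      by_contra h
      exact hn (if_neg h)
    exact Nat.le_of_dvd hN hd
  · have hmob := (ArithmeticFunction.sum_eq_iff_sum_mul_moebius_eq (R := ℚ)
      (f := fun m => (m : ℚ) * Hypermap.numIsoClasses p m)
      (g := fun n => n * coeff n (formalLog (allSeries p)))).1
      (fun n _ => (mul_coeff_formalLog_allSeries p n).symm) N hN
    rw [finsum_eq_sum_of_support_subset (s := (Finset.range N).map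
        ⟨Nat.succPNat, Nat.succPNat_injective⟩), Finset.sum_map]
    · have hN' : (N : ℚ) ≠ 0 := by positivity
      refine mul_left_cancel₀ hN' ?_
      rw [← hmob, Nat.sum_divisorsAntidiagonal (fun a b => (ArithmeticFunction.moebius a : ℚ) *
        (b * coeff b (formalLog (allSeries p)))), Nat.divisors, Finset.sum_filter,
        Finset.sum_Ico_eq_sum_range, Finset.mul_sum]
      refine Finset.sum_congr rfl fun i _ => ?_
      rw [add_comm 1 i]
      change (N : ℚ) * (if i + 1 ∣ N then (ArithmeticFunction.moebius (i + 1) : ℚ) /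
        ((i + 1 : ℕ) : ℚ) * coeff (N / (i + 1)) (formalLog (allSeries p)) else 0) = _
      by_cases hd : i + 1 ∣ N
      · have hi : ((i + 1 : ℕ) : ℚ) ≠ 0 := by positivity
        rw [if_pos hd, if_pos hd, Nat.cast_div hd hi]
        field_simp
      · rw [if_neg hd, if_neg hd, mul_zero]
    · intro n hn
      have hd : (n : ℕ) ∣ N := by
        by_contra h
        exact hn (if_neg h)
      have h1 := Nat.le_of_dvd hN hd
      have h2 := n.pos
      rw [Finset.mem_coe, Finset.mem_map]
      refine ⟨(n : ℕ) - 1, Finset.mem_range.2 (by omega), ?_⟩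
      apply PNat.eq
      simp; omega

/-! ### Existence of hypermaps -/

/-- The number of permutations of `n` points with all cycles of length `p`. -/
noncomputable def uniformCount (p n : ℕ) : ℕ :=
  Nat.card {h : Perm (Fin n) // ∀ y, minimalPeriod h y = p}

/-- The `k`-th power of a single cycle on `p * k` points has all cycles of length `p`. -/
lemma exists_uniform (p k : ℕ) (hp : 0 < p) (hk : 0 < k) :
    ∃ b : Unit → Perm (Fin (p * k)), TransFam b ∧ ∀ y, minimalPeriod ((b ()) ^ k) y = p := by
  obtain ⟨n, hn⟩ : ∃ n, p * k = n + 1 := ⟨p * k - 1, by have := Nat.mul_pos hp hk; omega⟩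
  rw [hn]
  have hpos : 0 < Nat.card {c : Unit → Perm (Fin (n + 1)) // TransFam c} := by
    rw [card_isTrans_perm]; exact Nat.factorial_pos n
  obtain ⟨⟨b, hb⟩⟩ := (Nat.card_pos_iff.1 hpos).1
  refine ⟨b, hb, fun y => ?_⟩
  rw [minimalPeriod_eq_orderOf hb ((commute_iff_mem_zpowers hb _).2 ⟨k, by simp⟩) y,
    orderOf_pow, orderOf_of_transFam hb, Nat.card_fin, ← hn, Nat.gcd_mul_left_left,
    Nat.mul_div_cancel _ hk]

lemma uniformCount_mul {p k : ℕ} (hp : 0 < p) :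
    uniformCount p (p * k) * (p ^ k * k.factorial) = (p * k).factorial := by
  rcases Nat.eq_zero_or_pos k with rfl | hk
  · have : uniformCount p (p * 0) = 1 := by
      rw [uniformCount, Nat.card_eq_one_iff_unique]
      exact ⟨⟨fun a b => Subtype.ext (Equiv.ext fun y => y.elim0)⟩, ⟨⟨1, fun y => y.elim0⟩⟩⟩
    rw [this]; simp
  · obtain ⟨b, -, hb⟩ := exists_uniform p k hp hk
    exact card_uniform hp hb (Nat.card_fin _)

lemma dvd_of_uniform {p n : ℕ} {g : Perm (Fin n)} (hg : ∀ y, minimalPeriod g y = p) :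
    p ∣ n := by
  have h := card_minimalPeriod_eq g p
  rw [Nat.card_congr (Equiv.subtypeUnivEquiv hg), Nat.card_fin] at h
  exact ⟨_, h⟩

lemma uniformCount_eq_zero {p n : ℕ} (h : ¬ p ∣ n) : uniformCount p n = 0 := by
  rw [uniformCount, Nat.card_eq_zero]
  exact Or.inl ⟨fun g => h (dvd_of_uniform g.2)⟩

theorem numIsoClasses_ne_zero_iff {p : ℕ} (hp : 0 < p) (N : ℕ) :
    Hypermap.numIsoClasses p N ≠ 0 ↔ ∃ k : ℕ, 1 ≤ k ∧ N = p * k := by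
  constructor
  · intro h
    obtain ⟨⟨q⟩, -⟩ := Nat.card_ne_zero.1 h
    obtain ⟨H, -⟩ := Quotient.exists_rep q
    obtain ⟨k, rfl⟩ := dvd_of_uniform ((H.1.isPInfinity_iff p).1 H.2)
    refine ⟨k, ?_, rfl⟩
    by_contra hk
    obtain rfl : k = 0 := by omega
    obtain ⟨x⟩ := H.1.nonempty_darts
    exact x.elim0
  · rintro ⟨k, hk, rfl⟩
    obtain ⟨b, hb, hper⟩ := exists_uniform p k hp hk
    have htr : TransFam (pairFam ((b ()) ^ k) (b ())) := fun S hS hcl =>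
      hb S hS fun _ z hz => hcl false z hz
    let H : Hypermap (Fin (p * k)) := ⟨(b ()) ^ k, b (), ⟨⟨0, Nat.mul_pos hp hk⟩⟩,
      (isPretransitive_iff_transFam (pairFam ((b ()) ^ k) (b ()))).2 htr⟩
    exact Nat.card_ne_zero.2 ⟨⟨Quotient.mk _ ⟨H, (H.isPInfinity_iff p).2 hper⟩⟩, inferInstance⟩

/-! ### Bounds for the number of hypermaps -/

/-- The order of the centralizer of a product of `n / d` cycles of length `d`, for `d` dividing
`n`. -/
def centOrder (n d : ℕ) : ℕ := d ^ (n / d) * (n / d).factorial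

lemma goodCount_triple_uniform {p i n : ℕ} (hi : 0 < i) (hp : 0 < p) (hin : i ∣ n) :
    (goodCount (tripleLengths p {i}) (noneRel Bool) n : ℚ) =
      n.factorial * (centOrder n i * coeff (n / i) (seriesP p i)) := by
  classical
  obtain ⟨j, rfl⟩ := hin
  rw [goodCount_triple_eq_sum, centOrder, Nat.mul_div_cancel_left _ hi]
  push_cast
  have hterm : ∀ g ∈ (Finset.univ.filter fun g : Perm (Fin (i * j)) =>
      ∀ y, minimalPeriod g y ∈ ({i} : Set ℕ)),
      (commCount p g : ℚ) * Nat.card (Subgroup.centralizer {g}) =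
      i ^ j * j.factorial * coeff j (seriesP p i) * (i ^ j * j.factorial) := by
    intro g hg
    have hg' : ∀ y, minimalPeriod g y = i := (Finset.mem_filter.1 hg).2
    rw [commCount_uniform hi hp hg' (Nat.card_fin _),
      card_centralizer_uniform hi hg' (Nat.card_fin _)]
    push_cast
    rfl
  rw [Finset.sum_congr rfl hterm, Finset.sum_const, nsmul_eq_mul]
  have hu := uniformCount_mul (p := i) (k := j) hi
  have hcard : (Finset.univ.filter fun g : Perm (Fin (i * j)) =>
      ∀ y, minimalPeriod g y ∈ ({i} : Set ℕ)).card = uniformCount i (i * j) := by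
    rw [uniformCount, Nat.card_eq_fintype_card, Fintype.card_subtype]
    rfl
  rw [hcard, ← hu]
  push_cast
  ring

/-- The automorphisms of a hypermap on `n` darts are fixed point free, so that in Burnside's lemma
only the permutations whose cycles have one and the same length `d`, a divisor of `n`, contribute. -/
lemma numIsoClasses_le_sum {p n : ℕ} (hp : 0 < p) (hn : 0 < n) :
    (Hypermap.numIsoClasses p n : ℚ) ≤
      ∑ d ∈ n.divisors, (centOrder n d : ℚ) * coeff (n / d) (seriesP p d) := by
  classical
  obtain ⟨m, rfl⟩ : ∃ m, n = m + 1 := ⟨n - 1, by omega⟩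
  have hB := blockCount_triple p 1 m
  have hle : blockCount (tripleLengths p Set.univ) 1 (m + 1) ≤
      ∑ d ∈ (m + 1).divisors, goodCount (tripleLengths p {d}) (noneRel Bool) (m + 1) := by
    rw [← Finset.sum_coe_sort]
    unfold goodCount
    rw [← Nat.card_sigma, blockCount, blockLengths_triple]
    have hper : ∀ c : Option Bool → Perm (Fin (m + 1)),
        Good (tripleLengths p Set.univ) (noneRel Bool) c → (TransFam fun i => c (some i)) →
        ∀ y, minimalPeriod (c none) y = minimalPeriod (c none) 0 := by
      intro c hc htr
      have := htr {y | minimalPeriod (c none) y = minimalPeriod (c none) 0} ⟨0, rfl⟩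
        (fun k z hz => by
          rw [Set.mem_ofPred_eq] at hz ⊢
          rw [← hz]
          exact minimalPeriod_of_semiconj (c (some k)).injective
            (fun y => (hc.2 none (some k) rfl y).symm) z)
      exact fun y => Set.eq_univ_iff_forall.1 this y
    refine Nat.card_le_card_of_injective (fun c => ⟨⟨minimalPeriod (c.1 none) 0, ?_⟩, c.1, ?_, ?_⟩) ?_
    · rw [Nat.mem_divisors]
      exact ⟨dvd_of_uniform (hper c.1 c.2.1 c.2.2), Nat.succ_ne_zero m⟩
    · intro k y
      rcases k with _ | _ | _
      · exact hper c.1 c.2.1 c.2.2 y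
      · trivial
      · exact c.2.1.1 (some true) y
    · exact c.2.1.2
    · rintro ⟨c, hc⟩ ⟨d, hd⟩ h
      obtain ⟨h1, h2⟩ := Sigma.mk.inj h
      refine Subtype.ext ?_
      have h3 : minimalPeriod (c none) 0 = minimalPeriod (d none) 0 := congrArg Subtype.val h1
      simp only at h2
      rw [Subtype.heq_iff_coe_eq] at h2
      · exact h2
      · intro x; simp only [h3]
  rw [hB] at hle
  have hle' : ((Hypermap.numIsoClasses p (m + 1) * (m + 1).factorial : ℕ) : ℚ) ≤
      ((∑ d ∈ (m + 1).divisors, goodCount (tripleLengths p {d}) (noneRel Bool) (m + 1) : ℕ) : ℚ) :=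
    by exact_mod_cast hle
  push_cast at hle'
  rw [Finset.sum_congr rfl fun d hd => goodCount_triple_uniform
    (Nat.pos_of_mem_divisors hd) hp (Nat.dvd_of_mem_divisors hd), ← Finset.mul_sum, mul_comm] at hle'
  exact le_of_mul_le_mul_left hle' (by positivity)

lemma factorial_mul_coeff_seriesP_one {p : ℕ} (hp : 0 < p) (n : ℕ) :
    (n.factorial : ℚ) * coeff n (seriesP p 1) = uniformCount p n := by
  have h := commCount_uniform (p := p) (i := 1) (j := n) (g := (1 : Perm (Fin n))) one_pos hp
    (fun y => minimalPeriod_id) (by simp)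
  have h2 : commCount p (1 : Perm (Fin n)) = uniformCount p n :=
    Nat.card_congr (Equiv.subtypeEquivRight fun a => by simp)
  rw [h2] at h
  simpa using h.symm

/-- The identity accounts for `uniformCount p n` in the lemma of Burnside; the other terms are bounded
by means of `[z ^ j] P_d ≤ 1 / j`. -/
lemma numIsoClasses_le {p n : ℕ} (hp : 0 < p) (hn : 0 < n) :
    (Hypermap.numIsoClasses p n : ℚ) ≤ uniformCount p n +
      ∑ d ∈ n.divisors.erase 1, (centOrder n d : ℚ) * d / n := by
  refine (numIsoClasses_le_sum hp hn).trans ?_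
  rw [← Finset.add_sum_erase _ _ (Nat.one_mem_divisors.2 hn.ne')]
  refine add_le_add ?_ (Finset.sum_le_sum fun d hd => ?_)
  · rw [← factorial_mul_coeff_seriesP_one hp n, centOrder]
    simp
  · have hd' := (Finset.mem_erase.1 hd).2
    have hd0 : (0 : ℚ) < d := by exact_mod_cast Nat.pos_of_mem_divisors hd'
    have hn0 : (0 : ℚ) < n := by exact_mod_cast hn
    rw [mul_div_assoc]
    refine mul_le_mul_of_nonneg_left ?_ (by positivity)
    have h := (mul_coeff_seriesP_le (Nat.pos_of_mem_divisors hd') hp (n / d)).1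
    rw [Nat.cast_div (Nat.dvd_of_mem_divisors hd') hd0.ne'] at h
    rw [le_div_iff₀ hn0]
    calc coeff (n / d) (seriesP p d) * n = d * (n / d * coeff (n / d) (seriesP p d)) := by
          field_simp
      _ ≤ d * 1 := mul_le_mul_of_nonneg_left h hd0.le
      _ = d := mul_one _

/-- Cycle lengths of the two permutations of a `(p, ∞)`-hypermap. -/
def hypermapLengths (p : ℕ) : Bool → Set ℕ
  | true => {p}
  | false => Set.univ

lemma goodCount_hypermapLengths (p n : ℕ) :
    goodCount (hypermapLengths p) (fun _ _ => False) n = uniformCount p n * n.factorial := by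
  have h : n.factorial = Nat.card (Perm (Fin n)) := by
    rw [Nat.card_eq_fintype_card, Fintype.card_perm, Fintype.card_fin]
  rw [h, uniformCount, ← Nat.card_prod, goodCount]
  refine Nat.card_congr (Equiv.ofBijective
    (fun c => (⟨c.1 true, c.2.1 true⟩, c.1 false)) ⟨?_, ?_⟩)
  · rintro ⟨c, hc⟩ ⟨d, hd⟩ h
    have h1 : c true = d true := congrArg (fun q => q.1.1) h
    have h2 : c false = d false := congrArg (fun q => q.2) h
    refine Subtype.ext (funext fun k => ?_)
    cases k
    · exact h2
    · exact h1
  · rintro ⟨⟨a, ha⟩, s⟩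
    refine ⟨⟨pairFam a s, ?_, fun _ _ h => h.elim⟩, rfl⟩
    intro k y
    cases k
    · trivial
    · exact ha y

/-- Labelled hypermaps, paired with the identity, are among the objects counted by Burnside's
lemma. -/
lemma transCount_le_numIsoClasses (p m : ℕ) :
    transCount (hypermapLengths p) (fun _ _ => False) (m + 1) ≤
      Hypermap.numIsoClasses p (m + 1) * (m + 1).factorial := by
  rw [← blockCount_triple p 1 m, blockCount, transCount, blockLengths_triple]
  refine Nat.card_le_card_of_injective
    (fun c => ⟨tripleFam 1 (c.1 true) (c.1 false), ⟨?_, ?_⟩, ?_⟩) ?_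
  · intro k y
    rcases k with _ | _ | _
    · trivial
    · trivial
    · exact c.2.1.1 true y
  · rintro k k' rfl
    intro y
    rcases k' with _ | _ | _ <;> rfl
  · convert c.2.2 using 1
    funext k
    cases k <;> rfl
  · rintro ⟨c, hc⟩ ⟨d, hd⟩ h
    have h := congrArg Subtype.val h
    have h1 : c true = d true := congrFun h (some true)
    have h2 : c false = d false := congrFun h (some false)
    refine Subtype.ext (funext fun k => ?_)
    cases k
    · exact h2
    · exact h1

/-- Most pairs of permutations are transitive: the others are accounted for by the products
of the numbers for smaller sets of darts. -/
lemma le_numIsoClasses (p N : ℕ) :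
    (uniformCount p (N + 1) : ℚ) -
      ∑ k ∈ Finset.range N, (uniformCount p (k + 1) : ℚ) * uniformCount p (N - k) ≤
    Hypermap.numIsoClasses p (N + 1) := by
  have h := goodCount_div_factorial_succ (hypermapLengths p) (fun _ _ => False) N
  have hN : (0 : ℚ) < ((N + 1 : ℕ) : ℚ) := by positivity
  have hF : ∀ n, (goodCount (hypermapLengths p) (fun _ _ => False) n : ℚ) / n.factorial =
      uniformCount p n := by
    intro n
    rw [goodCount_hypermapLengths]
    push_cast
    have : (n.factorial : ℚ) ≠ 0 := by positivity
    field_simp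
  have hT : ∀ k, (transCount (hypermapLengths p) (fun _ _ => False) (k + 1) : ℚ) / k.factorial ≤
      (k + 1 : ℕ) * uniformCount p (k + 1) := by
    intro k
    have h1 : (transCount (hypermapLengths p) (fun _ _ => False) (k + 1) : ℚ) ≤
        goodCount (hypermapLengths p) (fun _ _ => False) (k + 1) := by
      exact_mod_cast transCount_le_goodCount _ _ _
    rw [← hF (k + 1), Nat.factorial_succ]
    have : (k.factorial : ℚ) ≠ 0 := by positivity
    have h3 : ((k + 1 : ℕ) : ℚ) ≠ 0 := by positivity
    rw [Nat.cast_mul, ← mul_div_assoc, mul_div_mul_left _ _ h3]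
    exact div_le_div_of_nonneg_right h1 (by positivity)
  have h0 : (uniformCount p 0 : ℚ) = 1 := by
    rw [← hF 0, goodCount_zero]; simp
  have hlast : (transCount (hypermapLengths p) (fun _ _ => False) (N + 1) : ℚ) / N.factorial ≤
      (N + 1 : ℕ) * Hypermap.numIsoClasses p (N + 1) := by
    have h1 : (transCount (hypermapLengths p) (fun _ _ => False) (N + 1) : ℚ) ≤
        ((Hypermap.numIsoClasses p (N + 1) * (N + 1).factorial : ℕ) : ℚ) := by
      exact_mod_cast transCount_le_numIsoClasses p N
    rw [div_le_iff₀ (by positivity)]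
    refine h1.trans (le_of_eq ?_)
    rw [Nat.factorial_succ]; push_cast; ring
  simp only [hF] at h
  rw [Finset.sum_range_succ, Nat.sub_self, h0, mul_one] at h
  have hsum : ∑ k ∈ Finset.range N, (transCount (hypermapLengths p) (fun _ _ => False) (k + 1) : ℚ) /
      k.factorial * uniformCount p (N - k) ≤
      (N + 1 : ℕ) * ∑ k ∈ Finset.range N, (uniformCount p (k + 1) : ℚ) * uniformCount p (N - k) := by
    rw [Finset.mul_sum]
    refine Finset.sum_le_sum fun k hk => ?_
    have hk : ((k + 1 : ℕ) : ℚ) ≤ (N + 1 : ℕ) := by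
      exact_mod_cast Nat.succ_le_succ (Finset.mem_range.1 hk).le
    rw [← mul_assoc]
    exact mul_le_mul_of_nonneg_right ((hT k).trans
      (mul_le_mul_of_nonneg_right hk (by positivity))) (by positivity)
  refine le_of_mul_le_mul_left ?_ hN
  rw [mul_sub, h]
  linarith

/-! ### Estimates of factorials and binomial coefficients -/

lemma choose_mul_choose_le (m n i j : ℕ) :
    m.choose i * n.choose j ≤ (m + n).choose (i + j) := by
  rw [Nat.add_choose_eq]
  exact Finset.single_le_sum (f := fun q : ℕ × ℕ => m.choose q.1 * n.choose q.2)
    (fun _ _ => Nat.zero_le _) (Finset.HasAntidiagonal.mem_antidiagonal.2 rfl : (i, j) ∈ _)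

lemma choose_le_choose_mul {q : ℕ} (hq : 1 ≤ q) {k j : ℕ} (hj : j ≤ k) :
    k.choose j ≤ (q * k).choose (q * j) := by
  induction q, hq using Nat.le_induction with
  | base => simp
  | succ q hq ih =>
    have h := choose_mul_choose_le (q * k) k (q * j) j
    have h1 : 1 ≤ k.choose j := Nat.choose_pos hj
    rw [Nat.succ_mul, Nat.succ_mul]
    nlinarith

lemma choose_sq_le_choose_mul {p : ℕ} (hp : 2 ≤ p) {k j : ℕ} (hj : j ≤ k) :
    k.choose j * k.choose j ≤ (p * k).choose (p * j) := by
  obtain ⟨q, rfl⟩ : ∃ q, p = q + 1 := ⟨p - 1, by omega⟩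
  rw [Nat.succ_mul, Nat.succ_mul]
  exact (Nat.mul_le_mul_right _ (choose_le_choose_mul (by omega) hj)).trans
    (choose_mul_choose_le _ _ _ _)

lemma mul_pred_le_two_mul_choose (k : ℕ) : ∀ j, 2 ≤ j → j + 2 ≤ k →
    k * (k - 1) ≤ 2 * k.choose j := by
  induction k with
  | zero => intro j _ h; omega
  | succ k ih =>
    intro j h2 hk
    obtain ⟨i, rfl⟩ : ∃ i, j = i + 1 := ⟨j - 1, by omega⟩
    have htwo : ∀ m, 2 * m.choose 2 = m * (m - 1) := fun m => by
      rw [Nat.choose_two_right, Nat.mul_div_cancel' (Nat.even_mul_pred_self m).two_dvd]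
    by_cases hi : i = 1
    · subst hi
      rw [htwo]
    · by_cases hi' : i + 3 = k + 1
      · rw [← Nat.choose_symm (by omega), show k + 1 - (i + 1) = 2 by omega, htwo]
      · have h1 := ih i (by omega) (by omega)
        have h3 := ih (i + 1) (by omega) (by omega)
        rw [Nat.choose_succ_succ]
        simp only [Nat.add_sub_cancel]
        obtain ⟨m, rfl⟩ : ∃ m, k = m + 4 := ⟨k - 4, by omega⟩
        simp only [show m + 4 - 1 = m + 3 by omega] at h1 h3
        simp only [Nat.succ_eq_add_one]
        nlinarith

/-- The product of the numbers for `j` and for `k - j` cycles falls short of the number for `k` cycles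
by a factor of at least `binom(k, j)`, because `binom(p k, p j)` is at least `binom(k, j) ^ 2`. -/
lemma uniformCount_mul_le {p : ℕ} (hp : 2 ≤ p) {k j : ℕ} (hj : j ≤ k) :
    k.choose j * (uniformCount p (p * j) * uniformCount p (p * (k - j))) ≤
      uniformCount p (p * k) := by
  have hp0 : 0 < p := by omega
  have h1 := uniformCount_mul (p := p) (k := j) hp0
  have h2 := uniformCount_mul (p := p) (k := k - j) hp0
  have h3 := uniformCount_mul (p := p) (k := k) hp0
  have h4 := Nat.choose_mul_factorial_mul_factorial (Nat.mul_le_mul_left p hj)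
  have h5 := Nat.choose_mul_factorial_mul_factorial hj
  have h6 := choose_sq_le_choose_mul hp hj
  rw [← Nat.mul_sub, ← h1, ← h2, ← h3, ← h5] at h4
  have hpow : p ^ k = p ^ j * p ^ (k - j) := by rw [← pow_add, Nat.add_sub_cancel' hj]
  rw [hpow] at h4
  have hpos : 0 < p ^ j * p ^ (k - j) * (j.factorial * (k - j).factorial) := by positivity
  have h7 : (p * k).choose (p * j) * (uniformCount p (p * j) * uniformCount p (p * (k - j))) =
      uniformCount p (p * k) * k.choose j := by
    refine Nat.eq_of_mul_eq_mul_right hpos ?_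
    calc _ = _ := by ring
      _ = _ := h4
      _ = _ := by ring
  have hc : 0 < k.choose j := Nat.choose_pos hj
  refine Nat.le_of_mul_le_mul_right ?_ hc
  rw [← h7]
  calc _ = k.choose j * k.choose j *
        (uniformCount p (p * j) * uniformCount p (p * (k - j))) := by ring
    _ ≤ _ := Nat.mul_le_mul_right _ h6

/-- The terms `j = 1` and `j = k - 1` contribute at most `1 / k` each, the other terms at most
`2 / (k (k - 1))` each. -/
lemma sum_uniformCount_mul_le {p : ℕ} (hp : 2 ≤ p) {k : ℕ} (hk : 2 ≤ k) :
    ∑ m ∈ Finset.Ico 1 (p * k), (uniformCount p m : ℝ) * uniformCount p (p * k - m) ≤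
      uniformCount p (p * k) * (4 / k) := by
  have hp0 : 0 < p := by omega
  have h1 : ∑ m ∈ Finset.Ico 1 (p * k), (uniformCount p m : ℝ) * uniformCount p (p * k - m) =
      ∑ j ∈ Finset.Ico 1 k, (uniformCount p (p * j) : ℝ) * uniformCount p (p * (k - j)) := by
    symm
    refine Finset.sum_of_injOn (fun j => p * j) (fun i _ j _ h => Nat.eq_of_mul_eq_mul_left hp0 h)
      ?_ ?_ ?_
    · intro j hj
      have hj := Finset.mem_Ico.1 hj
      rw [Finset.mem_coe, Finset.mem_Ico]
      exact ⟨Nat.mul_pos hp0 hj.1, Nat.mul_lt_mul_of_pos_left hj.2 hp0⟩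
    · intro m hm hm'
      have hm := Finset.mem_Ico.1 hm
      rw [uniformCount_eq_zero, Nat.cast_zero, zero_mul]
      rintro ⟨j, rfl⟩
      refine hm' ⟨j, ?_, rfl⟩
      rw [Finset.mem_coe, Finset.mem_Ico]
      exact ⟨Nat.pos_of_mul_pos_left hm.1, Nat.lt_of_mul_lt_mul_left hm.2⟩
    · intro j _
      rw [Nat.mul_sub]
  have hk' : (2 : ℝ) ≤ k := by exact_mod_cast hk
  have hk0 : (0 : ℝ) < k := by linarith
  have hk1 : (0 : ℝ) < (k : ℝ) - 1 := by linarith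
  have h2 : ∀ j ∈ Finset.Ico 1 k,
      (uniformCount p (p * j) : ℝ) * uniformCount p (p * (k - j)) ≤ uniformCount p (p * k) *
        (2 / (k * (k - 1)) + ((if j = 1 then 1 / (k : ℝ) else 0) +
          if j = k - 1 then 1 / (k : ℝ) else 0)) := by
    intro j hj
    have hj := Finset.mem_Ico.1 hj
    have h := uniformCount_mul_le hp hj.2.le
    have hc : 0 < k.choose j := Nat.choose_pos hj.2.le
    have h' : (k.choose j : ℝ) *
        ((uniformCount p (p * j) : ℝ) * uniformCount p (p * (k - j))) ≤
        uniformCount p (p * k) := by exact_mod_cast h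
    have hc' : (0 : ℝ) < k.choose j := by exact_mod_cast hc
    have h3 : (uniformCount p (p * j) : ℝ) * uniformCount p (p * (k - j)) ≤
        uniformCount p (p * k) * (1 / k.choose j) := by
      rw [mul_one_div, le_div_iff₀ hc']
      linarith
    refine h3.trans (mul_le_mul_of_nonneg_left ?_ (by positivity))
    have hA : (0 : ℝ) ≤ 2 / (k * (k - 1)) := by positivity
    have hB : (0 : ℝ) ≤ 1 / k := by positivity
    by_cases e1 : j = 1
    · subst e1
      rw [Nat.choose_one_right, if_pos rfl]
      split_ifs <;> linarith
    · by_cases e2 : j = k - 1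
      · have : k.choose j = k := by
          rw [← Nat.choose_symm hj.2.le, show k - j = 1 by omega, Nat.choose_one_right]
        rw [this, if_pos e2, if_neg e1]
        linarith
      · rw [if_neg e1, if_neg e2, add_zero, add_zero]
        have h4 := mul_pred_le_two_mul_choose k j (by omega) (by omega)
        have h5 : (k : ℝ) * (k - 1) ≤ 2 * k.choose j := by
          have : ((k * (k - 1) : ℕ) : ℝ) ≤ ((2 * k.choose j : ℕ) : ℝ) := by exact_mod_cast h4
          push_cast [Nat.cast_sub (show 1 ≤ k by omega)] at this
          exact this
        rw [div_le_div_iff₀ hc' (by positivity)]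
        linarith
  rw [h1]
  refine (Finset.sum_le_sum h2).trans ?_
  rw [← Finset.mul_sum]
  refine mul_le_mul_of_nonneg_left ?_ (by positivity)
  rw [Finset.sum_add_distrib, Finset.sum_add_distrib, Finset.sum_const, Finset.sum_ite_eq',
    Finset.sum_ite_eq', Nat.card_Ico, nsmul_eq_mul, if_pos (Finset.mem_Ico.2 ⟨le_rfl, by omega⟩),
    if_pos (Finset.mem_Ico.2 ⟨by omega, by omega⟩), Nat.cast_sub (by omega)]
  refine le_of_eq ?_
  push_cast
  field_simp
  ring

/-- Pairs of permutations that are not transitive are negligible. -/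
lemma uniformCount_sub_le_numIsoClasses {p : ℕ} (hp : 2 ≤ p) {k : ℕ} (hk : 2 ≤ k) :
    (uniformCount p (p * k) : ℝ) * (1 - 4 / k) ≤ Hypermap.numIsoClasses p (p * k) := by
  obtain ⟨N, hN⟩ : ∃ N, p * k = N + 1 := ⟨p * k - 1, by
    have : 0 < p * k := by positivity
    omega⟩
  have h1 := le_numIsoClasses p N
  have h2 := sum_uniformCount_mul_le hp hk
  rw [hN] at h2 ⊢
  have h3 : ∑ m ∈ Finset.Ico 1 (N + 1), (uniformCount p m : ℝ) * uniformCount p (N + 1 - m) =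
      ∑ k ∈ Finset.range N, (uniformCount p (k + 1) : ℝ) * uniformCount p (N - k) := by
    rw [Finset.sum_Ico_eq_sum_range]
    refine Finset.sum_congr rfl fun i _ => ?_
    rw [add_comm 1 i, Nat.add_sub_add_right]
  rw [h3] at h2
  have h4 : (uniformCount p (N + 1) : ℝ) -
      ∑ k ∈ Finset.range N, (uniformCount p (k + 1) : ℝ) * uniformCount p (N - k) ≤
      Hypermap.numIsoClasses p (N + 1) := by
    exact_mod_cast h1
  linarith

/-- The fourth power of the centralizer order is at most `4 j (n!)²`: up to a factor of order
`n ^ (1 / 2)`, the square of the order is at most `n!`. -/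
lemma pow_mul_factorial_pow_four_le {d : ℕ} (hd : 2 ≤ d) (j : ℕ) (hj : 1 ≤ j) :
    (d ^ j * j.factorial) ^ 4 ≤ 4 * j * (d * j).factorial ^ 2 := by
  induction j, hj using Nat.le_induction with
  | base =>
    have h1 : d * d ≤ 2 * d.factorial := by
      obtain ⟨e, rfl⟩ : ∃ e, d = e + 2 := ⟨d - 2, by omega⟩
      rw [Nat.factorial_succ, Nat.factorial_succ]
      have := Nat.factorial_pos e
      nlinarith [Nat.mul_le_mul_left ((e + 2) * (e + 1)) this]
    simp only [pow_one, Nat.factorial_one, mul_one]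
    nlinarith
  | succ j hj ih =>
    obtain ⟨e, rfl⟩ : ∃ e, d = e + 2 := ⟨d - 2, by omega⟩
    set D := (e + 2) * (j + 1) with hD
    have hDj : 2 * (j + 1) ≤ D := Nat.mul_le_mul_right _ (by omega)
    have h1 : ((e + 2) * j).factorial * ((D - 1) * D) ≤ D.factorial := by
      obtain ⟨E, hE⟩ : ∃ E, D = E + 2 := ⟨D - 2, by omega⟩
      rw [hE, Nat.factorial_succ, Nat.factorial_succ]
      have h2 : ((e + 2) * j).factorial ≤ E.factorial := Nat.factorial_le (by
        have : D = (e + 2) * j + (e + 2) := by rw [hD]; ring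
        omega)
      have h3 := Nat.mul_le_mul_right ((E + 1) * (E + 2)) h2
      calc _ ≤ _ := h3
        _ = _ := by ring
    have h2 : j * D ^ 2 ≤ (j + 1) * (D - 1) ^ 2 := by
      obtain ⟨E, hE⟩ : ∃ E, D = E + 1 := ⟨D - 1, by omega⟩
      rw [hE] at hDj ⊢
      rw [Nat.add_sub_cancel]
      nlinarith
    have h3 : ((e + 2) ^ (j + 1) * (j + 1).factorial) = ((e + 2) ^ j * j.factorial) * D := by
      rw [Nat.factorial_succ, hD]; ring
    rw [h3]
    calc (((e + 2) ^ j * j.factorial) * D) ^ 4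
        = ((e + 2) ^ j * j.factorial) ^ 4 * D ^ 4 := by ring
      _ ≤ 4 * j * ((e + 2) * j).factorial ^ 2 * D ^ 4 := Nat.mul_le_mul_right _ ih
      _ = 4 * ((e + 2) * j).factorial ^ 2 * D ^ 2 * (j * D ^ 2) := by ring
      _ ≤ 4 * ((e + 2) * j).factorial ^ 2 * D ^ 2 * ((j + 1) * (D - 1) ^ 2) :=
        Nat.mul_le_mul_left _ h2
      _ = 4 * (j + 1) * (((e + 2) * j).factorial * ((D - 1) * D)) ^ 2 := by ring
      _ ≤ 4 * (j + 1) * D.factorial ^ 2 := Nat.mul_le_mul_left _ (Nat.pow_le_pow_left h1 2)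

section
variable {n d : ℕ}

lemma centOrder_sq_le (hn : 0 < n) (hdn : d ∣ n) (hd : 2 ≤ d) :
    (centOrder n d : ℝ) ^ 2 ≤ 2 * √n * n.factorial := by
  obtain ⟨j, rfl⟩ := hdn
  have hd0 : 0 < d := by omega
  have hj : 1 ≤ j := Nat.pos_of_mul_pos_left hn
  have h := pow_mul_factorial_pow_four_le hd j hj
  rw [centOrder, Nat.mul_div_cancel_left _ hd0]
  have h' : ((((d ^ j * j.factorial : ℕ) : ℝ)) ^ 2) ^ 2 ≤
      (2 * √((d * j : ℕ) : ℝ) * (d * j).factorial) ^ 2 := by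
    have h1 : ((((d ^ j * j.factorial) ^ 4 : ℕ)) : ℝ) ≤
        ((4 * j * (d * j).factorial ^ 2 : ℕ) : ℝ) := by exact_mod_cast h
    have h2 : (2 * √((d * j : ℕ) : ℝ) * (d * j).factorial) ^ 2 =
        4 * ((d * j : ℕ) : ℝ) * ((d * j).factorial : ℝ) ^ 2 := by
      rw [mul_pow, mul_pow, Real.sq_sqrt (by positivity)]; ring
    rw [h2, ← pow_mul]
    refine le_trans (le_of_eq (by push_cast; ring)) (h1.trans ?_)
    push_cast
    have h3 : (j : ℝ) ≤ d * j := by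
      have : (1 : ℝ) ≤ d := by exact_mod_cast hd0
      have hj0 : (0 : ℝ) ≤ j := by positivity
      nlinarith
    have h4 : (0 : ℝ) ≤ ((d * j).factorial : ℝ) ^ 2 := by positivity
    nlinarith
  exact le_of_sq_le_sq h' (by positivity)

lemma centOrder_pow_three_le (hn : 0 < n) (hdn : d ∣ n) (hd : 3 ≤ d) :
    centOrder n d ^ 3 ≤ n ^ n := by
  obtain ⟨j, rfl⟩ := hdn
  have hd0 : 0 < d := by omega
  rw [centOrder, Nat.mul_div_cancel_left _ hd0]
  calc (d ^ j * j.factorial) ^ 3 ≤ (d ^ j * j ^ j) ^ 3 :=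
        Nat.pow_le_pow_left (Nat.mul_le_mul_left _ (Nat.factorial_le_pow j)) 3
    _ = (d * j) ^ (3 * j) := by rw [← mul_pow, ← pow_mul, mul_comm j 3]
    _ ≤ (d * j) ^ (d * j) := Nat.pow_le_pow_right hn (Nat.mul_le_mul_right _ hd)

lemma pow_div_exp_le_factorial (n : ℕ) : ((n : ℝ) / Real.exp 1) ^ n ≤ n.factorial := by
  rcases Nat.eq_zero_or_pos n with rfl | hn
  · simp
  · refine le_trans ?_ (Stirling.le_factorial_stirling n)
    refine le_mul_of_one_le_left (by positivity) ?_
    rw [Real.one_le_sqrt]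
    have h1 : (1 : ℝ) ≤ n := by exact_mod_cast hn
    nlinarith [Real.pi_gt_three]

/-- For cycles of length at least `3` the centralizer order is smaller by an exponential factor. The
bound `200` exceeds `8 e ^ 3`. -/
lemma centOrder_sq_le_of_three_le (hn : 200 ≤ n) (hdn : d ∣ n) (hd : 3 ≤ d) :
    (centOrder n d : ℝ) ^ 2 ≤ n.factorial / 2 ^ n := by
  have hn0 : (0 : ℝ) < n := by positivity
  have h1 : ((centOrder n d : ℝ)) ^ 3 ≤ (n : ℝ) ^ n := by
    exact_mod_cast centOrder_pow_three_le (by omega) hdn hd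
  have h2 := pow_div_exp_le_factorial n
  have he : Real.exp 1 ^ 3 * 8 ≤ n := by
    have h3 : Real.exp 1 ≤ 2.7182818286 := Real.exp_one_lt_d9.le
    have h4 : Real.exp 1 ^ 3 ≤ 2.7182818286 ^ 3 := pow_le_pow_left₀ (Real.exp_pos 1).le h3 3
    have h5 : (200 : ℝ) ≤ n := by exact_mod_cast hn
    have h6 : (2.7182818286 : ℝ) ^ 3 ≤ 21 := by norm_num
    linarith
  refine le_of_pow_le_pow_left₀ (n := 3) (by norm_num) (by positivity) ?_
  rw [div_pow, le_div_iff₀ (by positivity)]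
  calc ((centOrder n d : ℝ) ^ 2) ^ 3 * (2 ^ n) ^ 3
      = ((centOrder n d : ℝ) ^ 3) ^ 2 * 8 ^ n := by
        rw [← pow_mul, ← pow_mul, ← pow_mul, mul_comm n 3, pow_mul 2 3 n]; norm_num
    _ ≤ ((n : ℝ) ^ n) ^ 2 * 8 ^ n :=
        mul_le_mul_of_nonneg_right (pow_le_pow_left₀ (by positivity) h1 2) (by positivity)
    _ = ((n : ℝ) ^ 2 * 8) ^ n := by rw [mul_pow, ← pow_mul, ← pow_mul, mul_comm n 2]
    _ ≤ (((n : ℝ) / Real.exp 1) ^ 3) ^ n := by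
        refine pow_le_pow_left₀ (by positivity) ?_ n
        rw [div_pow, le_div_iff₀ (by positivity)]
        nlinarith [sq_nonneg (n : ℝ)]
    _ = (((n : ℝ) / Real.exp 1) ^ n) ^ 3 := by rw [← pow_mul, ← pow_mul, mul_comm]
    _ ≤ (n.factorial : ℝ) ^ 3 := pow_le_pow_left₀ (by positivity) h2 3

end

/-- Hypermaps with non-trivial automorphisms are negligible. -/
lemma numIsoClasses_le_uniformCount_mul {p : ℕ} (hp : 2 ≤ p) {k : ℕ} (hk : 200 ≤ p * k) :
    (Hypermap.numIsoClasses p (p * k) : ℝ) ≤ uniformCount p (p * k) *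
      (1 + (4 / √((p * k : ℕ) : ℝ) +
        √(2 * ((p * k : ℕ) : ℝ) ^ 3 / 2 ^ (p * k)))) := by
  have hp0 : 0 < p := by omega
  have hW := uniformCount_mul (p := p) (k := k) hp0
  have hWp : p ^ k * k.factorial = centOrder (p * k) p := by
    rw [centOrder, Nat.mul_div_cancel_left _ hp0]
  rw [hWp] at hW
  have hpn : p ∣ p * k := dvd_mul_right _ _
  set n := p * k with hn
  have hn0 : 0 < n := by omega
  have hn0' : (0 : ℝ) < n := by exact_mod_cast hn0
  have hW' : (uniformCount p n : ℝ) * centOrder n p = n.factorial := by exact_mod_cast hW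
  have hfac : (0 : ℝ) < n.factorial := by positivity
  have hWp0 : (0 : ℝ) < centOrder n p := by
    rcases (Nat.cast_nonneg (α := ℝ) (centOrder n p)).lt_or_eq with h | h
    · exact h
    · rw [← h, mul_zero] at hW'; linarith
  have ha0 : (0 : ℝ) < uniformCount p n := by
    rcases (Nat.cast_nonneg (α := ℝ) (uniformCount p n)).lt_or_eq with h | h
    · exact h
    · rw [← h, zero_mul] at hW'; linarith
  have hle : (Hypermap.numIsoClasses p n : ℝ) ≤ uniformCount p n +
      ∑ d ∈ n.divisors.erase 1, (centOrder n d : ℝ) * d / n := by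
    have h := (Rat.cast_le (K := ℝ)).2 (numIsoClasses_le hp0 hn0)
    push_cast at h
    exact h
  have hsqp := centOrder_sq_le hn0 hpn hp
  have hsqrt1 : √(n : ℝ) ≤ n := by
    rw [Real.sqrt_le_left hn0'.le]
    have : (1 : ℝ) ≤ n := by exact_mod_cast hn0
    nlinarith
  -- the involutions contribute a share of order `n ^ (-1 / 2)`, which is the largest one
  have htwo : 2 ∣ n → (centOrder n 2 : ℝ) * 2 / n ≤ uniformCount p n * (4 / √n) := by
    intro h2
    have h := centOrder_sq_le hn0 h2 le_rfl
    have hs : (0 : ℝ) < √n := Real.sqrt_pos.2 hn0'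
    have hprod : (centOrder n 2 : ℝ) * centOrder n p ≤ 2 * √n * n.factorial := by
      refine le_of_sq_le_sq ?_ (by positivity)
      rw [mul_pow, sq (2 * √n * n.factorial)]
      exact mul_le_mul h hsqp (by positivity) (by positivity)
    refine le_of_mul_le_mul_right ?_ hWp0
    have e1 : (uniformCount p n : ℝ) * (4 / √n) * centOrder n p = n.factorial * (4 / √n) := by
      rw [← hW']; ring
    rw [e1, div_mul_eq_mul_div, div_le_iff₀ hn0']
    calc (centOrder n 2 : ℝ) * 2 * centOrder n p = (centOrder n 2 * centOrder n p) * 2 := by ring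
      _ ≤ (2 * √n * n.factorial) * 2 := mul_le_mul_of_nonneg_right hprod (by norm_num)
      _ = n.factorial * (4 / √n) * (√n * √n) := by field_simp; ring
      _ = n.factorial * (4 / √n) * n := by rw [Real.mul_self_sqrt hn0'.le]
  have hbig : ∀ d ∈ n.divisors, 3 ≤ d → (centOrder n d : ℝ) * d / n ≤
      uniformCount p n * √(2 * n / 2 ^ n) := by
    intro d hd h3
    have hdn := Nat.dvd_of_mem_divisors hd
    have h := centOrder_sq_le_of_three_le hk hdn h3
    have hdle : (d : ℝ) ≤ n := by exact_mod_cast Nat.le_of_dvd hn0 hdn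
    have hprod : (centOrder n d : ℝ) * centOrder n p ≤ √(2 * n / 2 ^ n) * n.factorial := by
      refine le_of_sq_le_sq ?_ (by positivity)
      rw [mul_pow, mul_pow, Real.sq_sqrt (by positivity)]
      have h4 : (centOrder n p : ℝ) ^ 2 ≤ 2 * n * n.factorial :=
        hsqp.trans (mul_le_mul_of_nonneg_right (by linarith) hfac.le)
      calc _ ≤ (n.factorial / 2 ^ n : ℝ) * (2 * n * n.factorial) :=
            mul_le_mul h h4 (by positivity) (by positivity)
        _ = _ := by ring
    refine le_of_mul_le_mul_right ?_ hWp0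
    have e1 : (uniformCount p n : ℝ) * √(2 * n / 2 ^ n) * centOrder n p =
        √(2 * n / 2 ^ n) * n.factorial := by rw [← hW']; ring
    rw [e1]
    refine le_trans ?_ hprod
    refine mul_le_mul_of_nonneg_right ?_ hWp0.le
    rw [div_le_iff₀ hn0']
    exact mul_le_mul_of_nonneg_left hdle (by positivity)
  have hsum : ∑ d ∈ n.divisors.erase 1, (centOrder n d : ℝ) * d / n ≤
      ∑ d ∈ n.divisors, (uniformCount p n : ℝ) *
        ((if d = 2 then 4 / √n else 0) + √(2 * n / 2 ^ n)) := by
    have hnn : ∀ d, (0 : ℝ) ≤ (uniformCount p n : ℝ) *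
        ((if d = 2 then 4 / √n else 0) + √(2 * n / 2 ^ n)) := by
      intro d
      split_ifs <;> positivity
    refine (Finset.sum_le_sum fun d hd => ?_).trans
      (Finset.sum_le_sum_of_subset_of_nonneg (Finset.erase_subset 1 _) fun d _ _ => hnn d)
    have hd1 := Finset.mem_erase.1 hd
    have hdpos := Nat.pos_of_mem_divisors hd1.2
    by_cases e : d = 2
    · subst e
      rw [if_pos rfl]
      refine (htwo (Nat.dvd_of_mem_divisors hd1.2)).trans ?_
      refine mul_le_mul_of_nonneg_left ?_ ha0.le
      have := Real.sqrt_nonneg (2 * (n : ℝ) / 2 ^ n)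
      linarith
    · rw [if_neg e, zero_add]
      exact hbig d hd1.2 (by omega)
  refine hle.trans ?_
  rw [mul_add, mul_one]
  refine add_le_add le_rfl (hsum.trans ?_)
  rw [← Finset.mul_sum]
  refine mul_le_mul_of_nonneg_left ?_ ha0.le
  rw [Finset.sum_add_distrib, Finset.sum_const, nsmul_eq_mul, Finset.sum_ite_eq']
  refine add_le_add ?_ ?_
  · split_ifs
    · exact le_rfl
    · positivity
  · have hcard : (n.divisors.card : ℝ) ≤ n := by exact_mod_cast Nat.card_divisors_le_self n
    calc (n.divisors.card : ℝ) * √(2 * n / 2 ^ n) ≤ n * √(2 * n / 2 ^ n) :=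
          mul_le_mul_of_nonneg_right hcard (Real.sqrt_nonneg _)
      _ = √((n : ℝ) ^ 2 * (2 * n / 2 ^ n)) := by
          rw [Real.sqrt_mul (by positivity), Real.sqrt_sq hn0'.le]
      _ = _ := by congr 1; ring

/-! ### The asymptotic behaviour -/

open Filter Topology Asymptotics in
/-- Almost all pairs of permutations `α`, `σ`, where `α` has only cycles of length `p`, generate
a transitive group with trivial centralizer, so that the relabellings of the hypermap of such a
pair are exactly `(p * k)!` pairs. -/
lemma numIsoClasses_isEquivalent_uniformCount {p : ℕ} (hp : 2 ≤ p) :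
    (fun k : ℕ => (Hypermap.numIsoClasses p (p * k) : ℝ)) ~[atTop]
      fun k => (uniformCount p (p * k) : ℝ) := by
  have hpk : Tendsto (fun k : ℕ => p * k) atTop atTop :=
    tendsto_id.const_mul_atTop' (by omega)
  have hsqrt : Tendsto (fun n : ℕ => 4 / √(n : ℝ)) atTop (𝓝 0) :=
    (Real.tendsto_sqrt_atTop.comp tendsto_natCast_atTop_atTop).const_div_atTop 4
  have hexp : Tendsto (fun n : ℕ => √(2 * (n : ℝ) ^ 3 / 2 ^ n)) atTop (𝓝 0) := by
    have h := (tendsto_pow_const_div_const_pow_of_one_lt 3 (r := (2 : ℝ)) (by norm_num)).const_mul 2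
    rw [mul_zero] at h
    have h2 := (Real.continuous_sqrt.tendsto 0).comp h
    rw [Real.sqrt_zero] at h2
    exact h2.congr fun n => by rw [Function.comp_apply, mul_div_assoc]
  have hupper : Tendsto (fun k : ℕ => 1 + (4 / √((p * k : ℕ) : ℝ) +
      √(2 * ((p * k : ℕ) : ℝ) ^ 3 / 2 ^ (p * k)))) atTop (𝓝 1) := by
    have h := ((hsqrt.add hexp).comp hpk).const_add 1
    simpa [Function.comp_def] using h
  have hlower : Tendsto (fun k : ℕ => 1 - 4 / (k : ℝ)) atTop (𝓝 1) := by
    simpa using (tendsto_natCast_atTop_atTop.const_div_atTop (4 : ℝ)).const_sub 1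
  have hpos : ∀ k, (0 : ℝ) < uniformCount p (p * k) := fun k => by
    have h := uniformCount_mul (p := p) (k := k) (by omega)
    have : uniformCount p (p * k) ≠ 0 := fun h0 => by
      rw [h0, zero_mul] at h
      exact (Nat.factorial_ne_zero _) h.symm
    exact_mod_cast Nat.pos_of_ne_zero this
  rw [isEquivalent_iff_tendsto_one (Eventually.of_forall fun k => (hpos k).ne')]
  refine tendsto_of_tendsto_of_tendsto_of_le_of_le' hlower hupper ?_ ?_
  · filter_upwards [eventually_ge_atTop 2] with k hk
    have hpos := hpos k
    rw [Pi.div_apply, le_div_iff₀ hpos, mul_comm]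
    exact uniformCount_sub_le_numIsoClasses hp hk
  · filter_upwards [eventually_ge_atTop 200] with k hk
    have hpos := hpos k
    rw [Pi.div_apply, div_le_iff₀ hpos]
    exact (numIsoClasses_le_uniformCount_mul hp
      (hk.trans (Nat.le_mul_of_pos_left k (by omega)))).trans_eq (mul_comm _ _)

open Filter Asymptotics in
/-- The formula of Stirling for `(p k)! / (p ^ k k!)`. -/
lemma uniformCount_isEquivalent {p : ℕ} (hp : 0 < p) :
    (fun k : ℕ => (uniformCount p (p * k) : ℝ)) ~[atTop] fun k : ℕ =>
      √p * (k : ℝ) ^ (((p : ℝ) - 1) * k) * Real.exp (((p : ℝ) - 1) * (Real.log p - 1) * k) := by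
  have hpk : Tendsto (fun k : ℕ => p * k) atTop atTop := tendsto_id.const_mul_atTop' hp
  have hp0 : (0 : ℝ) < p := by exact_mod_cast hp
  have h := (Stirling.factorial_isEquivalent_stirling.comp_tendsto hpk).div
    ((IsEquivalent.refl (u := fun k : ℕ => (p : ℝ) ^ k) (l := atTop)).mul
      Stirling.factorial_isEquivalent_stirling)
  refine (h.congr_left (Eventually.of_forall fun k => ?_)).congr_right ?_
  · have hk := uniformCount_mul (p := p) (k := k) hp
    have hk0 : (0 : ℝ) < (k.factorial : ℝ) := by positivity
    simp only [Function.comp_apply, Pi.div_apply, Pi.mul_apply]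
    rw [div_eq_iff (by positivity)]
    exact_mod_cast hk.symm
  · filter_upwards [eventually_gt_atTop 0] with k hk
    have hk0 : (0 : ℝ) < k := by exact_mod_cast hk
    simp only [Function.comp_apply, Pi.div_apply, Pi.mul_apply]
    have hsqrt : √(2 * ((p * k : ℕ) : ℝ) * Real.pi) = √p * √(2 * k * Real.pi) := by
      rw [← Real.sqrt_mul hp0.le]
      push_cast
      ring_nf
    have hpow : ∀ x : ℝ, 0 < x → ∀ n : ℕ, x ^ n = Real.exp (Real.log x * n) := fun x hx n => by
      rw [← Real.rpow_natCast, Real.rpow_def_of_pos hx]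
    rw [hsqrt, div_eq_iff (by positivity), Real.rpow_def_of_pos hk0,
      hpow (_ / _) (by positivity), hpow (_ / _) (by positivity), hpow _ hp0,
      Real.log_div (by positivity) (Real.exp_ne_zero _), Real.log_div hk0.ne' (Real.exp_ne_zero _),
      Real.log_exp]
    push_cast
    rw [Real.log_mul hp0.ne' hk0.ne']
    have : ∀ a b x y z w v : ℝ, x = y + z + w + v → a * b * Real.exp x =
        a * Real.exp y * Real.exp z * (Real.exp w * (b * Real.exp v)) := by
      rintro a b x y z w v rfl
      rw [Real.exp_add, Real.exp_add, Real.exp_add]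
      ring
    apply this
    ring

open Real in
lemma prod_two_mul_sin (m : ℕ) :
    ∏ k ∈ Finset.range m, (2 * sin (π * ((k + 1 : ℕ) / (m + 1 : ℕ)))) = m + 1 := by
  have hm : ((m + 1 : ℕ) : ℝ) ≠ 0 := by positivity
  have h := (Complex.isPrimitiveRoot_exp (m + 1) m.succ_ne_zero).prod_one_sub_pow_eq_order
  have h2 := congrArg (fun z : ℂ => ‖z‖) h
  simp only [norm_prod] at h2
  have h3 : ‖((m : ℂ) + 1)‖ = m + 1 := by
    have : ((m : ℂ) + 1) = ((m + 1 : ℕ) : ℂ) := by push_cast; rfl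
    rw [this, Complex.norm_natCast]
    push_cast; rfl
  rw [← h3, ← h2]
  refine Finset.prod_congr rfl fun k hk => ?_
  have hkm : ((k + 1 : ℕ) : ℝ) / (m + 1 : ℕ) ≤ 1 := by
    rw [div_le_one (by positivity)]
    exact_mod_cast (Nat.succ_lt_succ (Finset.mem_range.1 hk)).le
  rw [← Complex.exp_nat_mul, norm_sub_rev]
  have he : ((k + 1 : ℕ) : ℂ) * (2 * π * Complex.I / (m + 1 : ℕ)) =
      Complex.I * ((2 * (π * ((k + 1 : ℕ) / (m + 1 : ℕ))) : ℝ) : ℂ) := by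
    push_cast
    ring
  rw [he, Complex.norm_exp_I_mul_ofReal_sub_one, mul_div_cancel_left₀ _ (two_ne_zero' ℝ),
    Real.norm_of_nonneg]
  exact mul_nonneg zero_le_two (sin_nonneg_of_nonneg_of_le_pi (by positivity)
    (mul_le_of_le_one_right pi_pos.le hkm))

open Real in
/-- The case `z = 1` of the multiplication formula of Gauss, by the reflection formula. -/
lemma prod_Gamma_div_sq (m : ℕ) :
    (∏ k ∈ Finset.range m, Gamma ((k + 1 : ℕ) / (m + 1 : ℕ))) ^ 2 * (m + 1) = (2 * π) ^ m := by
  have hm : ((m + 1 : ℕ) : ℝ) ≠ 0 := by positivity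
  rw [sq]
  nth_rewrite 2 [← Finset.prod_range_reflect]
  rw [← prod_two_mul_sin, ← Finset.prod_mul_distrib, ← Finset.prod_mul_distrib,
    ← Finset.card_range m, ← Finset.prod_const, Finset.card_range]
  refine Finset.prod_congr rfl fun k hk => ?_
  have hk' := Finset.mem_range.1 hk
  have h1 : ((m - 1 - k + 1 : ℕ) : ℝ) / (m + 1 : ℕ) = 1 - (k + 1 : ℕ) / (m + 1 : ℕ) := by
    rw [eq_sub_iff_add_eq, ← add_div, div_eq_one_iff_eq hm, ← Nat.cast_add]
    congr 1
    omega
  have hs : 0 < sin (π * ((k + 1 : ℕ) / (m + 1 : ℕ))) := by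
    refine sin_pos_of_pos_of_lt_pi (by positivity) (mul_lt_of_lt_one_right pi_pos ?_)
    rw [div_lt_one (by positivity)]
    exact_mod_cast Nat.succ_lt_succ hk'
  rw [h1, Gamma_mul_Gamma_one_sub, mul_left_comm, div_mul_cancel₀ _ hs.ne']

open Real in
lemma two_pi_rpow_div_prod_Gamma {p : ℕ} (hp : 0 < p) :
    (2 * π) ^ (((p : ℝ) - 1) / 2) / (∏ i ∈ Finset.Icc 1 p, Gamma ((i : ℝ) / p)) = √p := by
  obtain ⟨m, rfl⟩ : ∃ m, p = m + 1 := ⟨p - 1, by omega⟩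
  have hprod : ∏ i ∈ Finset.Icc 1 (m + 1), Gamma ((i : ℝ) / (m + 1 : ℕ)) =
      ∏ k ∈ Finset.range m, Gamma ((k + 1 : ℕ) / (m + 1 : ℕ)) := by
    rw [← Finset.Ico_add_one_right_eq_Icc, Finset.prod_Ico_eq_prod_range,
      show m + 1 + 1 - 1 = m + 1 from rfl, Finset.prod_range_succ, add_comm 1 m,
      div_self (by positivity), Gamma_one, mul_one]
    simp only [add_comm 1]
  have hpos : 0 < ∏ k ∈ Finset.range m, Gamma ((k + 1 : ℕ) / (m + 1 : ℕ)) :=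
    Finset.prod_pos fun k _ => Gamma_pos_of_pos (by positivity)
  rw [hprod, div_eq_iff hpos.ne']
  refine (pow_left_inj₀ (by positivity) (by positivity) two_ne_zero).1 ?_
  rw [mul_pow, sq_sqrt (by positivity), mul_comm (_ : ℝ) (_ ^ 2), ← rpow_natCast, ← rpow_mul (by positivity)]
  push_cast
  rw [div_mul_cancel₀ _ (two_ne_zero' ℝ), add_sub_cancel_right, rpow_natCast]
  have h := prod_Gamma_div_sq m
  push_cast at h
  rw [h, mul_comm]

/-! ### The enumeration of hypermaps -/

theorem mainTheorem11 (p : ℕ) (hp : 2 ≤ p) :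
    (∃ G : ℕ+ → ℚ⟦X⟧,
      (∀ k : ℕ+, HasFormalSum (fun n : ℕ+ => logTerm p n k) (G k)) ∧
      HasFormalSum
        (fun k : ℕ+ => C ((ArithmeticFunction.moebius (k : ℕ) : ℚ) / ((k : ℕ) : ℚ)) * G k)
        (Hypermap.isoSeries p)) ∧
    (∀ N : ℕ, coeff N (Hypermap.isoSeries p) ≠ 0 ↔ ∃ k : ℕ, 1 ≤ k ∧ N = p * k) ∧
    Asymptotics.IsEquivalent Filter.atTop
      (fun k : ℕ => ((coeff (p * k) (Hypermap.isoSeries p) : ℚ) : ℝ))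
      (fun k : ℕ =>
        (2 * Real.pi) ^ (((p : ℝ) - 1) / 2) / (∏ i ∈ Finset.Icc 1 p, Real.Gamma ((i : ℝ) / p))
          * (k : ℝ) ^ (((p : ℝ) - 1) * k)
          * Real.exp (((p : ℝ) - 1) * (Real.log p - 1) * k)) := by
  have hp0 : 0 < p := by omega
  refine ⟨⟨_, fun k => hasFormalSum_logTerm hp0 k, hasFormalSum_isoSeries p⟩, fun N => ?_, ?_⟩
  · rw [Hypermap.isoSeries, coeff_mk, Nat.cast_ne_zero, numIsoClasses_ne_zero_iff hp0]
  · simp only [Hypermap.isoSeries, coeff_mk, Rat.cast_natCast]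
    rw [two_pi_rpow_div_prod_Gamma hp0]
    exact (numIsoClasses_isEquivalent_uniformCount hp).trans (uniformCount_isEquivalent hp0)
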